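/- **Setting.** Let $n\ge 1$ and let $L$ be an even lattice of signature $(2,n)$ with quadratic form $q$ and bilinear form $(x,y)=q(x+y)-q(x)-q(y)$. Let $e\in L$ be primitive isotropic, $e'\in L'$ with $(e,e')=1$, $\tilde e'=e'-q(e')e$, $V=L\otimes\mathbb Q$, $W(\mathbb R)=e^\perp\cap e'^\perp\subset V(\mathbb R)$, and let $b_1,\dots,b_n$ be an orthogonal basis of $W(\mathbb R)$ with $q(b_1)=\epsilon_1=1$, $q(b_j)=\epsilon_j=-1$ for $j\ge2$. Let $\mathbb H_n=\{Z=X+iY=\sum z_jb_j\in W(\mathbb C): q(Y)>0,\ y_1>0\}$ and $\psi(Z)=Z-q(Z)e+\tilde e'$. The group $O^+(V(\mathbb R))$ of isometries preserving $\mathbb H_n$ acts by $\gamma\psi(Z)=j(\gamma,Z)\psi(\gamma Z)$, $j(\gamma,Z)=(e,\gamma\psi(Z))$, and for a function or differential form $\alpha$ put $\alpha|_k\gamma=j(\gamma,Z)^{-k}\gamma^*\alpha$. For $\lambda\in V(\mathbb R)$ let $\lambda_{Z^+}$ be its orthogonal projection onto $Z^+=\langle\operatorname{Re}\psi(Z),\operatorname{Im}\psi(Z)\rangle$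 and $\lambda_{Z^-}=\lambda-\lambda_{Z^+}$. Let $h^{ij}=4y_iy_j-2q(Y)\epsilon_i\delta_{ij}$ (the inverse of $-\partial_i\bar\partial_j\log q(Y)$) and $d\mu=(4iq(Y))^{-n}\,dz_1\wedge d\bar z_1\wedge\dots\wedge dz_n\wedge d\bar z_n$. The antilinear Hodge operator $\bar*$ is defined by $\alpha\wedge\bar*\beta=\langle\alpha,\beta\rangle d\mu$, with the inner product normalised by $\langle d\bar z_i,d\bar z_j\rangle=\frac12h^{ij}$ and by $d\mu$ having norm $1$, i.e. $\langle dz_i,dz_j\rangle=8h^{ij}$ (so $\bar*1=d\mu$, $\bar*d\mu=1$, $\bar*\bar*=(-1)^k$ on $k$-forms). Put $\bar*_k=q(Y)^k\,\bar*$, $\xi_k=\bar*_k\bar\partial$ and $\Delta_k=\bar*_{-k}\bar\partial\,\bar*_k\bar\partial+\bar\partial\,\bar*_{-k}\bar\partial\,\bar*_k$; a form $H$ of weight $k$ is harmonic if $\Delta_kH=0$. Let $\Gamma\subseteq O^+(L)$ be a neat congruence subgroup and $\kappa>n$ an integer. For $\nu\in V$ with $q(\nu)<0$ let $\Gamma_\nu$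 be its stabiliser in $\Gamma$, $T_\nu=\{Z\in\mathbb H_n: q(\nu_{Z^+})=0\}$, $p_Z(\nu)=\xi_1\frac{(\nu,\psi(\overline Z))}{q(Y)}$, and, for $Z\notin T_\nu$, $$\tilde p_Z(\nu)=-\frac{(\nu,\psi(Z))^{\kappa-1}}{4^\kappa(\kappa-\frac n2)}\,\frac{p_Z(\nu)}{(-q(\nu_{Z^-}))^{n/2}}\;q(\nu_{Z^+})^{\frac n2-\kappa}\;F\!\Big(1-\tfrac n2,\kappa-\tfrac n2;\kappa-\tfrac n2+1;\tfrac{q(\nu)}{q(\nu_{Z^+})}\Big),$$ where $F$ is the principal branch of the Gauss hypergeometric function. Then $\tilde p_Z(\nu)$ is invariant under $|_{-\kappa}\gamma$ for $\gamma\in\Gamma_\nu$, so that the sums $$\Omega_\nu^{\rm mero}=\sum_{\gamma\in\Gamma_\nu\backslash\Gamma}\tilde p_Z(\nu)\big|_{-\kappa}\gamma,\qquad \omega_\nu^{\rm mero}=\sum_{\gamma\in\Gamma_\nu\backslash\Gamma}(\nu,\psi(Z))^{-\kappa}\big|_\kappa\gamma$$ are over well-defined terms. **Theorem.** For each $\nu\in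 V$ with $q(\nu)<0$, on the complement $U_\nu$ in $\mathbb H_n$ of the $\Gamma$-translates of $T_\nu$: 1. The series $\Omega_\nu^{\rm mero}$ converges absolutely and locally uniformly (the series of norms converges locally uniformly), and it defines a real analytic $(n,n-1)$-form with $\Omega_\nu^{\rm mero}|_{-\kappa}\gamma=\Omega_\nu^{\rm mero}$ for all $\gamma\in\Gamma$, i.e. a form with values in the line bundle $\mathcal L_{-\kappa}$ of modular forms of weight $-\kappa$. 2. The series $\omega_\nu^{\rm mero}$ converges, $\xi_{-\kappa}\Omega_\nu^{\rm mero}=\omega_\nu^{\rm mero}$, and $\Omega_\nu^{\rm mero}$ is harmonic: $\Delta_{-\kappa}\Omega_\nu^{\rm mero}=0$. In particular, $\xi_{-\kappa}$ maps the complex span of all $\Omega_\nu^{\rm mero}$ ($\nu\in V$, $q(\nu)<0$) onto the complex span of all $\omega_\nu^{\rm mero}$ ($\nu\in V$, $q(\nu)<0$), where functions are identified if they agree off the $\Gamma$-translates of finitely many such divisors $T_\nu$. -/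

import Mathlib

noncomputable section

namespace PolarHarmonic

/-! ## The quadratic space of signature `(2, n)` and the orthogonal upper half plane

Let `L` be an even lattice of signature `(2, n)` with `e ∈ L` primitive isotropic and `e' ∈ L'` with
`(e, e') = 1`; put `e'' = e' - q(e') e` and let `b_1, …, b_n` be an orthogonal basis of
`W(ℝ) = e^⊥ ∩ e'^⊥` with `q(b_1) = 1`, `q(b_j) = -1` for `j ≥ 2`.
Vectors of `V(ℝ) = L ⊗ ℝ` and `V(ℂ)` are written in the basis `e, e'', b_1, …, b_n`:
the triple `(x, y, w)` stands for `x e + y e'' + ∑ w_j b_j`. -/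

/-- Coordinates on `V ⊗ R` in the basis `e, e'', b_1, …, b_n`. -/
abbrev QSpace (n : ℕ) (R : Type) : Type := R × R × (Fin n → R)

/-- Linear automorphisms of `V(ℝ)`. -/
abbrev LinAut (n : ℕ) : Type := QSpace n ℝ ≃ₗ[ℝ] QSpace n ℝ

/-- Coordinates on `W(ℂ)`: the point `Z = ∑ z_j b_j`. -/
abbrev WC (n : ℕ) : Type := Fin n → ℂ

/-- The signs `ε_j = q(b_j)`: `+1` for the first basis vector and `-1` for the others. -/
def eps {n : ℕ} (R : Type) [CommRing R] (j : Fin n) : R := if (j : ℕ) = 0 then 1 else -1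

/-- The quadratic form on `W`. -/
def qW {n : ℕ} {R : Type} [CommRing R] (w : Fin n → R) : R := ∑ j, eps R j * w j ^ 2

/-- The quadratic form on `V`. -/
def qV {n : ℕ} {R : Type} [CommRing R] (x : QSpace n R) : R := x.1 * x.2.1 + qW x.2.2

/-- The bilinear form `(x, y) = q(x + y) - q(x) - q(y)` on `V`. -/
def bV {n : ℕ} {R : Type} [CommRing R] (x y : QSpace n R) : R :=
  x.1 * y.2.1 + x.2.1 * y.1 + 2 * ∑ j, eps R j * x.2.2 j * y.2.2 j

/-- The inclusion `V(ℝ) → V(ℂ)`. -/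
def toC {n : ℕ} (x : QSpace n ℝ) : QSpace n ℂ := ((x.1 : ℂ), (x.2.1 : ℂ), fun j => (x.2.2 j : ℂ))

/-- Real part of a vector of `V(ℂ)`. -/
def reV {n : ℕ} (w : QSpace n ℂ) : QSpace n ℝ := (w.1.re, w.2.1.re, fun j => (w.2.2 j).re)

/-- Imaginary part of a vector of `V(ℂ)`. -/
def imV {n : ℕ} (w : QSpace n ℂ) : QSpace n ℝ := (w.1.im, w.2.1.im, fun j => (w.2.2 j).im)

/-- The imaginary part `Y` of `Z = X + iY`. -/
def imW {n : ℕ} (Z : WC n) : Fin n → ℝ := fun j => (Z j).im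

/-- `Z ↦ conj Z` on `W(ℂ)`. -/
def conjW {n : ℕ} (Z : WC n) : WC n := fun j => (starRingEnd ℂ) (Z j)

/-- The orthogonal upper half plane: the component `y_1 > 0` of `{Z = X + iY : q(Y) > 0}`. -/
def upperHalf (n : ℕ) : Set (WC n) :=
  {Z | 0 < qW (imW Z) ∧ ∀ j : Fin n, (j : ℕ) = 0 → 0 < (Z j).im}

/-- `ψ(Z) = Z - q(Z) e + e''`. -/
def psi {n : ℕ} (Z : WC n) : QSpace n ℂ := (-qW Z, 1, Z)

/-- The linear functional `(λ, ψ(Z))`, for a real vector `λ`. -/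
def pairPsi {n : ℕ} (l : QSpace n ℝ) (Z : WC n) : ℂ := bV (toC l) (psi Z)

/-- Complex linear extension of a real linear automorphism of `V(ℝ)` to `V(ℂ)`. -/
def extC {n : ℕ} (g : LinAut n) (w : QSpace n ℂ) : QSpace n ℂ :=
  toC (g (reV w)) + Complex.I • toC (g (imV w))

/-- The factor of automorphy `j(σ, Z) = (e, σ ψ(Z))`. -/
def autFactor {n : ℕ} (g : LinAut n) (Z : WC n) : ℂ :=
  bV ((1, 0, 0) : QSpace n ℂ) (extC g (psi Z))

/-- The action on the upper half plane, determined by `σ ψ(Z) = j(σ, Z) ψ(σ Z)`. -/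
def act {n : ℕ} (g : LinAut n) (Z : WC n) : WC n :=
  (autFactor g Z)⁻¹ • (extC g (psi Z)).2.2

/-- Orthogonal projection `λ_{Z^+}` of `λ` onto the positive definite plane `Z^+` spanned by the
(orthogonal) real and imaginary parts of `ψ(Z)`. -/
def projPlus {n : ℕ} (l : QSpace n ℝ) (Z : WC n) : QSpace n ℝ :=
  (bV l (reV (psi Z)) / bV (reV (psi Z)) (reV (psi Z))) • reV (psi Z) +
    (bV l (imV (psi Z)) / bV (imV (psi Z)) (imV (psi Z))) • imV (psi Z)

/-- `q(λ_{Z^+})`. -/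
def qPlus {n : ℕ} (l : QSpace n ℝ) (Z : WC n) : ℝ := qV (projPlus l Z)

/-- `q(λ_{Z^-})`, where `λ_{Z^-}` is the projection of `λ` onto the orthogonal complement of `Z^+`. -/
def qMinus {n : ℕ} (l : QSpace n ℝ) (Z : WC n) : ℝ := qV (l - projPlus l Z)

/-- The special divisor `T_ν = {Z : q(ν_{Z^+}) = 0}`. -/
def specialDivisor {n : ℕ} (v : QSpace n ℝ) : Set (WC n) := {Z ∈ upperHalf n | qPlus v Z = 0}

/-! ## Lattices and neat congruence subgroups -/

/-- `L` is an even lattice in `V(ℝ)` with `e ∈ L` primitive, and there is a dual vector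
`e' ∈ L'` of the form `e' = e'' + q(e') e`. -/
structure IsAdmissibleLattice {n : ℕ} (L : Submodule ℤ (QSpace n ℝ)) : Prop where
  discrete : DiscreteTopology L
  spans : Submodule.span ℝ (L : Set (QSpace n ℝ)) = ⊤
  even : ∀ x ∈ L, ∃ k : ℤ, qV x = k
  e_mem : ((1, 0, 0) : QSpace n ℝ) ∈ L
  e_primitive : ∀ x ∈ L, ∀ k : ℤ, k • x = ((1, 0, 0) : QSpace n ℝ) → IsUnit k
  exists_dual : ∃ r : ℝ, ∀ x ∈ L, ∃ k : ℤ, bV ((r, 1, 0) : QSpace n ℝ) x = k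

/-- Membership in the rational space `V = L ⊗ ℚ`. -/
def IsRationalVec {n : ℕ} (L : Submodule ℤ (QSpace n ℝ)) (v : QSpace n ℝ) : Prop :=
  ∃ N : ℤ, N ≠ 0 ∧ N • v ∈ L

/-- `O^+(V(ℝ))`: isometries that preserve the component `upperHalf n`. -/
def IsOPlus {n : ℕ} (g : LinAut n) : Prop :=
  (∀ x, qV (g x) = qV x) ∧ ∀ Z ∈ upperHalf n, act g Z ∈ upperHalf n

/-- `O^+(L) = O(L) ∩ O^+(V(ℝ))`. -/
def IsOPlusLattice {n : ℕ} (L : Submodule ℤ (QSpace n ℝ)) (g : LinAut n) :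
    Prop :=
  IsOPlus g ∧ ∀ x, g x ∈ L ↔ x ∈ L

/-- A congruence subgroup: a subgroup of `O^+(L)` that contains, for some `N ≥ 1`, all elements of
`O^+(L)` which act trivially on `L / N L`. -/
def IsCongruenceSubgroup {n : ℕ} (L : Submodule ℤ (QSpace n ℝ))
    (Γ : Subgroup (LinAut n)) : Prop :=
  (∀ g ∈ Γ, IsOPlusLattice L g) ∧
    ∃ N : ℕ, 0 < N ∧ ∀ g : LinAut n, IsOPlusLattice L g →
      (∀ x ∈ L, ∃ y ∈ L, g x - x = N • y) → g ∈ Γ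

/-- Neatness: for each `γ ∈ Γ` the subgroup of `ℂˣ` generated by the eigenvalues of `γ` is
torsion-free. -/
def IsNeat {n : ℕ} (Γ : Subgroup (LinAut n)) : Prop :=
  ∀ g ∈ Γ, ∀ u ∈ Subgroup.closure {u : ℂˣ |
      ((g : QSpace n ℝ →ₗ[ℝ] QSpace n ℝ).charpoly.map (algebraMap ℝ ℂ)).IsRoot (u : ℂ)},
    ∀ k : ℕ, 0 < k → u ^ k = 1 → u = 1

/-- The union of the `Γ`-translates of `T_ν`. -/
def singularSet {n : ℕ} (Γ : Subgroup (LinAut n)) (v : QSpace n ℝ) :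
    Set (WC n) :=
  {Z | ∃ g ∈ Γ, ∃ Z₀ ∈ specialDivisor v, Z = act g Z₀}

/-- The complement of the singularities in the upper half plane. -/
def regularSet {n : ℕ} (Γ : Subgroup (LinAut n)) (v : QSpace n ℝ) :
    Set (WC n) :=
  upperHalf n \ singularSet Γ v

/-! ## Differential forms, the Hodge star and the operator `ξ` -/

/-- Complex valued alternating `k`-forms on the (real) tangent space `W(ℂ)`. A differential `k`-form
is a function `WC n → Form n k`. -/
abbrev Form (n k : ℕ) : Type := (WC n) [⋀^Fin k]→L[ℝ] ℂ

/-- A number as a form of degree `0`. -/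
def zeroForm (n : ℕ) (c : ℂ) : Form n 0 := ContinuousAlternatingMap.constOfIsEmpty ℝ (WC n) (Fin 0) c

/-- Type `(p, q)`: the degree is `p + q` and `α(c v_1, …, c v_k) = c^p (conj c)^q α(v_1, …, v_k)`
for all complex `c`. -/
def IsOfType {n k : ℕ} (p q : ℕ) (α : Form n k) : Prop :=
  k = p + q ∧ ∀ (c : ℂ) (v : Fin k → WC n),
    α (fun i => c • v i) = c ^ p * (starRingEnd ℂ) c ^ q * α v

/-- Multiplication by `i` on `W(ℂ)` as a real linear map. -/
def mulI (n : ℕ) : WC n →L[ℝ] WC n :=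
  (Complex.I • ContinuousLinearMap.id ℂ (WC n)).restrictScalars ℝ

/-- The operator `∂̄ α = ∑_j d conj(z_j) ∧ ∂α/∂conj(z_j)`: the alternation of the antilinear part
`v ↦ (D_v α + i D_{iv} α) / 2` of the derivative of `α`. -/
def dbar {n k : ℕ} (α : WC n → Form n k) (Z : WC n) : Form n (k + 1) :=
  ContinuousAlternatingMap.alternatizeUncurryFin
    ((1 / 2 : ℂ) • (fderiv ℝ α Z + Complex.I • (fderiv ℝ α Z).comp (mulI n)))

/-- `h^{ij}(Y) = 4 y_i y_j - 2 q(Y) ε_i δ_{ij}`, the inverse of the matrix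
`h_{ij} = -∂_i ∂̄_j log q(Y)` of the invariant hermitian metric. -/
def metricInv {n : ℕ} (Y : Fin n → ℝ) (i j : Fin n) : ℝ :=
  4 * Y i * Y j - if i = j then 2 * qW Y * eps ℝ i else 0

/-- The determinant of the rows as a continuous alternating map. -/
def detForm (N : ℕ) : (Fin N → ℂ) [⋀^Fin N]→L[ℂ] ℂ :=
  { (Matrix.detRowAlternating : (Fin N → ℂ) [⋀^Fin N]→ₗ[ℂ] ℂ) with
    cont := by
      change Continuous (fun v : Fin N → Fin N → ℂ => Matrix.det v)
      exact Continuous.matrix_det continuous_id }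

/-- The list of one-forms `dz_1, d conj(z_1), …, dz_n, d conj(z_n)`, as a real linear map. -/
def coframe {n N : ℕ} (h : N = 2 * n) : WC n →L[ℝ] (Fin N → ℂ) :=
  ContinuousLinearMap.pi fun a =>
    if (a : ℕ) % 2 = 0 then
      ContinuousLinearMap.proj (R := ℝ) (φ := fun _ : Fin n => ℂ) ⟨(a : ℕ) / 2, by omega⟩
    else
      (Complex.conjCLE : ℂ →L[ℝ] ℂ).comp
        (ContinuousLinearMap.proj (R := ℝ) (φ := fun _ : Fin n => ℂ) ⟨(a : ℕ) / 2, by omega⟩)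

/-- The invariant volume form
`dμ(Z) = (4 i q(Y))^{-n} dz_1 ∧ d conj(z_1) ∧ … ∧ dz_n ∧ d conj(z_n)`. -/
def volForm {n N : ℕ} (h : N = 2 * n) (Z : WC n) : Form n N :=
  ((4 * Complex.I * ((qW (imW Z) : ℝ) : ℂ)) ^ n)⁻¹ •
    ((detForm N).restrictScalars ℝ).compContinuousLinearMap (coframe h)

/-- The iterated interior product: `(contract k ω v)(w) = ω(v_1, …, v_k, w_1, …, w_l)`. -/
def contract {n l : ℕ} : (k : ℕ) → Form n (l + k) → (Fin k → WC n) → Form n l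
  | 0, ω, _ => ω
  | k + 1, ω, v => contract (l := l) k (ContinuousAlternatingMap.curryLeft (n := l + k) ω (v 0))
      (Fin.tail v)

/-- The real basis `b_1, i b_1, …, b_n, i b_n` of the tangent space. -/
def frame {n : ℕ} (a : Fin n × Fin 2) : WC n :=
  Pi.single a.1 (if a.2 = 0 then 1 else Complex.I)

/-- The basis dual to `frame` for the Riemannian metric whose inner product on one-forms is
`⟨α, β⟩ = ∑ (h^{ij} / 4) (α(b_i) conj β(b_j) + α(i b_i) conj β(i b_j))`,
that is, `⟨d conj(z_i), d conj(z_j)⟩ = h^{ij} / 2`. -/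
def dualFrame {n : ℕ} (Z : WC n) (a : Fin n × Fin 2) : WC n :=
  fun j => ((metricInv (imW Z) a.1 j / 4 : ℝ) : ℂ) * (if a.2 = 0 then 1 else Complex.I)

/-- The (antilinear) Hodge star operator `*̄` on forms of degree `k` and type `(p, k - p)`, given by
`α ∧ *̄β = ⟨α, β⟩ dμ`. Here the inner product on forms is normalised by
`⟨d conj(z_i), d conj(z_j)⟩ = h^{ij} / 2`, and by the requirement that `dμ` has norm one (so that
`*̄ 1 = dμ`, `*̄ dμ = 1` and `*̄ *̄ = (-1)^k`). As `dμ` is `4^{-n}` times the unit volume form of the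
metric in `dualFrame`, this means that the inner product of that metric is multiplied by `16^p` on
forms of type `(p, q)`. -/
def starBar {n k l : ℕ} (p : ℕ) (h : l + k = 2 * n) (β : WC n → Form n k) (Z : WC n) : Form n l :=
  ((16 : ℂ) ^ p / (k.factorial : ℂ)) • ∑ a : Fin k → Fin n × Fin 2,
    (starRingEnd ℂ) (β Z fun t => frame (a t)) •
      contract k (volForm h Z) (fun t => dualFrame Z (a t))

/-- The weight `κ` Hodge operator `*̄_κ(φ F) = (*̄ φ) conj(F) q(Y)^κ`. -/
def starW {n k l : ℕ} (κ : ℤ) (p : ℕ) (h : l + k = 2 * n) (β : WC n → Form n k) (Z : WC n) :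
    Form n l :=
  (((qW (imW Z) : ℝ) : ℂ) ^ κ) • starBar p h β Z

/-- The operator `ξ_κ = *̄_κ ∂̄` on forms of degree `k` and type `(p, k - p)`. -/
def xi {n k l : ℕ} (κ : ℤ) (p : ℕ) (h : l + (k + 1) = 2 * n) (α : WC n → Form n k) :
    WC n → Form n l :=
  starW κ p h (dbar α)

/-- The weight `κ` Laplace operator `Δ_κ = *̄_{-κ} ∂̄ *̄_κ ∂̄ + ∂̄ *̄_{-κ} ∂̄ *̄_κ` on forms of positive
degree `k + 1` and type `(p, k + 1 - p)`, where `k + 1 < 2 n`. -/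
def laplace {n k l : ℕ} (κ : ℤ) (p : ℕ) (h : k + l + 2 = 2 * n) (α : WC n → Form n (k + 1))
    (Z : WC n) : Form n (k + 1) :=
  starW (l := k + 1) (k := l + 1) (-κ) (n - p) (by omega)
      (dbar (starW (l := l) (k := k + 1 + 1) κ p (by omega) (dbar α))) Z +
    dbar (starW (l := k) (k := l + 1 + 1) (-κ) (n - p) (by omega)
      (dbar (starW (l := l + 1) (k := k + 1) κ p (by omega) α))) Z

/-- The weight `κ` slash operator on functions. -/
def slashFun {n : ℕ} (κ : ℤ) (g : LinAut n) (f : WC n → ℂ) (Z : WC n) : ℂ :=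
  autFactor g Z ^ (-κ) * f (act g Z)

/-- The weight `κ` slash operator on differential forms: `j(σ, Z)^{-κ}` times the pullback. -/
def slashForm {n k : ℕ} (κ : ℤ) (g : LinAut n) (α : WC n → Form n k)
    (Z : WC n) : Form n k :=
  (autFactor g Z ^ (-κ)) • (α (act g Z)).compContinuousLinearMap (fderiv ℝ (act g) Z)

/-! ## Polar harmonic Maass forms

From here on `n = m + 1`, so that forms of type `(n, n - 1)` have degree `2 * m + 1`. -/

/-- `ξ_κ` from forms of type `(n, n - 1)` to functions (forms of degree `0`). -/
def xiTop {m : ℕ} (κ : ℤ) (α : WC (m + 1) → Form (m + 1) (2 * m + 1)) :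
    WC (m + 1) → Form (m + 1) 0 :=
  xi κ (m + 1) (by omega) α

/-- `Δ_κ` on forms of type `(n, n - 1)`. -/
def laplaceTop {m : ℕ} (κ : ℤ) (α : WC (m + 1) → Form (m + 1) (2 * m + 1)) :
    WC (m + 1) → Form (m + 1) (2 * m + 1) :=
  laplace (k := 2 * m) (l := 0) κ (m + 1) (by omega) α

/-- The principal branch of the Gauss hypergeometric function `F(a, b; c; x)` for real parameters
with `c > b > 0` and real `x < 1`, by Euler's integral. -/
def gaussF (a b c x : ℝ) : ℝ :=
  Real.Gamma c / (Real.Gamma b * Real.Gamma (c - b)) *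
    ∫ t in (0 : ℝ)..1, t ^ (b - 1) * (1 - t) ^ (c - b - 1) * (1 - x * t) ^ (-a)

/-- The form `p_Z(λ) = ξ_1 ((λ, ψ(conj Z)) / q(Y))` of type `(n, n - 1)`. -/
def pForm {m : ℕ} (l : QSpace (m + 1) ℝ) : WC (m + 1) → Form (m + 1) (2 * m + 1) :=
  xi (k := 0) 1 0 (by omega) fun Z =>
    zeroForm (m + 1) (pairPsi l (conjW Z) / ((qW (imW Z) : ℝ) : ℂ))

/-- The form `p̃_Z(λ)` of weight `-κ`, for `q(λ) < 0`:
`(λ, ψ(Z))^{κ-1} / ((-1)^{n/2-1} 4^κ (κ - n/2)) · p_Z(λ) / q(λ_{Z^-})^{n/2} · q(λ_{Z^+})^{n/2-κ}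
· F(1 - n/2, κ - n/2; κ - n/2 + 1; q(λ) / q(λ_{Z^+}))`.
Since `q(λ_{Z^-}) < 0`, the factor `(-1)^{n/2-1} q(λ_{Z^-})^{n/2}` is read as
`-(-q(λ_{Z^-}))^{n/2}`. -/
def pTilde {m : ℕ} (κ : ℤ) (l : QSpace (m + 1) ℝ) (Z : WC (m + 1)) :
    Form (m + 1) (2 * m + 1) :=
  let s : ℝ := ((m + 1 : ℕ) : ℝ) / 2
  (pairPsi l Z ^ (κ - 1) *
    ((-(1 / ((4 : ℝ) ^ κ * (κ - s))) * (-qMinus l Z) ^ (-s) * qPlus l Z ^ (s - κ) *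
      gaussF (1 - s) (κ - s) (κ - s + 1) (qV l / qPlus l Z) : ℝ) : ℂ)) • pForm l Z

/-- The set `Γ_ν \ Γ` of cosets `Γ_ν γ`, where `Γ_ν` is the stabiliser of `ν` in `Γ`. -/
abbrev Cosets {m : ℕ} (Γ : Subgroup (LinAut (m + 1)))
    (v : QSpace (m + 1) ℝ) : Type :=
  Quotient (QuotientGroup.rightRel (MulAction.stabilizer Γ v))

/-- The summand `p̃_Z(ν)|_{-κ} γ` of the coset `Γ_ν γ`. -/
def polarTerm {m : ℕ} (κ : ℤ)
    (Γ : Subgroup (LinAut (m + 1))) (v : QSpace (m + 1) ℝ) (c : Cosets Γ v) :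
    WC (m + 1) → Form (m + 1) (2 * m + 1) :=
  slashForm (-κ) (c.out : LinAut (m + 1)) (pTilde κ v)

/-- `Ω_ν^mero(Z) = ∑_{γ ∈ Γ_ν \ Γ} p̃_Z(ν)|_{-κ} γ`. -/
def polarMaass {m : ℕ} (κ : ℤ)
    (Γ : Subgroup (LinAut (m + 1))) (v : QSpace (m + 1) ℝ)
    (Z : WC (m + 1)) : Form (m + 1) (2 * m + 1) :=
  ∑' c : Cosets Γ v, polarTerm κ Γ v c Z

/-- The summand `(ν, ψ(Z))^{-κ}|_κ γ` of the coset `Γ_ν γ`. -/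
def meroTerm {m : ℕ} (κ : ℤ) (Γ : Subgroup (LinAut (m + 1))) (v : QSpace (m + 1) ℝ)
    (c : Cosets Γ v) : WC (m + 1) → ℂ :=
  slashFun κ (c.out : LinAut (m + 1)) fun Z => 1 / pairPsi v Z ^ κ

/-- `ω_ν^mero(Z) = ∑_{γ ∈ Γ_ν \ Γ} (ν, ψ(Z))^{-κ}|_κ γ`. -/
def meroForm {m : ℕ} (κ : ℤ) (Γ : Subgroup (LinAut (m + 1))) (v : QSpace (m + 1) ℝ)
    (Z : WC (m + 1)) : ℂ :=
  ∑' c : Cosets Γ v, meroTerm κ Γ v c Z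

/-- The space of polar harmonic Maass forms, spanned by `Ω_ν^mero` for `ν ∈ V`, `q(ν) < 0`. -/
def polarSpace {m : ℕ} (κ : ℤ) (L : Submodule ℤ (QSpace (m + 1) ℝ))
    (Γ : Subgroup (LinAut (m + 1))) :
    Submodule ℂ (WC (m + 1) → Form (m + 1) (2 * m + 1)) :=
  Submodule.span ℂ {F | ∃ v, IsRationalVec L v ∧ qV v < 0 ∧ F = polarMaass κ Γ v}

/-- The space spanned by `ω_ν^mero` for `ν ∈ V`, `q(ν) < 0`. -/
def meroSpace {m : ℕ} (κ : ℤ) (L : Submodule ℤ (QSpace (m + 1) ℝ))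
    (Γ : Subgroup (LinAut (m + 1))) :
    Submodule ℂ (WC (m + 1) → ℂ) :=
  Submodule.span ℂ {f | ∃ v, IsRationalVec L v ∧ qV v < 0 ∧ f = meroForm κ Γ v}

/-- Equality on the upper half plane away from the `Γ`-translates of finitely many special
divisors. -/
def EqAwayFromDivisors {m : ℕ} {X : Type} (L : Submodule ℤ (QSpace (m + 1) ℝ))
    (Γ : Subgroup (LinAut (m + 1))) (f g : WC (m + 1) → X) : Prop :=
  ∃ s : Set (QSpace (m + 1) ℝ), s.Finite ∧ (∀ v ∈ s, IsRationalVec L v ∧ qV v < 0) ∧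
    ∀ Z ∈ upperHalf (m + 1), (∀ v ∈ s, Z ∉ singularSet Γ v) → f Z = g Z

end PolarHarmonic

end

open PolarHarmonic

/-! For a vector `l` of negative norm put P = (l, ψ(Z)), f = (l, ψ(conj Z)) / q(Y) and θ = ∂̄f. The
form p̃_Z(l) is the weight κ Hodge dual of a (0,1)-form β = a θ (`pTilde_eq_starOne`), whose
amplitude a is P^(-κ) f⁻¹ times a function S of the single variable x = q(l)/q(l_{Z^+}) = 4 q(l)/(P
f), up to a constant. Since P is holomorphic, ∂̄a is a multiple of θ; as θ is ∂̄-exact, β is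
∂̄-closed (`dbar_oneForm_betaV`). The form ∂̄ *̄_κ β is a divergence, and computing it leaves a
first order linear differential equation for S. The hypergeometric profile solves exactly this
equation (`hasDerivAt_profile`), and the result is `dbar_starOne_betaV`, which says that ξ_{-κ}
p̃_Z(l) = P^(-κ). Harmonicity follows: one half of the Laplacian differentiates the holomorphic
function P^(-κ), the other half recovers -β from its dual because *̄ *̄ = -1 on one-forms
(`starBar_starBar_one`), and β is closed.

Isometries act compatibly: f has a holomorphic factor of automorphy, so θ transforms simply
(`sum_theta_act`). Because the covectors θ_l span and their hermitian products depend only on the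
pairings (`sum_theta_mul_conj_grad`), the metric and its dual vectors are equivariant as well; the
derivative of the action is never written out. Hence p̃(ν)|γ = p̃(γ⁻¹ν) (`slashForm_pTilde`), the
terms of Ω depend only on the coset, and Ω is a sum over the orbit of ν, a set of vectors of one
fixed negative norm in a multiple of the lattice.

Convergence rests on two facts. The majorant 2 q(l_{Z^+}) - q(l) is positive definite
(`exists_majorant`), so off the divisors |P| is at least a constant times ‖l‖, and the summands are
of size ‖l‖^(-κ). The sum of ‖l‖^(-κ) over lattice vectors of fixed nonzero norm converges for κ > n
(`IsAdmissibleLattice.summable`): with a hyperbolic pair e, e' split off, the projection to the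
n-dimensional complement determines the product of the integers (l, e) and (l, e'), so a divisor
bound controls the fibres; the vectors orthogonal to e or e' are counted by a second projection.

Real analyticity and termwise differentiation come from treating all normalised summands at once as
one analytic map into the Banach algebra of bounded functions on the index set. The sum is then this
map followed by a continuous linear functional (`UniformAnalyticAt.normalSumAt`), so ∂̄, ξ and the
Laplacian pass to the sum. -/

namespace PolarHarmonic

open Module

noncomputable section

/-! ## Determinants on the real tangent space -/

/-- Such maps `b` are the embeddings of `Fin k` into the `k`-element complement of `c`. -/
theorem card_injective_cons {k : ℕ} (c : Fin (k + 1)) :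
    (Finset.univ.filter fun b : Fin k → Fin (k + 1) =>
      Function.Injective (Fin.cons c b : Fin (k + 1) → Fin (k + 1))).card = k.factorial := by
  classical
  rw [← Fintype.card_subtype]
  have e : {b : Fin k → Fin (k + 1) //
      Function.Injective (Fin.cons c b : Fin (k + 1) → Fin (k + 1))} ≃
      (Fin k ↪ {d : Fin (k + 1) // d ≠ c}) :=
    { toFun := fun b => ⟨fun i => ⟨b.1 i, fun h =>
          (Fin.cons_injective_iff.1 b.2).1 ⟨i, h⟩⟩, fun i j h =>
          (Fin.cons_injective_iff.1 b.2).2 (congrArg Subtype.val h)⟩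
      invFun := fun f => ⟨fun i => (f i).1, Fin.cons_injective_iff.2
          ⟨fun ⟨i, hi⟩ => (f i).2 hi, fun i j h => f.injective (Subtype.ext h)⟩⟩
      left_inv := fun b => rfl
      right_inv := fun f => rfl }
  rw [Fintype.card_congr e, Fintype.card_embedding_eq]
  simp [Nat.descFactorial_self]

/-- Orthogonality of contractions of a volume form: contracting with all `k`-tuples of basis vectors
turns products of determinants into the Euclidean inner product. This evaluates the sum over frames
that arises when the Hodge star is applied twice to a one-form. -/
theorem sum_det_cons_mul_det_cons {E : Type*} [AddCommGroup E] [Module ℝ E] {k : ℕ}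
    (B : Basis (Fin (k + 1)) ℝ E) (x y : E) :
    ∑ b : Fin k → Fin (k + 1), B.det (Fin.cons x (B ∘ b)) * B.det (Fin.cons y (B ∘ b)) =
      k.factorial * ∑ c, B.repr x c * B.repr y c := by
  classical
  have hexp : ∀ (x : E) (b : Fin k → Fin (k + 1)),
      B.det (Fin.cons x (B ∘ b)) =
        ∑ c, B.repr x c * B.det (B ∘ (Fin.cons c b : Fin (k + 1) → Fin (k + 1))) := by
    intro x b
    let f : E →ₗ[ℝ] ℝ :=
      { toFun := fun z => B.det (Fin.cons z (B ∘ b))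
        map_add' := fun z w => congrArg (fun F => F (B ∘ b))
          (map_add (AlternatingMap.curryLeft B.det) z w)
        map_smul' := fun r z => congrArg (fun F => F (B ∘ b))
          (map_smul (AlternatingMap.curryLeft B.det) r z) }
    change f x = _
    conv_lhs => rw [← B.sum_repr x]
    rw [map_sum]
    refine Finset.sum_congr rfl fun c _ => ?_
    rw [map_smul, smul_eq_mul]
    congr 1
    change B.det (Fin.cons (B c) (B ∘ b)) = _
    rw [Fin.comp_cons]
  have hinj : ∀ a : Fin (k + 1) → Fin (k + 1), ¬ Function.Injective a → B.det (B ∘ a) = 0 := by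
    intro a ha
    apply AlternatingMap.map_eq_zero_of_not_injective
    exact fun h => ha h.of_comp
  have hsq : ∀ a : Fin (k + 1) → Fin (k + 1), Function.Injective a →
      B.det (B ∘ a) * B.det (B ∘ a) = 1 := by
    intro a ha
    let σ : Equiv.Perm (Fin (k + 1)) :=
      Equiv.ofBijective a (Finite.injective_iff_bijective.1 ha)
    change B.det (B ∘ σ) * B.det (B ∘ σ) = 1
    rw [AlternatingMap.map_perm, B.det_self]
    rcases Int.units_eq_one_or (Equiv.Perm.sign σ) with h | h <;> simp [h]
  have hcd : ∀ c d : Fin (k + 1), ∑ b : Fin k → Fin (k + 1),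
      B.det (B ∘ (Fin.cons c b : Fin (k + 1) → Fin (k + 1))) *
        B.det (B ∘ (Fin.cons d b : Fin (k + 1) → Fin (k + 1))) =
      if c = d then (k.factorial : ℝ) else 0 := by
    intro c d
    split_ifs with h
    · subst h
      rw [← card_injective_cons c, Finset.card_filter, Nat.cast_sum]
      refine Finset.sum_congr rfl fun b _ => ?_
      split_ifs with hb
      · rw [hsq _ hb]; simp
      · rw [hinj _ hb]; simp
    · refine Finset.sum_eq_zero fun b _ => ?_
      -- An injective completion of `b` by `c` is surjective, so `d` is `c` or a value of `b`; both
      -- are impossible if the completion by `d` is injective too.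
      by_cases hc : Function.Injective (Fin.cons c b : Fin (k + 1) → Fin (k + 1))
      · by_cases hd : Function.Injective (Fin.cons d b : Fin (k + 1) → Fin (k + 1))
        · exfalso
          obtain ⟨i, hi⟩ := (Finite.injective_iff_bijective.1 hc).2 d
          refine Fin.cases (fun hi => ?_) (fun i hi => ?_) i hi
          · exact h (by simpa using hi)
          · exact (Fin.cons_injective_iff.1 hd).1 ⟨i, by simpa using hi⟩
        · rw [hinj _ hd, mul_zero]
      · rw [hinj _ hc, zero_mul]
  calc _ = ∑ b : Fin k → Fin (k + 1), ∑ c, ∑ d, (B.repr x c * B.repr y d) *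
        (B.det (B ∘ (Fin.cons c b : Fin (k + 1) → Fin (k + 1))) *
        B.det (B ∘ (Fin.cons d b : Fin (k + 1) → Fin (k + 1)))) := by
          refine Finset.sum_congr rfl fun b _ => ?_
          rw [hexp x, hexp y, Finset.sum_mul_sum]
          refine Finset.sum_congr rfl fun c _ => Finset.sum_congr rfl fun d _ => by ring
    _ = ∑ c, ∑ d, (B.repr x c * B.repr y d) * ∑ b : Fin k → Fin (k + 1),
        (B.det (B ∘ (Fin.cons c b : Fin (k + 1) → Fin (k + 1))) *
        B.det (B ∘ (Fin.cons d b : Fin (k + 1) → Fin (k + 1)))) := by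
          rw [Finset.sum_comm]
          refine Finset.sum_congr rfl fun c _ => ?_
          rw [Finset.sum_comm]
          refine Finset.sum_congr rfl fun d _ => ?_
          rw [Finset.mul_sum]
    _ = _ := by
          simp only [hcd, mul_ite, mul_zero, Finset.sum_ite_eq, Finset.mem_univ, if_true]
          rw [Finset.mul_sum]
          exact Finset.sum_congr rfl fun c _ => by ring

/-- Only permutations contribute, each with the square of its sign. This normalises the Hodge star
in top degree. -/
theorem sum_det_mul_self {E : Type*} [AddCommGroup E] [Module ℝ E] {N : ℕ}
    (B : Basis (Fin N) ℝ E) :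
    ∑ a : Fin N → Fin N, B.det (B ∘ a) * B.det (B ∘ a) = N.factorial := by
  classical
  have key : ∀ a : Fin N → Fin N, B.det (B ∘ a) * B.det (B ∘ a) =
      if Function.Injective a then 1 else 0 := by
    intro a
    split_ifs with ha
    · let σ : Equiv.Perm (Fin N) :=
        Equiv.ofBijective a (Finite.injective_iff_bijective.1 ha)
      change B.det (B ∘ σ) * B.det (B ∘ σ) = 1
      rw [AlternatingMap.map_perm, B.det_self]
      rcases Int.units_eq_one_or (Equiv.Perm.sign σ) with h | h <;> simp [h]
    · rw [AlternatingMap.map_eq_zero_of_not_injective _ _ fun h => ha h.of_comp, mul_zero]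
  simp only [key]
  rw [← Nat.cast_one, ← Nat.cast_zero]
  simp only [← Nat.cast_ite]
  rw [← Nat.cast_sum, ← Finset.card_filter, ← Fintype.card_subtype]
  rw [Fintype.card_congr (Equiv.subtypeInjectiveEquivEmbedding (Fin N) (Fin N)),
    Fintype.card_embedding_eq]
  simp [Nat.descFactorial_self]

/-- The real basis `b_1, i b_1, …, b_n, i b_n`, in this order. -/
def realBasis {n N : ℕ} (h : N = 2 * n) : Basis (Fin N) ℝ (WC n) :=
  ((Pi.basis fun _ : Fin n => Complex.basisOneI).reindex
    (Equiv.sigmaEquivProd (Fin n) (Fin 2))).reindex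
      (finProdFinEquiv.trans (finCongr (by omega)))

/-- The enumeration of `frame` used for `realBasis`. -/
def frameIndex {n N : ℕ} (h : N = 2 * n) : Fin N ≃ Fin n × Fin 2 :=
  (finCongr (by omega : N = n * 2)).trans finProdFinEquiv.symm

theorem realBasis_apply {n N : ℕ} (h : N = 2 * n) (a : Fin N) :
    realBasis h a = frame (frameIndex h a) := by
  subst h
  obtain ⟨a, rfl⟩ := (frameIndex (n := n) rfl).symm.surjective a
  rw [Equiv.apply_symm_apply]
  obtain ⟨i, j⟩ := a
  have : realBasis (n := n) rfl ((frameIndex rfl).symm (i, j)) =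
      (Pi.basis fun _ : Fin n => Complex.basisOneI) ⟨i, j⟩ := by
    simp [realBasis, frameIndex]
  rw [this, Pi.basis_apply]
  unfold frame
  fin_cases j <;> simp

/-- The form `dz_1 ∧ d conj(z_1) ∧ … ∧ dz_n ∧ d conj(z_n)`. -/
def detZ {n N : ℕ} (h : N = 2 * n) : Form n N :=
  ((detForm N).restrictScalars ℝ).compContinuousLinearMap (coframe h)

theorem volForm_eq {n N : ℕ} (h : N = 2 * n) (Z : WC n) :
    volForm h Z = ((4 * Complex.I * ((qW (imW Z) : ℝ) : ℂ)) ^ n)⁻¹ • detZ h := rfl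

theorem detZ_eq {n N : ℕ} (h : N = 2 * n) (v : Fin N → WC n) :
    detZ h v = detZ h (realBasis h) * ((realBasis h).det v : ℝ) := by
  have : (detZ h).toAlternatingMap = (LinearMap.toSpanSingleton ℝ ℂ
      (detZ h (realBasis h))).compAlternatingMap (realBasis h).det := by
    refine Basis.ext_alternating (realBasis h) fun i hi => ?_
    let σ : Equiv.Perm (Fin N) := Equiv.ofBijective i (Finite.injective_iff_bijective.1 hi)
    change (detZ h).toAlternatingMap (realBasis h ∘ σ) =
      ((LinearMap.toSpanSingleton ℝ ℂ
      (detZ h (realBasis h))).compAlternatingMap (realBasis h).det) (realBasis h ∘ σ)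
    rw [AlternatingMap.map_perm, AlternatingMap.map_perm]
    simp [Basis.det_self]
  have h2 := congrArg (fun f => f v) this
  have h3 : detZ h v = ((realBasis h).det v : ℝ) • detZ h (realBasis h) := by
    simpa using h2
  rw [h3, Complex.real_smul, mul_comm]

theorem detZ_realBasis {n N : ℕ} (h : N = 2 * n) :
    detZ h (realBasis h) = (-2 * Complex.I) ^ n := by
  change Matrix.det (fun a : Fin N => coframe h (realBasis h a)) = _
  -- Evaluated on b_j and i b_j, the pair dz_j, d conj(z_j) gives one 2 × 2 block of determinant
  -- -2i; different indices do not interact. The swap of factors is needed because `blockDiagonal`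
  -- puts the block index second.
  have h1 : (fun a : Fin N => coframe h (realBasis h a)) =
      (Matrix.blockDiagonal fun _ : Fin n => !![1, 1; Complex.I, -Complex.I]).submatrix
        ((frameIndex h).trans (Equiv.prodComm _ _)) ((frameIndex h).trans (Equiv.prodComm _ _)) := by
    subst h
    ext a b
    rw [realBasis_apply, Matrix.submatrix_apply, Matrix.blockDiagonal_apply]
    obtain ⟨a, rfl⟩ := (frameIndex (n := n) rfl).symm.surjective a
    obtain ⟨b, rfl⟩ := (frameIndex (n := n) rfl).symm.surjective b
    obtain ⟨i, s⟩ := a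
    obtain ⟨j, t⟩ := b
    have hb : (((frameIndex (n := n) rfl).symm (j, t) : Fin (2 * n)) : ℕ) = t + 2 * j := by
      simp [frameIndex]
    have hd : (⟨(((frameIndex (n := n) rfl).symm (j, t) : Fin (2 * n)) : ℕ) / 2, by omega⟩ : Fin n)
        = j := by
      apply Fin.ext; simp only [hb]; omega
    have hm : (((frameIndex (n := n) rfl).symm (j, t) : Fin (2 * n)) : ℕ) % 2 = t := by
      rw [hb]; omega
    simp only [coframe, ContinuousLinearMap.coe_pi', hd, frame, Equiv.trans_apply,
      Equiv.apply_symm_apply, Equiv.prodComm_apply, Prod.swap_prod_mk, hm]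
    by_cases hij : i = j
    · subst hij
      fin_cases t <;> fin_cases s <;> simp
    · have : j ≠ i := fun h => hij h.symm
      fin_cases t <;> fin_cases s <;> simp [hij]
  rw [h1, Matrix.det_submatrix_equiv_self, Matrix.det_blockDiagonal]
  simp only [Matrix.det_fin_two_of, Finset.prod_const, Finset.card_univ, Fintype.card_fin]
  congr 1
  ring

/-- A real linear map multiplies the top form by its determinant. -/
theorem detZ_comp {n N : ℕ} (h : N = 2 * n) (T : WC n →ₗ[ℝ] WC n) (v : Fin N → WC n) :
    detZ h (T ∘ v) = ((LinearMap.det T : ℝ) : ℂ) * detZ h v := by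
  rw [detZ_eq h (T ∘ v), detZ_eq h v, Basis.det_comp]
  push_cast
  ring

theorem det_restrictScalars_complex {n : ℕ} (T : WC n →ₗ[ℂ] WC n) :
    LinearMap.det (T.restrictScalars ℝ) = Complex.normSq (LinearMap.det T) := by
  rw [LinearMap.det_restrictScalars, Algebra.norm_complex_eq]; rfl

end

end PolarHarmonic


namespace PolarHarmonic

open Module

noncomputable section

/-! ## Contractions of the top form -/

/-- The family `v_0, …, v_{k-1}, w_0, …, w_{l-1}`. -/
def catFamily {X : Type*} {l : ℕ} : (k : ℕ) → (Fin k → X) → (Fin l → X) → Fin (l + k) → X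
  | 0, _, w => w
  | k + 1, v, w => (Fin.cons (v 0) (catFamily k (Fin.tail v) w) : Fin (l + k + 1) → X)

theorem contract_apply {n l : ℕ} (k : ℕ) (ω : Form n (l + k)) (v : Fin k → WC n)
    (w : Fin l → WC n) : contract k ω v w = ω (catFamily k v w) := by
  induction k with
  | zero => rfl
  | succ k ih =>
    rw [contract, ih]
    rfl

theorem catFamily_apply {X : Type*} {l : ℕ} (k : ℕ) (v : Fin k → X) (w : Fin l → X)
    (i : Fin (l + k)) : catFamily k v w i =
      if h : (i : ℕ) < k then v ⟨i, h⟩ else w ⟨i - k, by omega⟩ := by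
  induction k with
  | zero => simp [catFamily]
  | succ k ih =>
    change (Fin.cons (v 0) (catFamily k (Fin.tail v) w) : Fin (l + k + 1) → X) i = _
    refine Fin.cases ?_ (fun j => ?_) i
    · simp
    · rw [Fin.cons_succ, ih]
      simp only [Fin.val_succ, Nat.add_lt_add_iff_right, Nat.add_sub_add_right]
      rfl

theorem detZ_congr {n N N' : ℕ} (h : N = 2 * n) (h' : N' = 2 * n) (e : N' = N)
    (v : Fin N → WC n) : detZ h v = detZ h' (v ∘ Fin.cast e) := by
  subst e
  rfl

/-- Moving the last vector to the front is a cycle of length `k + 1` with `k = 2n - 1` odd. This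
sign is the -1 in *̄ *̄ = -1. -/
theorem detZ_catFamily_one {n k : ℕ} (h : 1 + k = 2 * n) (v : Fin k → WC n) (w : Fin 1 → WC n) :
    detZ h (catFamily k v w) =
      -detZ (show k + 1 = 2 * n by omega) (Fin.cons (w 0) v) := by
  rw [detZ_congr h (show k + 1 = 2 * n by omega) (by omega)]
  have : catFamily k v w ∘ Fin.cast (by omega : k + 1 = 1 + k) =
      (Fin.cons (w 0) v : Fin (k + 1) → WC n) ∘ finRotate (k + 1) := by
    have h1 := Fin.snoc_eq_cons_rotate v (w 0)
    refine Eq.trans ?_ h1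
    funext i
    rw [Function.comp_apply, catFamily_apply]
    refine Fin.lastCases ?_ (fun j => ?_) i
    · simp
    · simp
  rw [this]
  change (detZ (show k + 1 = 2 * n by omega)).toAlternatingMap _ = _
  rw [AlternatingMap.map_perm, sign_finRotate]
  have hk : Odd k := by
    rw [← Nat.not_even_iff_odd]; intro hk; obtain ⟨j, hj⟩ := hk; omega
  rw [Nat.add_sub_cancel, hk.neg_one_pow]
  simp

theorem detZ_catFamily_zero {n k : ℕ} (h : 0 + k = 2 * n) (v : Fin k → WC n) (w : Fin 0 → WC n) :
    detZ h (catFamily k v w) = detZ (show k = 2 * n by omega) v := by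
  rw [detZ_congr h (show k = 2 * n by omega) (by omega)]
  congr 1
  funext i
  rw [Function.comp_apply, catFamily_apply]
  simp

theorem mulI_apply {n : ℕ} (w : WC n) : mulI n w = Complex.I • w := rfl

/-- The contraction of the top form with the vector `∑_j conj(w_j) ∂/∂conj(z_j)`. -/
def kap {n k : ℕ} (h : k + 1 = 2 * n) (w : WC n) : Form n k :=
  (1 / 2 : ℂ) • (ContinuousAlternatingMap.curryLeft (detZ h) w +
    Complex.I • ContinuousAlternatingMap.curryLeft (detZ h) (mulI n w))

theorem kap_apply {n k : ℕ} (h : k + 1 = 2 * n) (w : WC n) (v : Fin k → WC n) :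
    kap h w v = 1 / 2 * (detZ h (Fin.cons w v) +
      Complex.I * detZ h (Fin.cons (Complex.I • w) v)) := rfl

theorem kap_add {n k : ℕ} (h : k + 1 = 2 * n) (w w' : WC n) :
    kap h (w + w') = kap h w + kap h w' := by
  unfold kap
  simp only [map_add, smul_add]
  abel

theorem kap_real_smul {n k : ℕ} (h : k + 1 = 2 * n) (r : ℝ) (w : WC n) :
    kap h (r • w) = (r : ℂ) • kap h w := by
  unfold kap
  simp only [map_smul]
  ext v
  simp
  ring

/-- The contraction with a vector of type (0,1) is antilinear in `w`. It is therefore determined by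
the `n` constant forms obtained from the basis vectors, and differentiating it only involves the
conjugated components of `w`. -/
theorem kap_I_smul {n k : ℕ} (h : k + 1 = 2 * n) (w : WC n) :
    kap h (Complex.I • w) = -Complex.I • kap h w := by
  unfold kap
  have : mulI n (Complex.I • w) = -w := by
    rw [mulI_apply, smul_smul, Complex.I_mul_I, neg_one_smul]
  rw [this, ← mulI_apply, map_neg]
  generalize ContinuousAlternatingMap.curryLeft (detZ h) (mulI n w) = A
  generalize ContinuousAlternatingMap.curryLeft (detZ h) w = B
  ext v
  change 1 / 2 * (A v + Complex.I * -(B v)) = -Complex.I * (1 / 2 * (B v + Complex.I * A v))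
  linear_combination (1 / 2 * A v) * Complex.I_sq

theorem kap_smul {n k : ℕ} (h : k + 1 = 2 * n) (c : ℂ) (w : WC n) :
    kap h (c • w) = (starRingEnd ℂ) c • kap h w := by
  have : c • w = c.re • w + Complex.I • (c.im • w) := by
    ext j
    change c * w j = (c.re : ℂ) * w j + Complex.I * ((c.im : ℂ) * w j)
    linear_combination -(w j) * Complex.re_add_im c
  rw [this, kap_add, kap_I_smul, kap_real_smul, kap_real_smul]
  ext v
  change (c.re : ℂ) * kap h w v + -Complex.I * ((c.im : ℂ) * kap h w v) =
    (starRingEnd ℂ) c * kap h w v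
  have hc : (starRingEnd ℂ) c = c.re - Complex.I * c.im := by
    apply Complex.ext <;> simp
  rw [hc]
  ring

/-- `kap` as a real linear map. -/
def kapLin {n k : ℕ} (h : k + 1 = 2 * n) : WC n →ₗ[ℝ] Form n k where
  toFun := kap h
  map_add' := kap_add h
  map_smul' r w := by
    rw [kap_real_smul]; ext v; simp

theorem kap_sum {n k : ℕ} (h : k + 1 = 2 * n) {ι : Type*} (s : Finset ι) (w : ι → WC n) :
    kap h (∑ i ∈ s, w i) = ∑ i ∈ s, kap h (w i) := map_sum (kapLin h) w s

theorem kap_eq_sum {n k : ℕ} (h : k + 1 = 2 * n) (w : WC n) :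
    kap h w = ∑ j, (starRingEnd ℂ) (w j) • kap h (Pi.single j 1) := by
  conv_lhs => rw [← Finset.univ_sum_single w]
  rw [kap_sum]
  refine Finset.sum_congr rfl fun j _ => ?_
  rw [← kap_smul, ← Pi.single_smul, smul_eq_mul, mul_one]

/-- Contraction is natural, and a complex linear map multiplies the top form by its real
determinant, which is the squared absolute value of the complex one. -/
theorem kap_comp {n k : ℕ} (h : k + 1 = 2 * n) (T : WC n →L[ℂ] WC n) (w : WC n) :
    (kap h (T w)).compContinuousLinearMap (T.restrictScalars ℝ) =
      (Complex.normSq (LinearMap.det (T : WC n →ₗ[ℂ] WC n)) : ℂ) • kap h w := by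
  ext v
  have key : ∀ u : WC n, detZ h (Fin.cons (T u) (T ∘ v)) =
      (Complex.normSq (LinearMap.det (T : WC n →ₗ[ℂ] WC n)) : ℂ) * detZ h (Fin.cons u v) := by
    intro u
    rw [← det_restrictScalars_complex, ← detZ_comp]
    congr 1
    exact (Fin.comp_cons T u v).symm
  change kap h (T w) (T ∘ v) = _ * kap h w v
  rw [kap_apply, kap_apply, ← map_smul, key, key]
  ring

/-- Naturality applied to multiplication by `c`, with `w` written as c · c⁻¹w, gives the factor
|c|^(2n) conj(c)⁻¹ = c^n conj(c)^(n-1). The case `c = 0` is separate and uses that the degree is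
positive. -/
theorem kap_isOfType {m : ℕ} (h : 2 * m + 1 + 1 = 2 * (m + 1)) (w : WC (m + 1)) :
    IsOfType (m + 1) m (kap h w) := by
  refine ⟨by omega, fun c v => ?_⟩
  rcases eq_or_ne c 0 with rfl | hc
  · rw [zero_pow (Nat.succ_ne_zero m), zero_mul, zero_mul]
    exact (kap h w).map_coord_zero 0 (zero_smul _ _)
  have h1 := kap_comp h (c • ContinuousLinearMap.id ℂ (WC (m + 1))) (c⁻¹ • w)
  have h2 := congrArg (fun F => F v) h1
  have hdet : LinearMap.det ((c • ContinuousLinearMap.id ℂ (WC (m + 1)) :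
      WC (m + 1) →L[ℂ] WC (m + 1)) : WC (m + 1) →ₗ[ℂ] WC (m + 1)) = c ^ (m + 1) := by
    have : ((c • ContinuousLinearMap.id ℂ (WC (m + 1)) :
      WC (m + 1) →L[ℂ] WC (m + 1)) : WC (m + 1) →ₗ[ℂ] WC (m + 1)) = c • LinearMap.id := rfl
    rw [this, LinearMap.det_smul]
    simp
  rw [hdet, kap_smul] at h2
  have h3 : kap h w (fun i => c • v i) = (Complex.normSq (c ^ (m + 1)) : ℂ) *
      ((starRingEnd ℂ) c⁻¹ * kap h w v) := by
    refine Eq.trans ?_ h2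
    change _ = kap h (c • c⁻¹ • w) (fun i => c • v i)
    rw [smul_inv_smul₀ hc]
  rw [h3, ← Complex.mul_conj, map_inv₀, map_pow]
  have hc' : (starRingEnd ℂ) c ≠ 0 := by simpa using hc
  field_simp
  ring

/-! ## The operator `∂̄` on forms of type `(n, n - 1)` -/

theorem finrank_real_WC (n : ℕ) : finrank ℝ (WC n) = 2 * n := by
  rw [finrank_eq_card_basis (realBasis (n := n) rfl), Fintype.card_fin]

/-- This is α ∧ ι_w vol = α(w) vol: the form α ∧ vol has degree 2n + 1 on a real space of dimension
2n, hence vanishes, and its expansion on (w, v) is the identity. -/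
theorem sum_smul_cons_removeNth {n k : ℕ} (h : k + 1 = 2 * n) (α : WC n →L[ℝ] ℂ) (w : WC n)
    (v : Fin (k + 1) → WC n) :
    ∑ i : Fin (k + 1), (-1 : ℤ) ^ (i : ℕ) • (α (v i) * detZ h (Fin.cons w (i.removeNth v))) =
      α w * detZ h v := by
  have h0 : ContinuousAlternatingMap.alternatizeUncurryFin (α.smulRight (detZ h))
      (Fin.cons w v) = 0 := by
    change (ContinuousAlternatingMap.alternatizeUncurryFin
      (α.smulRight (detZ h))).toAlternatingMap (Fin.cons w v) = 0
    apply AlternatingMap.map_linearDependent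
    intro hl
    have := hl.fintype_card_le_finrank
    rw [finrank_real_WC, Fintype.card_fin] at this
    omega
  rw [ContinuousAlternatingMap.alternatizeUncurryFin_apply, Fin.sum_univ_succ] at h0
  simp only [Fin.val_zero, pow_zero, one_smul, Fin.cons_zero, Fin.val_succ, Fin.cons_succ,
    ContinuousLinearMap.smulRight_apply, ContinuousAlternatingMap.smul_apply, smul_eq_mul] at h0
  have h1 : (Fin.removeNth 0 (Fin.cons w v : Fin (k + 2) → WC n)) = v := by
    ext i; simp [Fin.removeNth]
  have h2 : ∀ i : Fin (k + 1), (i.succ.removeNth (Fin.cons w v : Fin (k + 2) → WC n)) =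
      (Fin.cons w (i.removeNth v) : Fin (k + 1) → WC n) := by
    intro i
    funext j
    refine Fin.cases ?_ (fun j => ?_) j
    · simp [Fin.removeNth]
    · simp [Fin.removeNth, Fin.succ_succAbove_succ]
  rw [h1] at h0
  simp only [h2] at h0
  rw [← sub_eq_zero, ← neg_eq_zero, neg_sub, ← h0, sub_eq_add_neg, ← Finset.sum_neg_distrib]
  congr 1
  refine Finset.sum_congr rfl fun i _ => ?_
  rw [pow_succ, mul_neg_one, neg_smul]

/-- Half the sum of the previous identity for `w` and `i` times that for `iw`; antilinearity of `α`
makes the two right sides equal. -/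
theorem sum_smul_kap_removeNth {n k : ℕ} (h : k + 1 = 2 * n) (α : WC n →L[ℝ] ℂ)
    (hα : ∀ w, α (Complex.I • w) = -Complex.I * α w) (w : WC n) (v : Fin (k + 1) → WC n) :
    ∑ i : Fin (k + 1), (-1 : ℤ) ^ (i : ℕ) • (α (v i) * kap h w (i.removeNth v)) =
      α w * detZ h v := by
  have h1 := sum_smul_cons_removeNth h α w v
  have h2 := sum_smul_cons_removeNth h α (Complex.I • w) v
  rw [hα] at h2
  have : α w * detZ h v = 1 / 2 * (α w * detZ h v + Complex.I * (-Complex.I * α w * detZ h v)) := by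
    linear_combination (1 / 2 * α w * detZ h v) * Complex.I_sq
  rw [this, ← h1, ← h2, Finset.mul_sum, ← Finset.sum_add_distrib, Finset.mul_sum]
  refine Finset.sum_congr rfl fun i _ => ?_
  rw [kap_apply]
  simp only [zsmul_eq_mul]
  ring

/-- The derivative `∂F/∂conj(z_j)` of a function. -/
def dbarAt {n : ℕ} (F : WC n → ℂ) (Z : WC n) (j : Fin n) : ℂ :=
  1 / 2 * (fderiv ℝ F Z (Pi.single j 1) + Complex.I * fderiv ℝ F Z (Pi.single j Complex.I))

/-- Antilinearity of `kap` turns the form into ∑ Φ_j times constant forms, so ∂̄ only sees the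
antilinear derivatives of Φ_j, and wedging them with the contractions leaves a divergence. -/
theorem dbar_kap {n k : ℕ} (h : k + 1 = 2 * n) (Φ : WC n → WC n) (Z : WC n)
    (hΦ : DifferentiableAt ℝ Φ Z) :
    dbar (fun Z => kap h (conjW (Φ Z))) Z =
      (∑ j, dbarAt (fun Z => Φ Z j) Z j) • detZ h := by
  have hΦj : ∀ j, DifferentiableAt ℝ (fun Z => Φ Z j) Z := fun j => differentiableAt_pi.1 hΦ j
  have h1 : HasFDerivAt (fun Z => kap h (conjW (Φ Z)))
      (∑ j, (fderiv ℝ (fun Z => Φ Z j) Z).smulRight (kap h (Pi.single j 1))) Z := by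
    have h2 : (fun Z => kap h (conjW (Φ Z))) =
        fun Z => ∑ j, Φ Z j • kap h (Pi.single j 1 : WC n) := by
      funext Z
      rw [kap_eq_sum]
      simp [conjW]
    rw [h2]
    exact HasFDerivAt.fun_sum fun j _ => (hΦj j).hasFDerivAt.smul_const (kap h (Pi.single j 1))
  have hanti : ∀ j : Fin n, ∃ α : WC n →L[ℝ] ℂ,
      (∀ w, α w = 1 / 2 * (fderiv ℝ (fun Z => Φ Z j) Z w +
        Complex.I * fderiv ℝ (fun Z => Φ Z j) Z (Complex.I • w))) := fun j =>
    ⟨(1 / 2 : ℂ) • (fderiv ℝ (fun Z => Φ Z j) Z +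
      Complex.I • (fderiv ℝ (fun Z => Φ Z j) Z).comp (mulI n)), fun w => rfl⟩
  choose α hα using hanti
  have hα' : ∀ j w, α j (Complex.I • w) = -Complex.I * α j w := by
    intro j w
    rw [hα, hα, smul_smul, Complex.I_mul_I, neg_one_smul, map_neg]
    linear_combination (1 / 2 * fderiv ℝ (fun Z => Φ Z j) Z (Complex.I • w)) * Complex.I_sq
  ext v
  rw [dbar, h1.fderiv, ContinuousAlternatingMap.alternatizeUncurryFin_apply]
  have h3 : ∀ i : Fin (k + 1), (((1 / 2 : ℂ) •
      ((∑ j, (fderiv ℝ (fun Z => Φ Z j) Z).smulRight (kap h (Pi.single j 1))) +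
      Complex.I • (∑ j, (fderiv ℝ (fun Z => Φ Z j) Z).smulRight (kap h (Pi.single j 1))).comp
        (mulI n))) (v i)) (i.removeNth v) =
      ∑ j, α j (v i) * kap h (Pi.single j 1) (i.removeNth v) := by
    intro i
    simp only [_root_.smul_apply, _root_.add_apply,
      ContinuousLinearMap.comp_apply, _root_.sum_apply,
      ContinuousLinearMap.smulRight_apply, ContinuousAlternatingMap.smul_apply,
      ContinuousAlternatingMap.add_apply, ContinuousAlternatingMap.sum_apply, smul_eq_mul, hα,
      mulI_apply, Finset.mul_sum, ← Finset.sum_add_distrib]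
    refine Finset.sum_congr rfl fun j _ => by ring
  simp only [h3, Finset.smul_sum]
  rw [Finset.sum_comm]
  simp only [sum_smul_kap_removeNth h (α _) (hα' _)]
  rw [ContinuousAlternatingMap.smul_apply, smul_eq_mul, Finset.sum_mul]
  refine Finset.sum_congr rfl fun j _ => ?_
  rw [hα, dbarAt, ← Pi.single_smul, smul_eq_mul, mul_one]

end

end PolarHarmonic


namespace PolarHarmonic

open Module

noncomputable section

/-! ## The Hodge star operator -/

theorem metricInv_symm {n : ℕ} (Y : Fin n → ℝ) (i j : Fin n) :
    metricInv Y i j = metricInv Y j i := by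
  unfold metricInv
  by_cases h : i = j
  · subst h; rfl
  · have : ¬ j = i := fun h' => h h'.symm
    simp only [h, this, if_false]
    ring

/-- The hermitian metric on one-forms as a complex linear map. -/
def metricMap {n : ℕ} (Y : Fin n → ℝ) : WC n →ₗ[ℂ] WC n :=
  Matrix.toLin' (Matrix.of fun i j => (metricInv Y i j : ℂ))

theorem metricMap_apply {n : ℕ} (Y : Fin n → ℝ) (w : WC n) (i : Fin n) :
    metricMap Y w i = ∑ j, (metricInv Y i j : ℂ) * w j := by
  simp [metricMap, Matrix.mulVec, dotProduct]

theorem metricMap_apply' {n : ℕ} (Y : Fin n → ℝ) (w : WC n) (i : Fin n) :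
    metricMap Y w i = 4 * (Y i : ℂ) * ∑ j, (Y j : ℂ) * w j -
      2 * ((qW Y : ℝ) : ℂ) * eps ℂ i * w i := by
  have he : ((eps ℝ i : ℝ) : ℂ) = eps ℂ i := by unfold eps; split_ifs <;> simp
  rw [metricMap_apply]
  simp only [metricInv]
  push_cast
  simp only [sub_mul, Finset.sum_sub_distrib, ite_mul, apply_ite (Complex.ofReal)]
  push_cast
  simp only [zero_mul, Finset.sum_ite_eq, Finset.mem_univ, if_true, he, Finset.mul_sum]
  congr 1
  exact Finset.sum_congr rfl fun j _ => by ring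

theorem dualFrame_eq {n : ℕ} (Z : WC n) (a : Fin n × Fin 2) :
    dualFrame Z a = (1 / 4 : ℂ) • metricMap (imW Z) (frame a) := by
  funext j
  rw [Pi.smul_apply, metricMap_apply]
  simp only [dualFrame, frame, Pi.single_apply, mul_ite, mul_zero, Finset.sum_ite_eq',
    Finset.mem_univ, if_true, smul_eq_mul]
  rw [metricInv_symm]
  push_cast
  split_ifs <;> ring

theorem prod_eps (m : ℕ) : ∏ j : Fin (m + 1), eps ℝ j = (-1) ^ m := by
  rw [Fin.prod_univ_succ]
  simp [eps]

theorem eps_mul_self {n : ℕ} {R : Type} [CommRing R] (j : Fin n) : eps R j * eps R j = 1 := by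
  unfold eps; split_ifs <;> simp

/-- The matrix is diagonal with entries -2 q ε_j times a rank one perturbation of the identity,
which by the matrix determinant lemma contributes 1 - 2 = -1. The signs cancel against ∏ ε_j =
(-1)^m. -/
theorem det_metricInv {m : ℕ} (Y : Fin (m + 1) → ℝ) (hY : qW Y ≠ 0) :
    (Matrix.of fun i j => metricInv Y i j).det = (2 * qW Y) ^ (m + 1) := by
  have h1 : (Matrix.of fun i j => metricInv Y i j) =
      Matrix.diagonal (fun j => -2 * qW Y * eps ℝ j) *
        (1 + Matrix.replicateCol Unit (fun j => -2 / qW Y * eps ℝ j * Y j) *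
          Matrix.replicateRow Unit Y) := by
    ext i j
    rw [Matrix.diagonal_mul, Matrix.add_apply, Matrix.mul_apply]
    simp only [Matrix.of_apply, metricInv, Matrix.one_apply, Finset.univ_unique,
      Finset.sum_singleton, Matrix.replicateCol_apply, Matrix.replicateRow_apply]
    have h2 : -2 * qW Y * eps ℝ i * (-2 / qW Y * eps ℝ i * Y i * Y j) = 4 * Y i * Y j := by
      field_simp
      linear_combination (Y i * Y j * 4) * eps_mul_self (R := ℝ) i
    rw [mul_add, h2]
    split_ifs <;> ring
  rw [h1, Matrix.det_mul, Matrix.det_diagonal,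
    Matrix.det_one_add_replicateCol_mul_replicateRow, Finset.prod_mul_distrib, prod_eps]
  have h3 : Y ⬝ᵥ (fun j => -2 / qW Y * eps ℝ j * Y j) = -2 := by
    have : Y ⬝ᵥ (fun j => -2 / qW Y * eps ℝ j * Y j) = -2 / qW Y * qW Y := by
      conv_rhs => rw [qW]
      rw [dotProduct, Finset.mul_sum]
      refine Finset.sum_congr rfl fun j _ => ?_
      rw [show (∑ j, eps ℝ j * Y j ^ 2) = qW Y from rfl]
      ring
    rw [this]
    field_simp
  rw [h3]
  simp only [Finset.prod_const, Finset.card_univ, Fintype.card_fin]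
  have : (-2 * qW Y) ^ (m + 1) = (-1) ^ (m + 1) * (2 * qW Y) ^ (m + 1) := by
    rw [← mul_pow]; ring
  rw [this]
  have h4 : ((-1 : ℝ) ^ m) * (-1) ^ m = 1 := by rw [← mul_pow]; simp
  rw [pow_succ (-1 : ℝ) m]
  linear_combination ((2 * qW Y) ^ (m + 1)) * h4

theorem det_metricMap {n : ℕ} (hn : n ≠ 0) (Y : Fin n → ℝ) (hY : qW Y ≠ 0) :
    LinearMap.det (metricMap Y) = (2 * ((qW Y : ℝ) : ℂ)) ^ n := by
  obtain ⟨m, rfl⟩ := Nat.exists_eq_succ_of_ne_zero hn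
  have h1 := det_metricInv Y hY
  rw [metricMap, LinearMap.det_toLin']
  have h2 : (Matrix.of fun i j => (metricInv Y i j : ℂ)) =
      (Complex.ofRealHom).mapMatrix (Matrix.of fun i j => metricInv Y i j) := by
    ext i j; simp
  rw [h2, ← RingHom.map_det, h1]
  simp

/-- The real linear map taking `frame` to `dualFrame`. -/
def dualMap {n : ℕ} (Z : WC n) : WC n →ₗ[ℝ] WC n :=
  ((1 / 4 : ℂ) • metricMap (imW Z)).restrictScalars ℝ

theorem dualMap_frame {n : ℕ} (Z : WC n) (a : Fin n × Fin 2) :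
    dualMap Z (frame a) = dualFrame Z a := (dualFrame_eq Z a).symm

/-- The value of the volume form on the basis `realBasis`. -/
def volConst {n : ℕ} (Z : WC n) : ℂ :=
  ((4 * Complex.I * ((qW (imW Z) : ℝ) : ℂ)) ^ n)⁻¹ * (-2 * Complex.I) ^ n

theorem volForm_apply {n N : ℕ} (h : N = 2 * n) (Z : WC n) (v : Fin N → WC n) :
    volForm h Z v = volConst Z * ((realBasis h).det v : ℝ) := by
  rw [volForm_eq, ContinuousAlternatingMap.smul_apply, detZ_eq, detZ_realBasis, volConst,
    smul_eq_mul]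
  ring

/-- This expresses that dμ has norm one. Per complex dimension the factors are 16, 1/(4 q²) and
q²/4, which is where the power of 16 in `starBar` is used up. -/
theorem volConst_normalization {n : ℕ} (hn : n ≠ 0) (Z : WC n) (hZ : qW (imW Z) ≠ 0) :
    (16 : ℂ) ^ n * ((starRingEnd ℂ) (volConst Z) * volConst Z) *
      ((LinearMap.det (dualMap Z) : ℝ) : ℂ) = 1 := by
  have hq : ((qW (imW Z) : ℝ) : ℂ) ≠ 0 := by exact_mod_cast hZ
  rw [dualMap, det_restrictScalars_complex, LinearMap.det_smul, det_metricMap hn _ hZ,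
    ← Complex.mul_conj, volConst]
  simp only [map_mul, map_inv₀, map_pow, Complex.conj_ofReal, Complex.conj_I, map_div₀, map_one,
    map_ofNat, finrank_fin_fun, map_neg]
  rw [← inv_pow, ← inv_pow]
  simp only [← mul_pow]
  rw [show (16 * ((4 * -Complex.I * ((qW (imW Z) : ℝ) : ℂ))⁻¹ * (-2 * -Complex.I) *
      ((4 * Complex.I * ((qW (imW Z) : ℝ) : ℂ))⁻¹ * (-2 * Complex.I))) *
      (1 / 4 * (2 * ((qW (imW Z) : ℝ) : ℂ)) * (1 / 4 * (2 * ((qW (imW Z) : ℝ) : ℂ))))) = 1 by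
    field_simp; norm_num, one_pow]

theorem det_dualMap_ne_zero {n : ℕ} (hn : n ≠ 0) (Z : WC n) (hZ : qW (imW Z) ≠ 0) :
    LinearMap.det (dualMap Z) ≠ 0 := by
  intro h
  have := volConst_normalization hn Z hZ
  rw [h] at this
  simp at this

theorem realBasis_repr {n N : ℕ} (h : N = 2 * n) (x : WC n) (c : Fin N) :
    (realBasis h).repr x c = if (frameIndex h c).2 = 0 then (x (frameIndex h c).1).re
      else (x (frameIndex h c).1).im := by
  subst h
  obtain ⟨c, rfl⟩ := (frameIndex (n := n) rfl).symm.surjective c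
  rw [Equiv.apply_symm_apply]
  obtain ⟨i, j⟩ := c
  have : (realBasis (n := n) rfl).repr x ((frameIndex rfl).symm (i, j)) =
      (Pi.basis fun _ : Fin n => Complex.basisOneI).repr x ⟨i, j⟩ := by
    rw [realBasis, Basis.repr_reindex_apply, Basis.repr_reindex_apply]
    congr 1
    simp [frameIndex]
  rw [this, Pi.basis_repr]
  fin_cases j <;> simp

/-- Symmetry of the Riemannian metric in the real basis, needed to move `dualMap` from one argument
of the inner product to the other. -/
theorem repr_dualMap_symm {n N : ℕ} (h : N = 2 * n) (Z : WC n) (a c : Fin N) :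
    (realBasis h).repr (dualMap Z (realBasis h a)) c =
      (realBasis h).repr (dualMap Z (realBasis h c)) a := by
  rw [realBasis_apply, realBasis_apply, dualMap_frame, dualMap_frame, realBasis_repr,
    realBasis_repr]
  simp only [dualFrame]
  rw [metricInv_symm]
  generalize (frameIndex h a) = a
  generalize (frameIndex h c) = c
  obtain ⟨i, s⟩ := a
  obtain ⟨j, t⟩ := c
  fin_cases s <;> fin_cases t <;> simp

/-- `*̄` on one-forms. -/
theorem starBar_one_apply {n k : ℕ} (h : k + (0 + 1) = 2 * n) (β : WC n → Form n (0 + 1))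
    (Z : WC n) (v : Fin k → WC n) :
    starBar 0 h β Z v = ∑ a : Fin n × Fin 2, (starRingEnd ℂ) (β Z fun _ => frame a) *
      volForm h Z (Fin.cons (dualFrame Z a) v) := by
  unfold starBar
  simp only [pow_zero, zero_add, Nat.factorial_one, Nat.cast_one, div_one, one_smul]
  rw [ContinuousAlternatingMap.sum_apply]
  refine Fintype.sum_equiv (Equiv.funUnique (Fin 1) (Fin n × Fin 2)) _ _ fun a => ?_
  rw [ContinuousAlternatingMap.smul_apply, smul_eq_mul, contract_apply]
  have ha : a = fun _ => a 0 := funext fun i => congrArg a (Subsingleton.elim (α := Fin 1) i 0)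
  rw [ha]
  rfl

/-- For an antilinear β the frame vectors b_j and i b_j have proportional values, and their two
contributions combine to one contraction of type (0,1). The star of a (0,1)-form is thus the
contraction of the volume form with its metric dual. -/
theorem starBar_one {n k : ℕ} (h : k + (0 + 1) = 2 * n) (β : WC n → Form n (0 + 1))
    (Z : WC n) (hβ : ∀ w, β Z (fun _ => Complex.I • w) = -Complex.I * β Z fun _ => w) :
    starBar 0 h β Z = ((4 * Complex.I * ((qW (imW Z) : ℝ) : ℂ)) ^ n)⁻¹ •
      kap (k := k) h ((1 / 2 : ℂ) • metricMap (imW Z) fun j => β Z fun _ => Pi.single j 1) := by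
  ext v
  rw [starBar_one_apply, Fintype.sum_prod_type, ContinuousAlternatingMap.smul_apply]
  have h1 : ((1 / 2 : ℂ) • metricMap (imW Z) fun j => β Z fun _ => Pi.single j 1) =
      ∑ i, (2 * β Z fun _ => Pi.single i 1) • dualFrame Z (i, 0) := by
    simp only [dualFrame_eq]
    funext j
    rw [Pi.smul_apply, metricMap_apply, Finset.sum_apply, smul_eq_mul, Finset.mul_sum]
    refine Finset.sum_congr rfl fun i _ => ?_
    rw [Pi.smul_apply, Pi.smul_apply, metricMap_apply]
    simp only [frame, Pi.single_apply, mul_ite, mul_zero, Finset.sum_ite_eq',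
      Finset.mem_univ, if_true, smul_eq_mul, mul_one]
    ring
  have h2 : ∀ i : Fin n, dualFrame Z (i, 1) = Complex.I • dualFrame Z (i, 0) := by
    intro i
    funext j
    simp [dualFrame, mul_comm]
  have h3 : ∀ i : Fin n, (frame (i, 1) : WC n) = Complex.I • frame (i, 0) := by
    intro i
    simp [frame, ← Pi.single_smul]
  rw [h1, kap_sum, ContinuousAlternatingMap.sum_apply, smul_eq_mul, Finset.mul_sum]
  refine Finset.sum_congr rfl fun i _ => ?_
  rw [Fin.sum_univ_two, h2, h3, hβ, kap_smul, ContinuousAlternatingMap.smul_apply, kap_apply,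
    volForm_eq, ContinuousAlternatingMap.smul_apply, ContinuousAlternatingMap.smul_apply]
  have h4 : (frame (i, 0) : WC n) = Pi.single i 1 := by simp [frame]
  rw [h4]
  simp only [smul_eq_mul, map_mul, map_neg, Complex.conj_I, map_ofNat, neg_neg]
  ring

/-- `*̄` on forms of top degree, normalised by `*̄ dμ = 1`. -/
theorem starBar_top {n k : ℕ} (hn : n ≠ 0) (h : 0 + k = 2 * n) (h' : k = 2 * n)
    (β : WC n → Form n k) (Z : WC n) (hZ : qW (imW Z) ≠ 0) (c : ℂ) (hβ : β Z = c • detZ h') :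
    starBar n h β Z = zeroForm n ((starRingEnd ℂ)
      (c * (4 * Complex.I * ((qW (imW Z) : ℝ) : ℂ)) ^ n)) := by
  have hq : ((qW (imW Z) : ℝ) : ℂ) ≠ 0 := by exact_mod_cast hZ
  have hq4 : (4 * Complex.I * ((qW (imW Z) : ℝ) : ℂ)) ^ n ≠ 0 :=
    pow_ne_zero _ (by simp [hq])
  ext w
  unfold starBar
  rw [ContinuousAlternatingMap.smul_apply, ContinuousAlternatingMap.sum_apply]
  set B := realBasis h' with hB
  have h1 : ∀ a : Fin k → Fin k, (starRingEnd ℂ) (β Z (B ∘ a)) * volForm h Z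
      (catFamily k (dualMap Z ∘ (B ∘ a)) w) =
      ((starRingEnd ℂ) (c * (4 * Complex.I * ((qW (imW Z) : ℝ) : ℂ)) ^ n) *
        ((starRingEnd ℂ) (volConst Z) * volConst Z) *
        ((LinearMap.det (dualMap Z) : ℝ) : ℂ)) * ((B.det (B ∘ a) * B.det (B ∘ a) : ℝ) : ℂ) := by
    intro a
    have e1 : volForm h Z (catFamily k (dualMap Z ∘ (B ∘ a)) w) =
        volConst Z * ((LinearMap.det (dualMap Z) : ℝ) * (B.det (B ∘ a) : ℝ)) := by
      rw [volForm_eq, ContinuousAlternatingMap.smul_apply, detZ_catFamily_zero,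
        ← ContinuousAlternatingMap.smul_apply, ← volForm_eq h', volForm_apply, Basis.det_comp]
      push_cast
      rfl
    have e2 : β Z (B ∘ a) = c * (4 * Complex.I * ((qW (imW Z) : ℝ) : ℂ)) ^ n *
        (volConst Z * (B.det (B ∘ a) : ℝ)) := by
      rw [hβ, ContinuousAlternatingMap.smul_apply, ← volForm_apply h', volForm_eq,
        ContinuousAlternatingMap.smul_apply, smul_eq_mul, smul_eq_mul]
      field_simp
    rw [e1, e2]
    simp only [map_mul, Complex.conj_ofReal]
    push_cast
    ring
  have h2 : (∑ a : Fin k → Fin n × Fin 2, ((starRingEnd ℂ) (β Z fun t => frame (a t)) •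
      contract k (volForm h Z) (fun t => dualFrame Z (a t))) w) =
      ∑ a : Fin k → Fin k, (starRingEnd ℂ) (β Z (B ∘ a)) * volForm h Z
        (catFamily k (dualMap Z ∘ (B ∘ a)) w) := by
    symm
    refine Fintype.sum_equiv (Equiv.arrowCongr (Equiv.refl _) (frameIndex h')) _ _ fun a => ?_
    rw [ContinuousAlternatingMap.smul_apply, contract_apply, smul_eq_mul]
    simp only [Equiv.arrowCongr_apply, Equiv.coe_refl, Function.comp_def, Equiv.refl_symm, id,
      hB, realBasis_apply, dualMap_frame]
  rw [h2]
  simp only [h1]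
  rw [← Finset.mul_sum, ← Complex.ofReal_sum, sum_det_mul_self, smul_eq_mul]
  have hk : (k.factorial : ℂ) ≠ 0 := by exact_mod_cast k.factorial_ne_zero
  have h3 := volConst_normalization hn Z hZ
  change _ = (starRingEnd ℂ) (c * (4 * Complex.I * ((qW (imW Z) : ℝ) : ℂ)) ^ n)
  generalize (starRingEnd ℂ) (c * (4 * Complex.I * ((qW (imW Z) : ℝ) : ℂ)) ^ n) = C at *
  push_cast
  field_simp
  linear_combination C * h3

/-- `*̄ *̄ = -1` on one-forms. -/
theorem starBar_starBar_one {n k : ℕ} (h : k + (0 + 1) = 2 * n) (h' : (0 + 1) + k = 2 * n)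
    (β : WC n → Form n (0 + 1)) (Z : WC n) (hZ : qW (imW Z) ≠ 0) (γ : WC n → Form n k)
    (hγ : γ Z = starBar 0 h β Z) :
    starBar n h' γ Z = -β Z := by
  have hn : n ≠ 0 := by omega
  have hk1 : k + 1 = 2 * n := h
  ext w
  unfold starBar
  rw [ContinuousAlternatingMap.smul_apply, ContinuousAlternatingMap.sum_apply]
  set B := realBasis hk1 with hB
  -- With the free argument written as `dualMap Z w'`, all arguments of the outer volume form lie in
  -- the image of `dualMap`; its determinant comes out and the sum over `b` is
  -- `sum_det_cons_mul_det_cons`.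
  obtain ⟨w', hw'⟩ : ∃ w', dualMap Z w' = w 0 := by
    have hu : IsUnit (LinearMap.det (dualMap Z)) :=
      isUnit_iff_ne_zero.2 (det_dualMap_ne_zero hn Z hZ)
    obtain ⟨a, ha⟩ := (LinearMap.equivOfIsUnitDet hu).surjective (w 0)
    exact ⟨a, by rw [← ha, LinearMap.equivOfIsUnitDet_apply]⟩
  have h1 : ∀ b : Fin k → Fin (k + 1), (starRingEnd ℂ) (γ Z (B ∘ b)) * volForm h' Z
      (catFamily k (dualMap Z ∘ (B ∘ b)) w) = ∑ a : Fin (k + 1), (β Z fun _ => B a) *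
        (-((starRingEnd ℂ) (volConst Z) * volConst Z *
          ((LinearMap.det (dualMap Z) : ℝ) : ℂ)) *
        ((B.det (Fin.cons (dualMap Z (B a)) (B ∘ b)) * B.det (Fin.cons w' (B ∘ b)) : ℝ) : ℂ)) := by
    intro b
    have e1 : volForm h' Z (catFamily k (dualMap Z ∘ (B ∘ b)) w) =
        -(volConst Z * ((LinearMap.det (dualMap Z) : ℝ) * (B.det (Fin.cons w' (B ∘ b)) : ℝ))) := by
      rw [volForm_eq, ContinuousAlternatingMap.smul_apply, detZ_catFamily_one, smul_neg,
        ← ContinuousAlternatingMap.smul_apply, ← volForm_eq hk1, volForm_apply, ← hw',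
        show (Fin.cons (dualMap Z w') (dualMap Z ∘ (B ∘ b)) : Fin (k + 1) → WC n) =
          dualMap Z ∘ Fin.cons w' (B ∘ b) from (Fin.comp_cons _ _ _).symm, Basis.det_comp]
      push_cast
      rfl
    have e2 : γ Z (B ∘ b) = ∑ a : Fin (k + 1), (starRingEnd ℂ) (β Z fun _ => B a) *
        (volConst Z * (B.det (Fin.cons (dualMap Z (B a)) (B ∘ b)) : ℝ)) := by
      rw [hγ, starBar_one_apply]
      symm
      refine Fintype.sum_equiv (frameIndex hk1) _ _ fun a => ?_
      rw [hB, realBasis_apply, dualMap_frame, volForm_apply]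
    rw [e1, e2, map_sum, Finset.sum_mul]
    refine Finset.sum_congr rfl fun a _ => ?_
    simp only [map_mul, Complex.conj_ofReal, Complex.conj_conj]
    push_cast
    ring
  have h2 : (∑ a : Fin k → Fin n × Fin 2, ((starRingEnd ℂ) (γ Z fun t => frame (a t)) •
      contract k (volForm h' Z) (fun t => dualFrame Z (a t))) w) =
      ∑ b : Fin k → Fin (k + 1), (starRingEnd ℂ) (γ Z (B ∘ b)) * volForm h' Z
        (catFamily k (dualMap Z ∘ (B ∘ b)) w) := by
    symm
    refine Fintype.sum_equiv (Equiv.arrowCongr (Equiv.refl _) (frameIndex hk1)) _ _ fun a => ?_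
    rw [ContinuousAlternatingMap.smul_apply, contract_apply, smul_eq_mul]
    simp only [Equiv.arrowCongr_apply, Equiv.coe_refl, Function.comp_def, Equiv.refl_symm, id,
      hB, realBasis_apply, dualMap_frame]
  rw [h2]
  simp only [h1]
  rw [Finset.sum_comm]
  simp only [← Finset.mul_sum, ← Complex.ofReal_sum, sum_det_cons_mul_det_cons]
  -- By symmetry of the metric the inner sum is the `a`-th coordinate of `dualMap Z w'`, so summing
  -- against β reproduces β on the free argument.
  have h4 : ∑ a : Fin (k + 1), (β Z fun _ => B a) *
      ((∑ c, B.repr (dualMap Z (B a)) c * B.repr w' c : ℝ) : ℂ) = β Z w := by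
    have hw : w = fun _ => dualMap Z w' := by
      funext i; rw [hw', Subsingleton.elim (α := Fin 1) i 0]
    have hu : ∀ z : WC n, (fun _ => z : Fin (0 + 1) → WC n) =
        Function.update (fun _ => 0) 0 z := by
      intro z; funext i
      rw [Subsingleton.elim (α := Fin 1) i 0, Function.update_self]
    let f : WC n →ₗ[ℝ] ℂ :=
      { toFun := fun z => β Z (fun _ => z)
        map_add' := fun x y => by
          rw [hu, hu x, hu y]
          exact (β Z).map_update_add (fun _ => 0) 0 x y
        map_smul' := fun r x => by
          rw [hu, hu x]
          exact (β Z).map_update_smul (fun _ => 0) 0 r x }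
    have h5 : β Z w = f (dualMap Z w') := by rw [hw]; rfl
    rw [h5, ← B.sum_repr (dualMap Z w'), map_sum]
    refine Finset.sum_congr rfl fun a _ => ?_
    have h6 : B.repr (dualMap Z w') a = ∑ c, B.repr (dualMap Z (B a)) c * B.repr w' c := by
      conv_lhs => rw [← B.sum_repr w']
      simp only [map_sum, map_smul, Finsupp.coe_finsetSum, Finset.sum_apply, Finsupp.smul_apply,
        smul_eq_mul]
      refine Finset.sum_congr rfl fun c _ => ?_
      rw [hB, repr_dualMap_symm, mul_comm]
    rw [map_smul, h6, Complex.real_smul, mul_comm]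
    rfl
  have hk : (k.factorial : ℂ) ≠ 0 := by exact_mod_cast k.factorial_ne_zero
  have h3 := volConst_normalization hn Z hZ
  change _ = -(β Z w)
  rw [← h4, smul_eq_mul, Finset.mul_sum, ← Finset.sum_neg_distrib]
  refine Finset.sum_congr rfl fun a _ => ?_
  rw [Complex.ofReal_mul, Complex.ofReal_natCast]
  generalize ((∑ c, B.repr (dualMap Z (B a)) c * B.repr w' c : ℝ) : ℂ) = S
  field_simp
  linear_combination (-(S * β Z fun _ => B a)) * h3

end

end PolarHarmonic


namespace PolarHarmonic

open Module

noncomputable section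

/-! ## The quadratic space -/

section Bilinear

variable {n : ℕ} {R : Type} [CommRing R]

theorem bV_comm (x y : QSpace n R) : bV x y = bV y x := by
  unfold bV
  have : ∑ j, eps R j * x.2.2 j * y.2.2 j = ∑ j, eps R j * y.2.2 j * x.2.2 j :=
    Finset.sum_congr rfl fun j _ => by ring
  rw [this]; ring

theorem bV_add_left (x y z : QSpace n R) : bV (x + y) z = bV x z + bV y z := by
  simp only [bV, Prod.fst_add, Prod.snd_add, Pi.add_apply, mul_add, add_mul,
    Finset.sum_add_distrib]
  ring

theorem bV_smul_left (c : R) (x z : QSpace n R) : bV (c • x) z = c * bV x z := by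
  simp only [bV, Prod.smul_fst, Prod.smul_snd, Pi.smul_apply, smul_eq_mul, mul_add,
    Finset.mul_sum]
  congr 1
  · ring
  · exact Finset.sum_congr rfl fun j _ => by ring

theorem bV_add_right (x y z : QSpace n R) : bV x (y + z) = bV x y + bV x z := by
  rw [bV_comm, bV_add_left, bV_comm y, bV_comm z]

theorem bV_smul_right (c : R) (x z : QSpace n R) : bV x (c • z) = c * bV x z := by
  rw [bV_comm, bV_smul_left, bV_comm z]

theorem bV_neg_left (x z : QSpace n R) : bV (-x) z = -bV x z := by
  rw [← neg_one_smul R, bV_smul_left, neg_one_mul]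

theorem bV_sub_left (x y z : QSpace n R) : bV (x - y) z = bV x z - bV y z := by
  rw [sub_eq_add_neg, bV_add_left, bV_neg_left, sub_eq_add_neg]

theorem bV_sub_right (x y z : QSpace n R) : bV x (y - z) = bV x y - bV x z := by
  rw [bV_comm, bV_sub_left, bV_comm y, bV_comm z]

theorem bV_self (x : QSpace n R) : bV x x = 2 * qV x := by
  unfold bV qV qW
  rw [mul_add]
  congr 1
  · ring
  · rw [Finset.mul_sum, Finset.mul_sum]
    exact Finset.sum_congr rfl fun j _ => by ring

theorem qV_add (x y : QSpace n R) : qV (x + y) = qV x + qV y + bV x y := by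
  simp only [qV, qW, bV, Prod.fst_add, Prod.snd_add, Pi.add_apply, Finset.mul_sum]
  have : ∑ j, eps R j * (x.2.2 j + y.2.2 j) ^ 2 = ∑ j, eps R j * x.2.2 j ^ 2 +
      ∑ j, eps R j * y.2.2 j ^ 2 + ∑ j, 2 * (eps R j * x.2.2 j * y.2.2 j) := by
    rw [← Finset.sum_add_distrib, ← Finset.sum_add_distrib]
    exact Finset.sum_congr rfl fun j _ => by ring
  rw [this]; ring

theorem qV_smul (c : R) (x : QSpace n R) : qV (c • x) = c ^ 2 * qV x := by
  simp only [qV, qW, Prod.smul_fst, Prod.smul_snd, Pi.smul_apply, smul_eq_mul, mul_add,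
    Finset.mul_sum]
  congr 1
  · ring
  · exact Finset.sum_congr rfl fun j _ => by ring

/-- The bilinear form `∑ ε_j a_j b_j` on `W(ℂ)`. -/
def bW (a b : WC n) : ℂ := ∑ j, eps ℂ j * a j * b j

theorem bW_comm (a b : WC n) : bW a b = bW b a :=
  Finset.sum_congr rfl fun j _ => by ring

theorem bW_smul_left (r : ℂ) (a c : WC n) : bW (r • a) c = r * bW a c := by
  simp only [bW, Pi.smul_apply, smul_eq_mul, Finset.mul_sum]
  exact Finset.sum_congr rfl fun j _ => by ring

theorem bW_sub_left (a b c : WC n) : bW (a - b) c = bW a c - bW b c := by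
  simp only [bW, Pi.sub_apply, mul_sub, sub_mul, Finset.sum_sub_distrib]

theorem bW_sub_right (a b c : WC n) : bW a (b - c) = bW a b - bW a c := by
  rw [bW_comm, bW_sub_left, bW_comm b, bW_comm c]

theorem bW_smul_right (r : ℂ) (a c : WC n) : bW a (r • c) = r * bW a c := by
  rw [bW_comm, bW_smul_left, bW_comm c]

end Bilinear

/-! ### Hermitian geometry of the upper half plane: the covectors θ_l and their metric duals -/

section HalfSpace

variable {n : ℕ}

/-- The imaginary part as a complex vector. -/
def yC (Z : WC n) : WC n := fun j => ((Z j).im : ℂ)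

/-- `q(Y)` as a complex number. -/
def qC (Z : WC n) : ℂ := ((qW (imW Z) : ℝ) : ℂ)

/-- The component of a real vector in `W(ℂ)`. -/
def wC (l : QSpace n ℝ) : WC n := fun j => (l.2.2 j : ℂ)

theorem yC_eq (Z : WC n) : yC Z = (1 / (2 * Complex.I)) • (Z - conjW Z) := by
  funext j
  simp only [yC, Pi.smul_apply, Pi.sub_apply, conjW, smul_eq_mul, Complex.sub_conj]
  field_simp
  push_cast
  ring

theorem eps_ofReal (j : Fin n) : ((eps ℝ j : ℝ) : ℂ) = eps ℂ j := by
  unfold eps; split_ifs <;> simp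

theorem conj_eps (j : Fin n) : (starRingEnd ℂ) (eps ℂ j) = eps ℂ j := by
  unfold eps; split_ifs <;> simp

theorem qC_eq (Z : WC n) : qC Z = bW (yC Z) (yC Z) := by
  unfold qC qW bW yC imW
  push_cast
  exact Finset.sum_congr rfl fun j _ => by rw [eps_ofReal]; ring

theorem qW_eq_bW (Z : WC n) : qW Z = bW Z Z :=
  Finset.sum_congr rfl fun j _ => by ring

theorem pairPsi_eq (l : QSpace n ℝ) (Z : WC n) :
    pairPsi l Z = l.1 - l.2.1 * bW Z Z + 2 * bW (wC l) Z := by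
  rw [pairPsi, ← qW_eq_bW]
  simp only [bV, toC, psi, bW, wC]
  ring

theorem conjW_conjW (Z : WC n) : conjW (conjW Z) = Z := by
  funext j; simp [conjW]

theorem conj_bW (a b : WC n) : (starRingEnd ℂ) (bW a b) = bW (conjW a) (conjW b) := by
  simp only [bW, map_sum, map_mul, conj_eps]
  rfl

theorem conjW_wC (l : QSpace n ℝ) : conjW (wC l) = wC l := by
  funext j; simp [conjW, wC]

theorem conj_qC (Z : WC n) : (starRingEnd ℂ) (qC Z) = qC Z := Complex.conj_ofReal _

theorem pairPsi_conjW (l : QSpace n ℝ) (Z : WC n) :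
    pairPsi l (conjW Z) = (starRingEnd ℂ) (pairPsi l Z) := by
  rw [pairPsi_eq, pairPsi_eq]
  simp only [map_add, map_sub, map_mul, Complex.conj_ofReal, conj_bW, map_ofNat, conjW_wC]

/-- The components of `∂̄ ((l, ψ(conj Z)) / q(Y))`. -/
def thetaV (l : QSpace n ℝ) (Z : WC n) : WC n := fun k =>
  2 * eps ℂ k * (l.2.2 k - l.2.1 * (starRingEnd ℂ) (Z k)) / qC Z -
    Complex.I * pairPsi l (conjW Z) * eps ℂ k * (Z k).im / qC Z ^ 2

/-- Half of the metric dual of `thetaV`. -/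
def gradV (l : QSpace n ℝ) (Z : WC n) : WC n :=
  -((Complex.I * pairPsi l Z / qC Z) • yC Z) - (2 : ℂ) • (wC l - (l.2.1 : ℂ) • Z)

/-- Expansion with Y = (Z - conj Z)/(2i). It is used to trade the product of Y with the W-component
for the two conjugate pairings. -/
theorem pairPsi_sub_conj (l : QSpace n ℝ) (Z : WC n) :
    4 * Complex.I * bW (yC Z) (wC l - (l.2.1 : ℂ) • conjW Z) =
      pairPsi l Z - 4 * l.2.1 * qC Z - pairPsi l (conjW Z) := by
  rw [pairPsi_eq, pairPsi_eq, qC_eq, yC_eq]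
  simp only [bW_sub_left, bW_sub_right, bW_smul_left, bW_smul_right, bW_comm (conjW Z) Z,
    bW_comm Z (wC l), bW_comm (conjW Z) (wC l)]
  have hI : (Complex.I) ≠ 0 := Complex.I_ne_zero
  have h2 : Complex.I⁻¹ ^ 2 = -1 := by rw [inv_pow, Complex.I_sq]; norm_num
  field_simp
  simp only [Complex.I_sq]
  ring

theorem sum_y_mul_theta (l : QSpace n ℝ) (Z : WC n) (hq : qC Z ≠ 0) :
    ∑ j, ((Z j).im : ℂ) * thetaV l Z j =
      2 * bW (yC Z) (wC l - (l.2.1 : ℂ) • conjW Z) / qC Z -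
        Complex.I * pairPsi l (conjW Z) / qC Z := by
  have h1 : ∑ j, ((Z j).im : ℂ) * thetaV l Z j =
      2 * bW (yC Z) (wC l - (l.2.1 : ℂ) • conjW Z) / qC Z -
        Complex.I * pairPsi l (conjW Z) / qC Z ^ 2 * bW (yC Z) (yC Z) := by
    simp only [bW, Finset.mul_sum, Finset.sum_div]
    rw [← Finset.sum_sub_distrib]
    refine Finset.sum_congr rfl fun j _ => ?_
    simp only [thetaV, yC, Pi.sub_apply, Pi.smul_apply, smul_eq_mul, wC, conjW]
    ring
  rw [h1, ← qC_eq]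
  field_simp

theorem half_metricMap_theta (l : QSpace n ℝ) (Z : WC n) (hq : qC Z ≠ 0) :
    (1 / 2 : ℂ) • metricMap (imW Z) (thetaV l Z) = gradV l Z := by
  funext k
  rw [Pi.smul_apply, metricMap_apply']
  have h1 := sum_y_mul_theta l Z hq
  have h2 := pairPsi_sub_conj l Z
  change (1 / 2 : ℂ) • (4 * ((Z k).im : ℂ) * (∑ j, ((Z j).im : ℂ) * thetaV l Z j) -
    2 * qC Z * eps ℂ k * thetaV l Z k) = _
  rw [h1]
  set E := bW (yC Z) (wC l - (l.2.1 : ℂ) • conjW Z)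
  have hE : E = -Complex.I * (pairPsi l Z - 4 * l.2.1 * qC Z - pairPsi l (conjW Z)) / 4 := by
    rw [← h2]
    linear_combination E * Complex.I_sq
  rw [hE]
  have hz : (starRingEnd ℂ) (Z k) = Z k - 2 * ((Z k).im : ℂ) * Complex.I := by
    apply Complex.ext <;> simp; ring
  simp only [thetaV, gradV, Pi.sub_apply, Pi.neg_apply, Pi.smul_apply, smul_eq_mul, yC, wC, hz]
  field_simp
  linear_combination (2 * pairPsi l (conjW Z) * Complex.I * ((Z k).im : ℂ) -
    4 * qC Z * (l.2.2 k - l.2.1 * (Z k - 2 * ((Z k).im : ℂ) * Complex.I))) *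
    eps_mul_self (R := ℂ) k

theorem toC_bV (l l' : QSpace n ℝ) : ((bV l l' : ℝ) : ℂ) =
    l.1 * l'.2.1 + l.2.1 * l'.1 + 2 * bW (wC l) (wC l') := by
  unfold bV bW wC
  push_cast
  simp only [eps_ofReal]

/-- The hermitian product of two covectors involves only the pairings with ψ, the product of the
vectors, and q(Y), all of which have known transformation laws. Equivariance of the metric rests on
this; for equal vectors it also enters the divergence of the polar form. -/
theorem sum_theta_mul_conj_grad (l l' : QSpace n ℝ) (Z : WC n) (hq : qC Z ≠ 0) :
    ∑ k, thetaV l Z k * (starRingEnd ℂ) (gradV l' Z k) =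
      (pairPsi l Z * pairPsi l' (conjW Z) + pairPsi l (conjW Z) * pairPsi l' Z) / (2 * qC Z ^ 2) -
        2 * ((bV l l' : ℝ) : ℂ) / qC Z := by
  have h1 : ∑ k, thetaV l Z k * (starRingEnd ℂ) (gradV l' Z k) =
      Complex.I * pairPsi l' (conjW Z) / qC Z * (∑ j, ((Z j).im : ℂ) * thetaV l Z j) -
      2 * (2 * bW (wC l - (l.2.1 : ℂ) • conjW Z) (wC l' - (l'.2.1 : ℂ) • conjW Z) / qC Z -
        Complex.I * pairPsi l (conjW Z) / qC Z ^ 2 *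
          bW (yC Z) (wC l' - (l'.2.1 : ℂ) • conjW Z)) := by
    simp only [bW, Finset.mul_sum, Finset.sum_div]
    rw [← Finset.sum_sub_distrib, Finset.mul_sum, ← Finset.sum_sub_distrib]
    refine Finset.sum_congr rfl fun j _ => ?_
    simp only [gradV, Pi.sub_apply, Pi.neg_apply, Pi.smul_apply, smul_eq_mul, map_sub, map_neg,
      map_mul, map_div₀, Complex.conj_I, conj_qC, ← pairPsi_conjW, yC, Complex.conj_ofReal,
      map_ofNat, wC]
    simp only [thetaV, conjW]
    ring
  rw [h1, sum_y_mul_theta l Z hq]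
  have h2 := pairPsi_sub_conj l Z
  have h2' := pairPsi_sub_conj l' Z
  have hB : 2 * bW (wC l - (l.2.1 : ℂ) • conjW Z) (wC l' - (l'.2.1 : ℂ) • conjW Z) =
      ((bV l l' : ℝ) : ℂ) - l.2.1 * pairPsi l' (conjW Z) - l'.2.1 * pairPsi l (conjW Z) := by
    rw [toC_bV, pairPsi_eq, pairPsi_eq]
    simp only [bW_sub_left, bW_sub_right, bW_smul_left, bW_smul_right, bW_comm (conjW Z) (wC _)]
    ring
  set E := bW (yC Z) (wC l - (l.2.1 : ℂ) • conjW Z)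
  set E' := bW (yC Z) (wC l' - (l'.2.1 : ℂ) • conjW Z)
  rw [hB]
  field_simp
  linear_combination (pairPsi l' (conjW Z)) * h2 + (pairPsi l (conjW Z)) * h2' -
    2 * (pairPsi l' (conjW Z)) * (pairPsi l (conjW Z)) * Complex.I_sq

/-- The covectors `thetaV l Z` span. -/
theorem eq_zero_of_forall_theta (Z : WC n) (hq : qC Z ≠ 0) (w : WC n)
    (h : ∀ l : QSpace n ℝ, ∑ k, thetaV l Z k * w k = 0) : w = 0 := by
  have h1 : ∑ k, eps ℂ k * (Z k).im * w k = 0 := by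
    have := h (1, 0, 0)
    have hp : pairPsi ((1, 0, 0) : QSpace n ℝ) (conjW Z) = 1 := by
      rw [pairPsi_eq]; simp [bW, wC]
    simp only [thetaV, hp] at this
    have h3 : (-Complex.I / qC Z ^ 2) * ∑ k, eps ℂ k * (Z k).im * w k = 0 := by
      rw [← this, Finset.mul_sum]
      refine Finset.sum_congr rfl fun k _ => ?_
      simp
      ring
    rcases mul_eq_zero.1 h3 with h4 | h4
    · simp [hq] at h4
    · exact h4
  funext j
  have := h (0, 0, Pi.single j 1)
  simp only [thetaV, sub_mul, Finset.sum_sub_distrib] at this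
  have h3 : ∑ k, Complex.I * pairPsi ((0, 0, Pi.single j 1) : QSpace n ℝ) (conjW Z) *
      eps ℂ k * (Z k).im / qC Z ^ 2 * w k = 0 := by
    have h4 : ∑ k, Complex.I * pairPsi ((0, 0, Pi.single j 1) : QSpace n ℝ) (conjW Z) *
      eps ℂ k * (Z k).im / qC Z ^ 2 * w k =
      (Complex.I * pairPsi ((0, 0, Pi.single j 1) : QSpace n ℝ) (conjW Z) / qC Z ^ 2) *
      ∑ k, eps ℂ k * (Z k).im * w k := by
      rw [Finset.mul_sum]
      exact Finset.sum_congr rfl fun k _ => by ring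
    rw [h4, h1, mul_zero]
  rw [h3, sub_zero, Finset.sum_eq_single j] at this
  · have he : eps ℂ j ≠ 0 := by unfold eps; split_ifs <;> simp
    simpa [hq, he] using this
  · intro k _ hk
    simp [hk]
  · simp

end HalfSpace

end

end PolarHarmonic


namespace PolarHarmonic

open Module

noncomputable section

/-! ## The action of `O^+(V(ℝ))` -/

section Action

variable {n : ℕ}

theorem toC_reV_add (w : QSpace n ℂ) : toC (reV w) + Complex.I • toC (imV w) = w := by
  refine Prod.ext ?_ (Prod.ext ?_ (funext fun j => ?_))
  · simp [toC, reV, imV, mul_comm Complex.I]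
  · simp [toC, reV, imV, mul_comm Complex.I]
  · simp [toC, reV, imV, mul_comm Complex.I]

theorem bV_toC (x y : QSpace n ℝ) : bV (toC x) (toC y) = ((bV x y : ℝ) : ℂ) := by
  simp only [bV, toC]
  push_cast
  simp only [eps_ofReal]

theorem reV_extC (g : LinAut n) (w : QSpace n ℂ) : reV (extC g w) = g (reV w) := by
  unfold extC
  refine Prod.ext ?_ (Prod.ext ?_ (funext fun j => ?_)) <;> simp [reV, toC]

theorem imV_extC (g : LinAut n) (w : QSpace n ℂ) : imV (extC g w) = g (imV w) := by
  unfold extC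
  refine Prod.ext ?_ (Prod.ext ?_ (funext fun j => ?_)) <;> simp [imV, toC]

theorem ext_reV_imV {v w : QSpace n ℂ} (h1 : reV v = reV w) (h2 : imV v = imV w) : v = w := by
  rw [← toC_reV_add v, ← toC_reV_add w, h1, h2]

theorem extC_smul (g : LinAut n) (c : ℂ) (w : QSpace n ℂ) : extC g (c • w) = c • extC g w := by
  have h1 : ∀ v : QSpace n ℂ, reV (c • v) = c.re • reV v - c.im • imV v := by
    intro v
    refine Prod.ext ?_ (Prod.ext ?_ (funext fun j => ?_)) <;> simp [reV, imV]
  have h2 : ∀ v : QSpace n ℂ, imV (c • v) = c.re • imV v + c.im • reV v := by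
    intro v
    refine Prod.ext ?_ (Prod.ext ?_ (funext fun j => ?_)) <;> simp [reV, imV]
  apply ext_reV_imV
  · rw [reV_extC, h1, h1, reV_extC, imV_extC, map_sub, map_smul, map_smul]
  · rw [imV_extC, h2, h2, reV_extC, imV_extC, map_add, map_smul, map_smul]

theorem extC_extC_inv (g : LinAut n) (w : QSpace n ℂ) : extC g (extC g⁻¹ w) = w := by
  apply ext_reV_imV
  · rw [reV_extC, reV_extC]; exact g.apply_symm_apply _
  · rw [imV_extC, imV_extC]; exact g.apply_symm_apply _

theorem bV_map {g : LinAut n} (hg : ∀ x, qV (g x) = qV x) (x y : QSpace n ℝ) :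
    bV (g x) (g y) = bV x y := by
  have h1 := qV_add x y
  have h2 := qV_add (g x) (g y)
  rw [← map_add, hg, hg, hg] at h2
  linarith

theorem bV_toC_extC {g : LinAut n} (hg : ∀ x, qV (g x) = qV x) (l : QSpace n ℝ)
    (w : QSpace n ℂ) : bV (toC (g l)) (extC g w) = bV (toC l) w := by
  conv_rhs => rw [← toC_reV_add w]
  unfold extC
  rw [bV_add_right, bV_add_right, bV_smul_right, bV_smul_right, bV_toC, bV_toC, bV_toC, bV_toC,
    bV_map hg, bV_map hg]

theorem bV_extC {g : LinAut n} (hg : ∀ x, qV (g x) = qV x) (v w : QSpace n ℂ) :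
    bV (extC g v) (extC g w) = bV v w := by
  conv_rhs => rw [← toC_reV_add v, bV_add_left, bV_smul_left]
  conv_lhs => rw [extC]
  rw [bV_add_left, bV_smul_left, bV_toC_extC hg, bV_toC_extC hg]

/-- Complex conjugation on `V(ℂ)`. -/
def conjV (w : QSpace n ℂ) : QSpace n ℂ :=
  ((starRingEnd ℂ) w.1, (starRingEnd ℂ) w.2.1, conjW w.2.2)

theorem conjV_extC (g : LinAut n) (w : QSpace n ℂ) : conjV (extC g w) = extC g (conjV w) := by
  have h1 : ∀ w : QSpace n ℂ, reV (conjV w) = reV w := fun w => by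
    refine Prod.ext ?_ (Prod.ext ?_ (funext fun j => ?_)) <;> simp [reV, conjV, conjW]
  have h2 : ∀ w : QSpace n ℂ, imV (conjV w) = -imV w := fun w => by
    refine Prod.ext ?_ (Prod.ext ?_ (funext fun j => ?_)) <;> simp [imV, conjV, conjW]
  apply ext_reV_imV
  · rw [h1, reV_extC, reV_extC, h1]
  · rw [h2, imV_extC, imV_extC, h2, map_neg]

theorem qV_psi (Z : WC n) : qV (psi Z) = 0 := by simp [qV, psi]

theorem bV_psi_conj (Z : WC n) : bV (psi Z) (conjV (psi Z)) = 4 * qC Z := by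
  have h : bV (psi Z) (conjV (psi Z)) =
      -bW Z Z - bW (conjW Z) (conjW Z) + 2 * bW Z (conjW Z) := by
    rw [← conj_bW, ← qW_eq_bW]
    simp only [bV, psi, conjV, map_neg, map_one, bW]
    ring
  rw [h, qC_eq, yC_eq]
  simp only [bW_sub_left, bW_sub_right, bW_smul_left, bW_smul_right, bW_comm (conjW Z) Z]
  have hI : (Complex.I) ≠ 0 := Complex.I_ne_zero
  field_simp
  simp only [Complex.I_sq]
  ring

theorem autFactor_eq_snd (g : LinAut n) (Z : WC n) : autFactor g Z = (extC g (psi Z)).2.1 := by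
  simp [autFactor, bV]

theorem qC_ne_zero {Z : WC n} (hZ : Z ∈ upperHalf n) : qC Z ≠ 0 := by
  have := hZ.1
  simp only [qC, ne_eq, Complex.ofReal_eq_zero]
  exact this.ne'

theorem autFactor_ne_zero {g : LinAut n} (hg : IsOPlus g) {Z : WC n} (hZ : Z ∈ upperHalf n) :
    autFactor g Z ≠ 0 := by
  intro h
  have h1 := (hg.2 Z hZ).1
  -- If the factor were 0, its inverse would be 0 by convention and the point would be sent to 0,
  -- which has q(Y) = 0.
  rw [act, h] at h1
  simp [imW, qW] at h1

/-- The last two coordinates agree by the definitions of the factor and of the action. The first is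
forced because both vectors are isotropic and the factor is nonzero. -/
theorem extC_psi {g : LinAut n} (hg : IsOPlus g) {Z : WC n} (hZ : Z ∈ upperHalf n) :
    extC g (psi Z) = autFactor g Z • psi (act g Z) := by
  have hj := autFactor_ne_zero hg hZ
  have h2 : (extC g (psi Z)).2.2 = autFactor g Z • act g Z := by
    rw [act, smul_inv_smul₀ hj]
  have h3 := bV_extC hg.1 (psi Z) (psi Z)
  rw [bV_self, bV_self, qV_psi, mul_zero, mul_eq_zero] at h3
  have h4 : qV (extC g (psi Z)) = 0 := by simpa using h3
  rw [qV, h2, ← autFactor_eq_snd] at h4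
  have h5 : qW (autFactor g Z • act g Z) = autFactor g Z ^ 2 * qW (act g Z) := by
    rw [qW_eq_bW, qW_eq_bW, bW_smul_left, bW_smul_right]; ring
  rw [h5] at h4
  refine Prod.ext ?_ (Prod.ext ?_ h2)
  · have h6 : autFactor g Z * ((extC g (psi Z)).1 + autFactor g Z * qW (act g Z)) = 0 := by
      linear_combination h4
    rcases mul_eq_zero.1 h6 with h7 | h7
    · exact absurd h7 hj
    · change (extC g (psi Z)).1 = autFactor g Z * (-qW (act g Z))
      linear_combination h7
  · rw [← autFactor_eq_snd]; simp [psi]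

theorem pairPsi_act {g : LinAut n} (hg : IsOPlus g) {Z : WC n} (hZ : Z ∈ upperHalf n)
    (l : QSpace n ℝ) : autFactor g Z * pairPsi (g l) (act g Z) = pairPsi l Z := by
  rw [pairPsi, pairPsi, ← bV_smul_right, ← extC_psi hg hZ, bV_toC_extC hg.1]

theorem conjV_smul (c : ℂ) (w : QSpace n ℂ) : conjV (c • w) = (starRingEnd ℂ) c • conjV w := by
  refine Prod.ext ?_ (Prod.ext ?_ (funext fun j => ?_)) <;> simp [conjV, conjW]

/-- Isometries commute with conjugation and preserve (ψ, conj ψ) = 4 q(Y). -/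
theorem qC_act {g : LinAut n} (hg : IsOPlus g) {Z : WC n} (hZ : Z ∈ upperHalf n) :
    autFactor g Z * (starRingEnd ℂ) (autFactor g Z) * qC (act g Z) = qC Z := by
  have h1 := bV_psi_conj Z
  rw [← bV_extC hg.1, ← conjV_extC, extC_psi hg hZ, conjV_smul, bV_smul_left, bV_smul_right,
    bV_psi_conj] at h1
  linear_combination h1 / 4

theorem pairPsi_eq_autFactor_inv {g : LinAut n} (hg : ∀ x, qV (g x) = qV x) (Z : WC n)
    (l : QSpace n ℝ) : bV (toC l) (extC g (psi Z)) = pairPsi (g⁻¹ l) Z := by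
  rw [pairPsi, ← bV_toC_extC hg (g⁻¹ l)]
  rw [show g (g⁻¹ l) = l from g.apply_symm_apply l]

theorem autFactor_eq_pairPsi {g : LinAut n} (hg : ∀ x, qV (g x) = qV x) (Z : WC n) :
    autFactor g Z = pairPsi (g⁻¹ (1, 0, 0)) Z := by
  rw [← pairPsi_eq_autFactor_inv hg, autFactor]
  congr 1

/-- The vector ε_j b_j / 2 pairs to 1 with b_j, so it reads off the `j`-th coordinate. Coordinates
of the action thus become quotients of polynomial functions, and holomorphy follows. -/
theorem act_apply_eq {g : LinAut n} (hg : ∀ x, qV (g x) = qV x) (Z : WC n) (j : Fin n) :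
    act g Z j = pairPsi (g⁻¹ (0, 0, Pi.single j (eps ℝ j / 2))) Z /
      pairPsi (g⁻¹ (1, 0, 0)) Z := by
  rw [← autFactor_eq_pairPsi hg, ← pairPsi_eq_autFactor_inv hg, act, Pi.smul_apply, smul_eq_mul,
    inv_mul_eq_div]
  congr 1
  simp only [bV, toC, Complex.ofReal_zero, zero_mul, zero_add]
  rw [Finset.sum_eq_single j]
  · simp only [Pi.single_eq_same, Complex.ofReal_div, eps_ofReal, Complex.ofReal_ofNat]
    linear_combination (-(extC g (psi Z)).2.2 j) * eps_mul_self (R := ℂ) j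
  · intro k _ hk
    simp [hk]
  · simp

theorem act_act_inv {g : LinAut n} (hg : IsOPlus g) (hg' : IsOPlus g⁻¹) {Z : WC n}
    (hZ : Z ∈ upperHalf n) : act g (act g⁻¹ Z) = Z := by
  have h1 := extC_psi hg' hZ
  have h2 := extC_psi hg (hg'.2 Z hZ)
  have h3 := extC_extC_inv g (psi Z)
  rw [h1, extC_smul, h2, smul_smul] at h3
  have h4 : autFactor g⁻¹ Z * autFactor g (act g⁻¹ Z) = 1 := by
    have := congrArg (fun w : QSpace n ℂ => w.2.1) h3
    simpa [psi] using this
  rw [h4, one_smul] at h3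
  exact congrArg (fun w : QSpace n ℂ => w.2.2) h3

theorem differentiable_pairPsi (l : QSpace n ℝ) : Differentiable ℂ (pairPsi l) := by
  have : pairPsi l = fun Z => (l.1 : ℂ) - l.2.1 * (∑ j, eps ℂ j * Z j * Z j) +
      2 * ∑ j, eps ℂ j * wC l j * Z j := by
    funext Z; rw [pairPsi_eq]; rfl
  rw [this]
  fun_prop

theorem differentiableAt_act {g : LinAut n} (hg : IsOPlus g) {Z : WC n} (hZ : Z ∈ upperHalf n) :
    DifferentiableAt ℂ (act g) Z := by
  rw [differentiableAt_pi]
  intro j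
  have h : (fun Z => act g Z j) = fun Z => pairPsi (g⁻¹ (0, 0, Pi.single j (eps ℝ j / 2))) Z /
      pairPsi (g⁻¹ (1, 0, 0)) Z := funext fun Z => act_apply_eq hg.1 Z j
  rw [h]
  have h0 : pairPsi (g⁻¹ (1, 0, 0)) Z ≠ 0 := by
    rw [← autFactor_eq_pairPsi hg.1]
    exact autFactor_ne_zero hg hZ
  have h1 := differentiable_pairPsi (g⁻¹ (0, 0, Pi.single j (eps ℝ j / 2))) Z
  have h2 := differentiable_pairPsi (g⁻¹ (1, 0, 0)) Z
  simp only [div_eq_mul_inv]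
  exact h1.mul (h2.inv h0)

theorem isOpen_upperHalf : IsOpen (upperHalf n) := by
  have h : upperHalf n = {Z | 0 < qW (imW Z)} ∩ ⋂ j : Fin n, {Z | (j : ℕ) = 0 → 0 < (Z j).im} := by
    ext Z; simp [upperHalf]
  rw [h]
  refine IsOpen.inter (isOpen_lt continuous_const ?_) (isOpen_iInter_of_finite fun j => ?_)
  · unfold qW imW
    fun_prop
  · by_cases hj : (j : ℕ) = 0
    · simp only [hj, true_imp_iff]
      exact isOpen_lt continuous_const (by fun_prop)
    · simp [hj]

end Action

end

end PolarHarmonic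


namespace PolarHarmonic

open Module

noncomputable section

/-! ## Antiholomorphic derivatives -/

section Dbar

variable {n : ℕ}

/-- `F` is real differentiable at `Z` with `∂F/∂conj(z_k) = D k`. -/
def HasDbarAt (F : WC n → ℂ) (D : WC n) (Z : WC n) : Prop :=
  ∃ F' : WC n →L[ℝ] ℂ, HasFDerivAt F F' Z ∧
    ∀ k, 1 / 2 * (F' (Pi.single k 1) + Complex.I * F' (Pi.single k Complex.I)) = D k

namespace HasDbarAt

variable {F G : WC n → ℂ} {D E Z : WC n}

theorem differentiableAt (h : HasDbarAt F D Z) : DifferentiableAt ℝ F Z :=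
  let ⟨_, h, _⟩ := h
  h.differentiableAt

theorem dbarAt_eq (h : HasDbarAt F D Z) (k : Fin n) : dbarAt F Z k = D k := by
  obtain ⟨F', h, hD⟩ := h
  rw [dbarAt, h.fderiv, hD]

theorem congr_deriv (h : HasDbarAt F D Z) (hDE : ∀ k, D k = E k) : HasDbarAt F E Z := by
  rwa [← show D = E from funext hDE]

theorem of_eventuallyEq (h : HasDbarAt F D Z) (hFG : G =ᶠ[nhds Z] F) : HasDbarAt G D Z := by
  obtain ⟨F', h, hD⟩ := h
  exact ⟨F', h.congr_of_eventuallyEq hFG, hD⟩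

theorem unique (h : HasDbarAt F D Z) (h' : HasDbarAt F E Z) : D = E := by
  funext k
  rw [← h.dbarAt_eq, ← h'.dbarAt_eq]

theorem const (c : ℂ) : HasDbarAt (fun _ : WC n => c) 0 Z :=
  ⟨0, hasFDerivAt_const _ _, fun k => by simp⟩

theorem of_differentiableAt (h : DifferentiableAt ℂ F Z) : HasDbarAt F 0 Z := by
  refine ⟨(fderiv ℂ F Z).restrictScalars ℝ, h.hasFDerivAt.restrictScalars ℝ, fun k => ?_⟩
  have : (Pi.single k Complex.I : WC n) = Complex.I • Pi.single k 1 := by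
    rw [← Pi.single_smul, smul_eq_mul, mul_one]
  simp only [ContinuousLinearMap.coe_restrictScalars', this, map_smul, smul_eq_mul, Pi.zero_apply]
  linear_combination (1 / 2 * fderiv ℂ F Z (Pi.single k 1)) * Complex.I_sq

theorem add (hF : HasDbarAt F D Z) (hG : HasDbarAt G E Z) :
    HasDbarAt (fun Z => F Z + G Z) (fun k => D k + E k) Z := by
  obtain ⟨F', hF, hD⟩ := hF
  obtain ⟨G', hG, hE⟩ := hG
  refine ⟨F' + G', hF.add hG, fun k => ?_⟩
  change _ = D k + E k
  rw [← hD, ← hE, _root_.add_apply, _root_.add_apply]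
  ring

theorem mul (hF : HasDbarAt F D Z) (hG : HasDbarAt G E Z) :
    HasDbarAt (fun Z => F Z * G Z) (fun k => F Z * E k + G Z * D k) Z := by
  obtain ⟨F', hF, hD⟩ := hF
  obtain ⟨G', hG, hE⟩ := hG
  refine ⟨F Z • G' + G Z • F', hF.mul hG, fun k => ?_⟩
  change _ = F Z * E k + G Z * D k
  rw [← hD, ← hE, _root_.add_apply, _root_.add_apply]
  simp only [_root_.smul_apply, smul_eq_mul]
  ring

theorem sum {ι : Type*} {s : Finset ι} {F : ι → WC n → ℂ} {D : ι → WC n}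
    (h : ∀ i ∈ s, HasDbarAt (F i) (D i) Z) :
    HasDbarAt (fun Z => ∑ i ∈ s, F i Z) (fun k => ∑ i ∈ s, D i k) Z := by
  classical
  induction s using Finset.induction_on with
  | empty =>
    simp only [Finset.sum_empty]
    exact const 0
  | insert a s ha ih =>
    simp only [Finset.sum_insert ha]
    exact (h a (Finset.mem_insert_self a s)).add
      (ih fun i hi => h i (Finset.mem_insert_of_mem hi))

theorem comp {φ : ℂ → ℂ} {φ' : ℂ} (hφ : HasDerivAt φ φ' (F Z)) (hF : HasDbarAt F D Z) :
    HasDbarAt (fun Z => φ (F Z)) (fun k => φ' * D k) Z := by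
  obtain ⟨F', hF, hD⟩ := hF
  refine ⟨_, (hφ.hasFDerivAt.restrictScalars ℝ).comp Z hF, fun k => ?_⟩
  change _ = φ' * D k
  rw [← hD]
  simp only [ContinuousLinearMap.comp_apply, ContinuousLinearMap.coe_restrictScalars']
  simp only [ContinuousLinearMap.toSpanSingleton_apply, smul_eq_mul]
  ring

theorem const_mul (c : ℂ) (hF : HasDbarAt F D Z) :
    HasDbarAt (fun Z => c * F Z) (fun k => c * D k) Z :=
  ((const c).mul hF).congr_deriv fun k => by simp

theorem neg (hF : HasDbarAt F D Z) : HasDbarAt (fun Z => -F Z) (fun k => -D k) Z := by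
  simpa using hF.const_mul (-1)

theorem sub (hF : HasDbarAt F D Z) (hG : HasDbarAt G E Z) :
    HasDbarAt (fun Z => F Z - G Z) (fun k => D k - E k) Z := by
  simpa [sub_eq_add_neg] using hF.add hG.neg

theorem inv (hF : HasDbarAt F D Z) (h0 : F Z ≠ 0) :
    HasDbarAt (fun Z => (F Z)⁻¹) (fun k => -D k / F Z ^ 2) Z :=
  (comp (hasDerivAt_inv h0) hF).congr_deriv fun k => by ring

theorem div (hF : HasDbarAt F D Z) (hG : HasDbarAt G E Z) (h0 : G Z ≠ 0) :
    HasDbarAt (fun Z => F Z / G Z) (fun k => D k / G Z - F Z * E k / G Z ^ 2) Z := by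
  simp only [div_eq_mul_inv (F _)]
  exact (hF.mul (hG.inv h0)).congr_deriv fun k => by ring

theorem pow (hF : HasDbarAt F D Z) (N : ℕ) :
    HasDbarAt (fun Z => F Z ^ N) (fun k => N * F Z ^ (N - 1) * D k) Z :=
  comp (hasDerivAt_pow N (F Z)) hF

theorem zpow (hF : HasDbarAt F D Z) (N : ℤ) (h0 : F Z ≠ 0) :
    HasDbarAt (fun Z => F Z ^ N) (fun k => N * F Z ^ (N - 1) * D k) Z :=
  comp (hasDerivAt_zpow N (F Z) (Or.inl h0)) hF

end HasDbarAt

theorem hasDbarAt_conj (Z : WC n) (j : Fin n) :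
    HasDbarAt (fun Z => (starRingEnd ℂ) (Z j)) (fun k => if k = j then 1 else 0) Z := by
  refine ⟨(Complex.conjCLE : ℂ →L[ℝ] ℂ).comp
    (ContinuousLinearMap.proj (R := ℝ) (φ := fun _ : Fin n => ℂ) j),
    ((Complex.conjCLE : ℂ →L[ℝ] ℂ).comp
    (ContinuousLinearMap.proj (R := ℝ) (φ := fun _ : Fin n => ℂ) j)).hasFDerivAt, fun k => ?_⟩
  by_cases h : k = j
  · subst h; simp; norm_num
  · have h' : j ≠ k := fun h' => h h'.symm
    simp [h, h']

theorem hasDbarAt_coord (Z : WC n) (j : Fin n) : HasDbarAt (fun Z => Z j) 0 Z :=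
  HasDbarAt.of_differentiableAt (by fun_prop)

theorem hasDbarAt_im (Z : WC n) (j : Fin n) :
    HasDbarAt (fun Z => ((Z j).im : ℂ)) (fun k => if k = j then Complex.I / 2 else 0) Z := by
  have h := ((hasDbarAt_coord Z j).sub (hasDbarAt_conj Z j)).const_mul (-Complex.I / 2)
  refine (h.of_eventuallyEq (Filter.Eventually.of_forall fun W => ?_)).congr_deriv fun k => ?_
  · simp only [Complex.sub_conj]
    push_cast
    linear_combination ((W j).im : ℂ) * Complex.I_sq
  · simp only [Pi.zero_apply]
    split_ifs <;> ring

theorem hasDbarAt_qC (Z : WC n) :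
    HasDbarAt qC (fun k => Complex.I * eps ℂ k * (Z k).im) Z := by
  have h := HasDbarAt.sum (s := Finset.univ)
    (fun j _ => ((hasDbarAt_im Z j).pow 2).const_mul (eps ℂ j))
  refine (h.of_eventuallyEq (Filter.Eventually.of_forall fun W => ?_)).congr_deriv fun k => ?_
  · simp only [qC, qW, imW]
    push_cast
    exact Finset.sum_congr rfl fun j _ => by rw [eps_ofReal]
  · simp only [mul_ite, mul_zero, Finset.sum_ite_eq, Finset.mem_univ, if_true]
    ring

theorem hasDbarAt_pairPsi (l : QSpace n ℝ) (Z : WC n) : HasDbarAt (pairPsi l) 0 Z :=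
  HasDbarAt.of_differentiableAt (differentiable_pairPsi l Z)

theorem hasDbarAt_pairPsi_conjW (l : QSpace n ℝ) (Z : WC n) :
    HasDbarAt (fun Z => pairPsi l (conjW Z))
      (fun k => 2 * eps ℂ k * (l.2.2 k - l.2.1 * (starRingEnd ℂ) (Z k))) Z := by
  have h1 := HasDbarAt.sum (s := Finset.univ)
    (fun j _ => ((hasDbarAt_conj Z j).pow 2).const_mul (eps ℂ j))
  have h2 := HasDbarAt.sum (s := Finset.univ)
    (fun j _ => (hasDbarAt_conj Z j).const_mul (eps ℂ j * l.2.2 j))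
  have h := ((HasDbarAt.const (Z := Z) (l.1 : ℂ)).sub (h1.const_mul l.2.1)).add (h2.const_mul 2)
  refine (h.of_eventuallyEq (Filter.Eventually.of_forall fun W => ?_)).congr_deriv fun k => ?_
  · simp only [pairPsi_eq, bW, conjW, wC]
    congr 3
    exact Finset.sum_congr rfl fun j _ => by ring
  · simp only [Pi.zero_apply, mul_ite, mul_zero, Finset.sum_ite_eq, Finset.mem_univ, if_true]
    push_cast
    ring

theorem hasDbarAt_quotient (l : QSpace n ℝ) (Z : WC n) (hq : qC Z ≠ 0) :
    HasDbarAt (fun Z => pairPsi l (conjW Z) / qC Z) (thetaV l Z) Z :=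
  ((hasDbarAt_pairPsi_conjW l Z).div (hasDbarAt_qC Z) hq).congr_deriv fun k => by
    simp only [thetaV]
    ring

/-- The antilinear part of a real linear map is determined by its values on the basis. -/
theorem antilinear_part_apply (F' : WC n →L[ℝ] ℂ) (D : WC n)
    (hD : ∀ k, 1 / 2 * (F' (Pi.single k 1) + Complex.I * F' (Pi.single k Complex.I)) = D k)
    (v : WC n) : 1 / 2 * (F' v + Complex.I * F' (Complex.I • v)) =
      ∑ k, D k * (starRingEnd ℂ) (v k) := by
  have hv : ∀ u : WC n, u = ∑ k, ((u k).re • (Pi.single k 1 : WC n) +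
      (u k).im • (Pi.single k Complex.I : WC n)) := by
    intro u
    conv_lhs => rw [← Finset.univ_sum_single u]
    refine Finset.sum_congr rfl fun k _ => ?_
    rw [← Pi.single_smul, ← Pi.single_smul, ← Pi.single_add]
    congr 1
    apply Complex.ext <;> simp
  have h1 : ∀ u, F' u = ∑ k, (((u k).re : ℂ) * F' (Pi.single k 1) +
      ((u k).im : ℂ) * F' (Pi.single k Complex.I)) := by
    intro u
    conv_lhs => rw [hv u]
    simp only [map_sum, map_add, map_smul, Complex.real_smul]
  rw [h1 v, h1 (Complex.I • v), Finset.mul_sum, ← Finset.sum_add_distrib, Finset.mul_sum]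
  refine Finset.sum_congr rfl fun k _ => ?_
  rw [← hD]
  have hc : (starRingEnd ℂ) (v k) = (v k).re - Complex.I * (v k).im := by
    apply Complex.ext <;> simp
  rw [hc]
  simp only [Pi.smul_apply, smul_eq_mul, Complex.I_mul_re, Complex.I_mul_im]
  push_cast
  linear_combination (1 / 2 * (v k).im * F' (Pi.single k Complex.I)) * Complex.I_sq

theorem hasFDerivAt_zeroForm {F : WC n → ℂ} {F' : WC n →L[ℝ] ℂ} {Z : WC n}
    (h : HasFDerivAt F F' Z) : HasFDerivAt (fun Z => zeroForm n (F Z))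
      (((ContinuousAlternatingMap.constOfIsEmptyLIE ℝ (WC n) ℂ (Fin 0)).toContinuousLinearEquiv :
        ℂ →L[ℝ] Form n 0).comp F') Z :=
  ((ContinuousAlternatingMap.constOfIsEmptyLIE ℝ (WC n) ℂ
    (Fin 0)).toContinuousLinearEquiv : ℂ →L[ℝ] Form n 0).hasFDerivAt.comp Z h

/-- `∂̄` of a function. -/
theorem dbar_zeroForm {F : WC n → ℂ} {D Z : WC n} (h : HasDbarAt F D Z) (v : Fin 1 → WC n) :
    dbar (fun Z => zeroForm n (F Z)) Z v = ∑ k, D k * (starRingEnd ℂ) (v 0 k) := by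
  obtain ⟨F', h, hD⟩ := h
  rw [← antilinear_part_apply F' D hD, dbar, (hasFDerivAt_zeroForm h).fderiv,
    ContinuousAlternatingMap.alternatizeUncurryFin_apply]
  simp only [Nat.reduceAdd, Finset.univ_unique, Fin.default_eq_zero, Fin.isValue, Fin.val_zero,
    pow_zero, one_smul, Finset.sum_singleton]
  rfl

theorem sum_mul_conj_single (D : WC n) (j : Fin n) (c : ℂ) :
    ∑ k, D k * (starRingEnd ℂ) ((Pi.single j c : WC n) k) = D j * (starRingEnd ℂ) c := by
  rw [Finset.sum_eq_single j]
  · simp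
  · intro k _ hk; simp [hk]
  · simp

end Dbar

/-! ## The form `p_Z(λ)` and its transformation behaviour -/

section PForm

variable {m : ℕ}

theorem pForm_eq (l : QSpace (m + 1) ℝ) {Z : WC (m + 1)} (hZ : Z ∈ upperHalf (m + 1)) :
    pForm l Z = (qC Z * ((4 * Complex.I * qC Z) ^ (m + 1))⁻¹) •
      kap (k := 2 * m + 1) (by omega) (gradV l Z) := by
  have hq := qC_ne_zero hZ
  have hd : ∀ v : Fin 1 → WC (m + 1), dbar (fun Z => zeroForm (m + 1)
      (pairPsi l (conjW Z) / ((qW (imW Z) : ℝ) : ℂ))) Z v =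
      ∑ k, thetaV l Z k * (starRingEnd ℂ) (v 0 k) :=
    dbar_zeroForm (hasDbarAt_quotient l Z hq)
  have h1 := starBar_one (k := 2 * m + 1) (by omega) (dbar fun Z => zeroForm (m + 1)
      (pairPsi l (conjW Z) / ((qW (imW Z) : ℝ) : ℂ))) Z (fun w => by
        rw [hd, hd, Finset.mul_sum]
        refine Finset.sum_congr rfl fun k _ => ?_
        simp only [Pi.smul_apply, smul_eq_mul, map_mul, Complex.conj_I]
        ring)
  have h2 : (fun j => dbar (fun Z => zeroForm (m + 1)
      (pairPsi l (conjW Z) / ((qW (imW Z) : ℝ) : ℂ))) Z fun _ => Pi.single j 1) =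
      thetaV l Z := by
    funext j
    rw [hd, sum_mul_conj_single, map_one, mul_one]
  rw [h2, half_metricMap_theta l Z hq] at h1
  unfold pForm xi starW
  rw [h1, zpow_one, smul_smul]
  rfl

variable {g : LinAut (m + 1)} {Z : WC (m + 1)}

/-- The complex derivative of the action. -/
def actDeriv {n : ℕ} (g : LinAut n) (Z : WC n) : WC n →L[ℂ] WC n := fderiv ℂ (act g) Z

theorem hasFDerivAt_act {n : ℕ} {g : LinAut n} {Z : WC n} (hg : IsOPlus g)
    (hZ : Z ∈ upperHalf n) :
    HasFDerivAt (act g) ((actDeriv g Z).restrictScalars ℝ) Z :=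
  (differentiableAt_act hg hZ).hasFDerivAt.restrictScalars ℝ

theorem differentiable_autFactor {n : ℕ} {g : LinAut n} (hg : IsOPlus g) :
    Differentiable ℂ (autFactor g) := by
  have : autFactor g = pairPsi (g⁻¹ (1, 0, 0)) := funext fun Z => autFactor_eq_pairPsi hg.1 Z
  rw [this]
  exact differentiable_pairPsi _

theorem conj_pairPsi_act {n : ℕ} {g : LinAut n} {Z : WC n} (hg : IsOPlus g)
    (hZ : Z ∈ upperHalf n) (l : QSpace n ℝ) :
    (starRingEnd ℂ) (autFactor g Z) * pairPsi (g l) (conjW (act g Z)) = pairPsi l (conjW Z) := by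
  rw [pairPsi_conjW, pairPsi_conjW, ← map_mul, pairPsi_act hg hZ]

/-- The function (l, ψ(conj Z))/q(Y) transforms with the holomorphic factor j: one factor conj(j)
cancels between numerator and denominator. Taking ∂̄ of both expressions for its pullback gives the
claim. -/
theorem sum_theta_act {n : ℕ} {g : LinAut n} {Z : WC n} (hg : IsOPlus g)
    (hZ : Z ∈ upperHalf n) (l : QSpace n ℝ) (k : Fin n) :
    ∑ j, thetaV (g l) (act g Z) j * (starRingEnd ℂ) (actDeriv g Z (Pi.single k 1) j) =
      autFactor g Z * thetaV l Z k := by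
  have h1 : HasDbarAt (fun Z => pairPsi (g l) (conjW (act g Z)) / qC (act g Z))
      (fun k => autFactor g Z * thetaV l Z k) Z := by
    have h2 := (HasDbarAt.of_differentiableAt (differentiable_autFactor hg Z)).mul
      (hasDbarAt_quotient l Z (qC_ne_zero hZ))
    refine (h2.of_eventuallyEq ?_).congr_deriv fun k => by simp
    filter_upwards [isOpen_upperHalf.mem_nhds hZ] with W hW
    have hj := autFactor_ne_zero hg hW
    have hj' : (starRingEnd ℂ) (autFactor g W) ≠ 0 := by simpa using hj
    have hq := qC_ne_zero (hg.2 W hW)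
    rw [← conj_pairPsi_act hg hW, ← qC_act hg hW]
    field_simp
  obtain ⟨F', hF, hD⟩ := hasDbarAt_quotient (g l) (act g Z) (qC_ne_zero (hg.2 Z hZ))
  have h3 : HasDbarAt (fun Z => pairPsi (g l) (conjW (act g Z)) / qC (act g Z))
      (fun k => ∑ j, thetaV (g l) (act g Z) j *
        (starRingEnd ℂ) (actDeriv g Z (Pi.single k 1) j)) Z := by
    refine ⟨_, hF.comp Z (hasFDerivAt_act hg hZ), fun k => ?_⟩
    change _ = ∑ j, thetaV (g l) (act g Z) j *
        (starRingEnd ℂ) (actDeriv g Z (Pi.single k 1) j)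
    rw [← antilinear_part_apply F' _ hD (actDeriv g Z (Pi.single k 1))]
    simp only [ContinuousLinearMap.comp_apply, ContinuousLinearMap.coe_restrictScalars']
    rw [← map_smul, ← Pi.single_smul, smul_eq_mul, mul_one]
  exact congrFun (h3.unique h1) k

theorem actDeriv_apply {n : ℕ} (g : LinAut n) (Z v : WC n) (j : Fin n) :
    actDeriv g Z v j = ∑ k, actDeriv g Z (Pi.single k 1) j * v k := by
  conv_lhs => rw [← Finset.univ_sum_single v]
  rw [map_sum, Finset.sum_apply]
  refine Finset.sum_congr rfl fun k _ => ?_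
  rw [show (Pi.single k (v k) : WC n) = v k • Pi.single k 1 by
    rw [← Pi.single_smul, smul_eq_mul, mul_one], map_smul, Pi.smul_apply, smul_eq_mul, mul_comm]

/-- The two vectors have the same hermitian product with every θ by `sum_theta_act` and
`sum_theta_mul_conj_grad`, and these covectors span. -/
theorem gradV_act {n : ℕ} {g : LinAut n} {Z : WC n} (hg : IsOPlus g)
    (hZ : Z ∈ upperHalf n) (l : QSpace n ℝ) :
    actDeriv g Z (autFactor g Z • gradV l Z) = gradV (g l) (act g Z) := by
  rw [← sub_eq_zero]
  have hq' := qC_ne_zero (hg.2 Z hZ)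
  have key : conjW (actDeriv g Z (autFactor g Z • gradV l Z) - gradV (g l) (act g Z)) = 0 := by
    apply eq_zero_of_forall_theta (act g Z) hq'
    intro l'
    obtain ⟨l', rfl⟩ := g.surjective l'
    simp only [conjW, Pi.sub_apply, map_sub, mul_sub, Finset.sum_sub_distrib]
    rw [sum_theta_mul_conj_grad _ _ _ hq', bV_map hg.1]
    have h1 : ∑ k, thetaV (g l') (act g Z) k * (starRingEnd ℂ)
        (actDeriv g Z (autFactor g Z • gradV l Z) k) =
        (starRingEnd ℂ) (autFactor g Z) * autFactor g Z *
          ∑ k, thetaV l' Z k * (starRingEnd ℂ) (gradV l Z k) := by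
      calc _ = ∑ k, ∑ i, thetaV (g l') (act g Z) k *
          ((starRingEnd ℂ) (actDeriv g Z (Pi.single i 1) k) *
            ((starRingEnd ℂ) (autFactor g Z) * (starRingEnd ℂ) (gradV l Z i))) := by
            refine Finset.sum_congr rfl fun k _ => ?_
            rw [actDeriv_apply, map_sum, Finset.mul_sum]
            simp only [map_mul, Pi.smul_apply, smul_eq_mul]
        _ = ∑ i, (∑ k, thetaV (g l') (act g Z) k *
          (starRingEnd ℂ) (actDeriv g Z (Pi.single i 1) k)) *
            ((starRingEnd ℂ) (autFactor g Z) * (starRingEnd ℂ) (gradV l Z i)) := by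
            rw [Finset.sum_comm]
            refine Finset.sum_congr rfl fun i _ => ?_
            rw [Finset.sum_mul]
            exact Finset.sum_congr rfl fun k _ => by ring
        _ = _ := by
            rw [Finset.mul_sum]
            refine Finset.sum_congr rfl fun i _ => ?_
            rw [sum_theta_act hg hZ]
            ring
    rw [h1, sum_theta_mul_conj_grad _ _ _ (qC_ne_zero hZ), ← pairPsi_act hg hZ l,
      ← pairPsi_act hg hZ l', ← conj_pairPsi_act hg hZ l, ← conj_pairPsi_act hg hZ l',
      ← qC_act hg hZ]
    have hj := autFactor_ne_zero hg hZ
    have hj' : (starRingEnd ℂ) (autFactor g Z) ≠ 0 := by simpa using hj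
    field_simp
    ring
  have := congrArg conjW key
  rw [conjW_conjW] at this
  rw [this]
  funext k; simp [conjW]

/-- The inverse metric `H` satisfies T H T* = H at the image point: it suffices to test this on the
spanning covectors θ, where it is `gradV_act`. Taking determinants gives the Jacobian without
knowing T. -/
theorem normSq_det_actDeriv {n : ℕ} (hn : n ≠ 0) {g : LinAut n} {Z : WC n} (hg : IsOPlus g)
    (hZ : Z ∈ upperHalf n) :
    (2 * qC (act g Z)) ^ n =
      (Complex.normSq (LinearMap.det (actDeriv g Z : WC n →ₗ[ℂ] WC n)) : ℂ) * (2 * qC Z) ^ n := by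
  have hq := qC_ne_zero hZ
  have hq' := qC_ne_zero (hg.2 Z hZ)
  set T := LinearMap.toMatrix' (actDeriv g Z : WC n →ₗ[ℂ] WC n) with hT
  set H : WC n → Matrix (Fin n) (Fin n) ℂ :=
    fun Z => Matrix.of fun i j => (metricInv (imW Z) i j : ℂ) with hH
  have hHmul : ∀ Z w, (H Z).mulVec w = metricMap (imW Z) w := fun Z w => by
    rw [metricMap, Matrix.toLin'_apply]
  have hTapp : ∀ j k, T j k = actDeriv g Z (Pi.single k 1) j := by
    intro j k
    rw [hT, LinearMap.toMatrix'_apply]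
    simp
  have hTmul : ∀ w, T.mulVec w = actDeriv g Z w := fun w => by
    rw [hT, LinearMap.toMatrix'_mulVec]; rfl
  have h1 : T * H Z * T.conjTranspose = H (act g Z) := by
    rw [← sub_eq_zero]
    ext r c
    have h2 : (fun k => (T * H Z * T.conjTranspose - H (act g Z)) r k) = 0 := by
      apply eq_zero_of_forall_theta (act g Z) hq'
      intro l
      obtain ⟨l, rfl⟩ := g.surjective l
      have h3 : (T * H Z * T.conjTranspose - H (act g Z)).mulVec (thetaV (g l) (act g Z)) = 0 := by
        rw [Matrix.sub_mulVec, ← Matrix.mulVec_mulVec, ← Matrix.mulVec_mulVec]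
        have h4 : T.conjTranspose.mulVec (thetaV (g l) (act g Z)) =
            autFactor g Z • thetaV l Z := by
          funext k
          rw [Pi.smul_apply, smul_eq_mul, ← sum_theta_act hg hZ]
          simp only [Matrix.mulVec, dotProduct, Matrix.conjTranspose_apply, hTapp]
          exact Finset.sum_congr rfl fun j _ => mul_comm _ _
        have h5 : ∀ l (Z : WC n), qC Z ≠ 0 →
            metricMap (imW Z) (thetaV l Z) = (2 : ℂ) • gradV l Z := by
          intro l Z hq
          rw [← half_metricMap_theta l Z hq, smul_smul]
          norm_num
        rw [h4, Matrix.mulVec_smul, hHmul, hHmul, h5 _ _ hq, h5 _ _ hq', hTmul,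
          ← gradV_act hg hZ, smul_comm, map_smul, sub_self]
      refine Eq.trans ?_ (congrFun h3 r)
      simp only [Matrix.mulVec, dotProduct]
      exact Finset.sum_congr rfl fun j _ => mul_comm _ _
    exact congrFun h2 c
  have hdet : ∀ Z : WC n, qC Z ≠ 0 → (H Z).det = (2 * qC Z) ^ n := by
    intro Z hq
    have := det_metricMap hn (imW Z) (by simpa [qC] using hq)
    rwa [metricMap, LinearMap.det_toLin'] at this
  have h7 := congrArg Matrix.det h1
  rw [Matrix.det_mul, Matrix.det_mul, Matrix.det_conjTranspose, hdet _ hq, hdet _ hq', hT,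
    LinearMap.det_toMatrix'] at h7
  rw [← h7, ← Complex.mul_conj]
  simp only [RCLike.star_def]
  ring

theorem compContinuousLinearMap_smul {n k : ℕ} (c : ℂ) (f : Form n k) (T : WC n →L[ℝ] WC n) :
    (c • f).compContinuousLinearMap T = c • f.compContinuousLinearMap T := rfl

theorem pForm_act_scalar {n : ℕ} {q q' j j' N : ℂ} (h3 : j * j' * q' = q) (hq : q ≠ 0)
    (h2 : (2 * q') ^ n = N * (2 * q) ^ n) :
    q' * ((4 * Complex.I * q') ^ n)⁻¹ * (N * j') = j⁻¹ * (q * ((4 * Complex.I * q) ^ n)⁻¹) := by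
  subst h3
  have hj : j ≠ 0 := by rintro rfl; simp at hq
  have hj' : j' ≠ 0 := by rintro rfl; simp at hq
  have hq' : q' ≠ 0 := by rintro rfl; simp at hq
  have h4 : N = ((j * j') ^ n)⁻¹ := by
    rw [mul_pow, mul_pow, mul_pow _ q'] at h2
    have h5 : (2 : ℂ) ^ n * q' ^ n * (N * (j * j') ^ n) = (2 : ℂ) ^ n * q' ^ n * 1 := by
      linear_combination -h2
    have h6 : (2 : ℂ) ^ n * q' ^ n ≠ 0 := mul_ne_zero (pow_ne_zero _ two_ne_zero) (pow_ne_zero _ hq')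
    exact eq_inv_of_mul_eq_one_left (mul_left_cancel₀ h6 h5)
  rw [h4]
  have : (4 * Complex.I) ^ n ≠ 0 := by simp
  simp only [mul_pow]
  field_simp

theorem pForm_act (hg : IsOPlus g) (hZ : Z ∈ upperHalf (m + 1)) (l : QSpace (m + 1) ℝ) :
    (pForm (g l) (act g Z)).compContinuousLinearMap (fderiv ℝ (act g) Z) =
      (autFactor g Z)⁻¹ • pForm l Z := by
  have h1 := kap_comp (k := 2 * m + 1) (by omega) (actDeriv g Z) (autFactor g Z • gradV l Z)
  have h2 := normSq_det_actDeriv (Nat.succ_ne_zero m) hg hZ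
  rw [gradV_act hg hZ] at h1
  rw [(hasFDerivAt_act hg hZ).fderiv, pForm_eq _ (hg.2 Z hZ), pForm_eq _ hZ,
    compContinuousLinearMap_smul, h1, kap_smul, smul_smul, smul_smul, smul_smul]
  congr 1
  rw [mul_assoc (qC (act g Z) * _)]
  exact pForm_act_scalar (qC_act hg hZ) (qC_ne_zero hZ) h2

end PForm

end

end PolarHarmonic


namespace PolarHarmonic

open Module

noncomputable section

/-! ### Projection to the positive plane, and equivariance of p̃ -/

section Projection

variable {n : ℕ}

theorem bV_toC_re_im (l : QSpace n ℝ) (w : QSpace n ℂ) :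
    bV (toC l) w = ((bV l (reV w) : ℝ) : ℂ) + Complex.I * ((bV l (imV w) : ℝ) : ℂ) := by
  conv_lhs => rw [← toC_reV_add w]
  rw [bV_add_right, bV_smul_right, bV_toC, bV_toC]

theorem pairPsi_re (l : QSpace n ℝ) (Z : WC n) : bV l (reV (psi Z)) = (pairPsi l Z).re := by
  rw [pairPsi, bV_toC_re_im]; simp

theorem pairPsi_im (l : QSpace n ℝ) (Z : WC n) : bV l (imV (psi Z)) = (pairPsi l Z).im := by
  rw [pairPsi, bV_toC_re_im]; simp

theorem conjV_eq (w : QSpace n ℂ) : conjV w = toC (reV w) - Complex.I • toC (imV w) := by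
  refine Prod.ext ?_ (Prod.ext ?_ (funext fun j => ?_)) <;>
    apply Complex.ext <;> simp [conjV, conjW, toC, reV, imV]

/-- The real and imaginary parts of (ψ, ψ) = 0, together with (ψ, conj ψ) = 4 q(Y). -/
theorem bV_re_im_psi (Z : WC n) :
    bV (reV (psi Z)) (reV (psi Z)) = 2 * qW (imW Z) ∧
    bV (imV (psi Z)) (imV (psi Z)) = 2 * qW (imW Z) ∧
    bV (reV (psi Z)) (imV (psi Z)) = 0 := by
  have h1 : bV (psi Z) (psi Z) = 0 := by rw [bV_self, qV_psi, mul_zero]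
  have h2 := bV_psi_conj Z
  rw [conjV_eq] at h2
  set a := reV (psi Z)
  set b := imV (psi Z)
  have hab : psi Z = toC a + Complex.I • toC b := (toC_reV_add _).symm
  rw [hab] at h1 h2
  simp only [bV_add_left, bV_add_right, bV_sub_right, bV_smul_left, bV_smul_right, bV_toC,
    bV_comm b a, qC] at h1 h2
  have r1 := congrArg Complex.re h1
  have i1 := congrArg Complex.im h1
  have r2 := congrArg Complex.re h2
  simp at r1 i1 r2
  refine ⟨by linarith, by linarith, by linarith⟩

theorem qPlus_eq (l : QSpace n ℝ) {Z : WC n} (hZ : Z ∈ upperHalf n) :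
    qPlus l Z = Complex.normSq (pairPsi l Z) / (4 * qW (imW Z)) := by
  have hq := hZ.1.ne'
  obtain ⟨h1, h2, h3⟩ := bV_re_im_psi Z
  have h : ∀ x : QSpace n ℝ, qV x = bV x x / 2 := fun x => by rw [bV_self]; ring
  rw [qPlus, h, projPlus, h1, h2, pairPsi_re, pairPsi_im]
  simp only [bV_add_left, bV_add_right, bV_smul_left, bV_smul_right, h1, h2, h3,
    bV_comm (imV (psi Z)) (reV (psi Z)), Complex.normSq_apply]
  field_simp
  ring

theorem qMinus_eq (l : QSpace n ℝ) {Z : WC n} (hZ : Z ∈ upperHalf n) :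
    qMinus l Z = qV l - qPlus l Z := by
  have hq := hZ.1.ne'
  obtain ⟨h1, h2, h3⟩ := bV_re_im_psi Z
  have h : ∀ x : QSpace n ℝ, qV x = bV x x / 2 := fun x => by rw [bV_self]; ring
  have h4 : bV l (projPlus l Z) = 2 * qPlus l Z := by
    rw [qPlus_eq l hZ, projPlus, h1, h2, bV_add_right, bV_smul_right, bV_smul_right, pairPsi_re,
      pairPsi_im, Complex.normSq_apply]
    field_simp
    ring
  rw [qMinus, h, bV_sub_left, bV_sub_right, bV_sub_right, bV_comm (projPlus l Z) l, h4, bV_self,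
    bV_self, ← qPlus]
  ring

theorem qPlus_act {g : LinAut n} (hg : IsOPlus g) {Z : WC n} (hZ : Z ∈ upperHalf n)
    (l : QSpace n ℝ) : qPlus (g l) (act g Z) = qPlus l Z := by
  rw [qPlus_eq _ (hg.2 Z hZ), qPlus_eq _ hZ, ← pairPsi_act hg hZ, map_mul]
  have h := qC_act hg hZ
  rw [Complex.mul_conj, qC, qC] at h
  have h' : Complex.normSq (autFactor g Z) * qW (imW (act g Z)) = qW (imW Z) := by
    exact_mod_cast h
  rw [← h']
  have h1 := (hg.2 Z hZ).1.ne'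
  have h2 : Complex.normSq (autFactor g Z) ≠ 0 := by
    simpa using autFactor_ne_zero hg hZ
  field_simp

end Projection

/-- The radial factors depend only on invariants. The powers of j cancel: κ from the slash operator,
1 - κ from the power of the pairing, -1 from p_Z. -/
theorem slashForm_pTilde {m : ℕ} (κ : ℤ) {g : LinAut (m + 1)} (hg : IsOPlus g)
    {Z : WC (m + 1)} (hZ : Z ∈ upperHalf (m + 1)) (l : QSpace (m + 1) ℝ) :
    slashForm (-κ) g (pTilde κ (g l)) Z = pTilde κ l Z := by
  have hj := autFactor_ne_zero hg hZ
  unfold slashForm pTilde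
  simp only
  rw [qPlus_act hg hZ, qMinus_eq _ (hg.2 Z hZ), qMinus_eq _ hZ, qPlus_act hg hZ, hg.1,
    compContinuousLinearMap_smul, pForm_act hg hZ, smul_smul, smul_smul]
  congr 1
  rw [← pairPsi_act hg hZ l, neg_neg, mul_zpow, zpow_sub_one₀ hj]
  ring

/-! ## The hypergeometric function -/

section Hypergeometric

/-- Euler's integral `b ∫_0^1 t^(b-1) (1 - z t)^(s-1) dt`. -/
def eulerF (s b : ℝ) (z : ℂ) : ℂ :=
  b * ∫ t in (0 : ℝ)..1, ((t ^ (b - 1) : ℝ) : ℂ) * (1 - z * t) ^ ((s - 1 : ℝ) : ℂ)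

theorem one_sub_mul_mem_slitPlane {z : ℂ} (hz : z.re < 1) {t : ℝ} (ht : t ∈ Set.Icc (0 : ℝ) 1) :
    1 - z * t ∈ Complex.slitPlane := by
  left
  simp only [Complex.sub_re, Complex.one_re, Complex.mul_re, Complex.ofReal_re, Complex.ofReal_im,
    mul_zero, sub_zero]
  obtain ⟨h0, h1⟩ := ht
  rcases le_or_gt z.re 0 with h | h
  · nlinarith
  · nlinarith

/-- For c = b + 1 the exponent of 1 - t is zero and the quotient of Gamma values is b. The integral
on the right also makes sense for complex arguments. -/
theorem gaussF_eq {s b : ℝ} (hb : 0 < b) {x : ℝ} (hx : x < 1) :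
    ((gaussF (1 - s) b (b + 1) x : ℝ) : ℂ) = eulerF s b x := by
  have hG : Real.Gamma (b + 1) / (Real.Gamma b * Real.Gamma (b + 1 - b)) = b := by
    rw [Real.Gamma_add_one hb.ne', show b + 1 - b = 1 by ring, Real.Gamma_one]
    have := (Real.Gamma_pos_of_pos hb).ne'
    field_simp
  rw [gaussF, hG, eulerF]
  push_cast
  rw [← intervalIntegral.integral_ofReal]
  congr 1
  refine intervalIntegral.integral_congr fun t ht => ?_
  rw [Set.uIcc_of_le zero_le_one] at ht
  have h1 : (0 : ℝ) ≤ 1 - x * t := by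
    obtain ⟨h0, h1⟩ := ht
    rcases le_or_gt x 0 with h | h <;> nlinarith
  have h2 : b + 1 - b - 1 = 0 := by ring
  have h3 : -(1 - s) = s - 1 := by ring
  simp only [h2, h3, Real.rpow_zero, mul_one]
  rw [Complex.ofReal_mul, Complex.ofReal_cpow h1]
  push_cast
  rfl

theorem continuousOn_cpow_one_sub {z₀ : ℂ} {ε : ℝ} (hε : z₀.re + ε < 1) (c : ℂ) :
    ContinuousOn (fun p : ℂ × ℝ => (1 - p.1 * p.2) ^ c)
      (Metric.closedBall z₀ ε ×ˢ Set.Icc (0 : ℝ) 1) := by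
  refine ContinuousOn.cpow_const (by fun_prop) fun p hp => ?_
  refine one_sub_mul_mem_slitPlane ?_ hp.2
  have h1 : ‖p.1 - z₀‖ ≤ ε := by simpa [dist_eq_norm] using hp.1
  have h2 := (Complex.abs_re_le_norm (p.1 - z₀)).trans h1
  rw [Complex.sub_re] at h2
  linarith [le_abs_self (p.1.re - z₀.re)]

/-- Differentiation under the integral sign is justified by a bound on a closed ball inside Re z <
1. The equation comes from integrating the t-derivative of t^b (1 - zt)^(s-1) over [0, 1]. -/
theorem hasDerivAt_eulerF {s b : ℝ} (hb : 0 < b) {z₀ : ℂ} (hz : z₀.re < 1) :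
    ∃ F' : ℂ, HasDerivAt (eulerF s b) F' z₀ ∧
      z₀ * F' = b * ((1 - z₀) ^ ((s - 1 : ℝ) : ℂ) - eulerF s b z₀) := by
  obtain ⟨ε, hε0, hε⟩ : ∃ ε > 0, z₀.re + ε < 1 := ⟨(1 - z₀.re) / 2, by linarith, by linarith⟩
  set c : ℂ := ((s - 1 : ℝ) : ℂ) with hc
  obtain ⟨C, hC⟩ := ((isCompact_closedBall z₀ ε).prod isCompact_Icc).exists_bound_of_continuousOn
    (continuousOn_cpow_one_sub hε (c - 1))
  have hslit : ∀ z ∈ Metric.ball z₀ ε, ∀ t ∈ Set.Icc (0 : ℝ) 1, 1 - z * t ∈ Complex.slitPlane := by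
    intro z hz' t ht
    refine one_sub_mul_mem_slitPlane ?_ ht
    have h1 : ‖z - z₀‖ < ε := by simpa [dist_eq_norm] using hz'
    have h2 := (Complex.abs_re_le_norm (z - z₀)).trans h1.le
    rw [Complex.sub_re] at h2
    linarith [le_abs_self (z.re - z₀.re)]
  have hcont : ∀ z ∈ Metric.ball z₀ ε, ∀ d : ℂ,
      ContinuousOn (fun t : ℝ => (1 - z * t) ^ d) (Set.Icc 0 1) := fun z hz d =>
    ContinuousOn.cpow_const (by fun_prop) fun t ht => hslit z hz t ht
  have hrpow : IntervalIntegrable (fun t : ℝ => ((t ^ (b - 1) : ℝ) : ℂ)) MeasureTheory.volume 0 1 := by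
    have h := intervalIntegral.intervalIntegrable_rpow' (a := 0) (b := 1) (r := b - 1) (by linarith)
    exact ⟨h.1.ofReal, h.2.ofReal⟩
  have hint : ∀ z ∈ Metric.ball z₀ ε, ∀ d : ℂ,
      IntervalIntegrable (fun t : ℝ => ((t ^ (b - 1) : ℝ) : ℂ) * (1 - z * t) ^ d)
        MeasureTheory.volume 0 1 := fun z hz d =>
    hrpow.mul_continuousOn (by rw [Set.uIcc_of_le zero_le_one]; exact hcont z hz d)
  have hz₀ := Metric.mem_ball_self (x := z₀) hε0
  have hderiv : ∀ z ∈ Metric.ball z₀ ε, ∀ t ∈ Set.Icc (0 : ℝ) 1,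
      HasDerivAt (fun z : ℂ => (1 - z * t) ^ c) (c * (1 - z * t) ^ (c - 1) * (-t)) z := by
    intro z hz t ht
    have h1 : HasDerivAt (fun z : ℂ => 1 - z * t) (-(1 * (t : ℂ))) z :=
      ((hasDerivAt_id z).mul_const (t : ℂ)).const_sub 1
    simpa using h1.cpow_const (c := c) (hslit z hz t ht)
  have hint' : IntervalIntegrable (fun t : ℝ => ((t ^ (b - 1) : ℝ) : ℂ) *
      (c * (1 - z₀ * t) ^ (c - 1) * (-t))) MeasureTheory.volume 0 1 := by
    refine hrpow.mul_continuousOn ?_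
    rw [Set.uIcc_of_le zero_le_one]
    exact (continuousOn_const.mul (hcont z₀ hz₀ _)).mul (by fun_prop)
  have hmain := intervalIntegral.hasDerivAt_integral_of_dominated_loc_of_deriv_le
    (μ := MeasureTheory.volume) (a := 0) (b := 1) (s := Metric.ball z₀ ε)
    (bound := fun t => t ^ (b - 1) * (‖c‖ * C))
    (F := fun (z : ℂ) (t : ℝ) => ((t ^ (b - 1) : ℝ) : ℂ) * (1 - z * t) ^ c)
    (F' := fun (z : ℂ) (t : ℝ) => ((t ^ (b - 1) : ℝ) : ℂ) * (c * (1 - z * t) ^ (c - 1) * (-t)))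
    (x₀ := z₀) (Metric.ball_mem_nhds z₀ hε0)
    (by
      filter_upwards [Metric.ball_mem_nhds z₀ hε0] with z hz
      exact (intervalIntegrable_iff.1 (hint z hz c)).aestronglyMeasurable)
    (hint z₀ hz₀ c) (intervalIntegrable_iff.1 hint').aestronglyMeasurable
    (by
      refine Filter.Eventually.of_forall fun t ht z hz => ?_
      rw [Set.uIoc_of_le zero_le_one] at ht
      have h1 := hC (z, t) ⟨Metric.ball_subset_closedBall hz, ⟨ht.1.le, ht.2⟩⟩
      have h2 : 0 ≤ t ^ (b - 1) := Real.rpow_nonneg ht.1.le _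
      simp only [norm_mul, norm_neg, Complex.norm_real, Real.norm_eq_abs, abs_of_nonneg h2,
        abs_of_pos ht.1]
      refine mul_le_mul_of_nonneg_left ?_ h2
      refine (mul_le_of_le_one_right (by positivity) ht.2).trans ?_
      exact mul_le_mul_of_nonneg_left h1 (norm_nonneg _))
    ((intervalIntegral.intervalIntegrable_rpow' (by linarith)).mul_const _)
    (by
      refine Filter.Eventually.of_forall fun t ht z hz => ?_
      rw [Set.uIoc_of_le zero_le_one] at ht
      exact (hderiv z hz t ⟨ht.1.le, ht.2⟩).const_mul _)
  refine ⟨_, hmain.2.const_mul (b : ℂ), ?_⟩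
  -- The two parts of this derivative integrate to `eulerF` and to z/b times its z-derivative; the
  -- boundary term at 0 vanishes because b > 0.
  have hparts := intervalIntegral.integral_eq_sub_of_hasDerivAt_of_le zero_le_one
    (f := fun t : ℝ => ((t ^ b : ℝ) : ℂ) * (1 - z₀ * t) ^ c)
    (f' := fun t : ℝ => b * (((t ^ (b - 1) : ℝ) : ℂ) * (1 - z₀ * t) ^ c) +
      z₀ * (((t ^ (b - 1) : ℝ) : ℂ) * (c * (1 - z₀ * t) ^ (c - 1) * (-t))))
    (by
      refine ContinuousOn.mul ?_ (hcont z₀ hz₀ c)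
      exact (Complex.continuous_ofReal.comp
        (Real.continuous_rpow_const hb.le)).continuousOn)
    (by
      intro t ht
      have h1 : HasDerivAt (fun t : ℝ => ((t ^ b : ℝ) : ℂ)) (((b * t ^ (b - 1) : ℝ)) : ℂ) t :=
        (Real.hasDerivAt_rpow_const (Or.inl ht.1.ne')).ofReal_comp
      have h2 : HasDerivAt (fun w : ℂ => 1 - z₀ * w) (-(z₀ * 1)) (t : ℂ) :=
        ((hasDerivAt_id (t : ℂ)).const_mul z₀).const_sub 1
      have h3 := (h2.cpow_const (c := c) (hslit z₀ hz₀ t ⟨ht.1.le, ht.2.le⟩)).comp_ofReal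
      refine (h1.mul h3).congr_deriv ?_
      have h4 : ((t ^ b : ℝ) : ℂ) = ((t ^ (b - 1) : ℝ) : ℂ) * t := by
        rw [← Complex.ofReal_mul, ← Real.rpow_add_one ht.1.ne']
        congr 2; ring
      rw [h4]
      push_cast
      ring)
    (((hint z₀ hz₀ c).const_mul _).add (hint'.const_mul _))
  rw [intervalIntegral.integral_add ((hint z₀ hz₀ c).const_mul _) (hint'.const_mul _),
    intervalIntegral.integral_const_mul, intervalIntegral.integral_const_mul] at hparts
  simp only [Complex.ofReal_one, mul_one, Real.one_rpow, one_mul, Real.zero_rpow hb.ne',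
    Complex.ofReal_zero, zero_mul, sub_zero] at hparts
  rw [eulerF, ← hparts]
  ring

/-- The radial profile `-(1 - z)^(-s) F(1 - s, b; b + 1; z) / (4^κ b)`. -/
def profile (κ : ℤ) (s b : ℝ) (z : ℂ) : ℂ :=
  -(1 / ((4 : ℂ) ^ κ * b)) * (1 - z) ^ ((-s : ℝ) : ℂ) * eulerF s b z

/-- The factor (1 - z)^(-s) turns the inhomogeneous term (1 - z)^(s-1) of the equation for Euler's
integral into a constant. This is the equation that the divergence computation requires. -/
theorem hasDerivAt_profile (κ : ℤ) {s b : ℝ} (hb : 0 < b) {z : ℂ} (hz : z.re < 1) :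
    ∃ S' : ℂ, HasDerivAt (profile κ s b) S' z ∧
      z * (1 - z) * S' = (s * z - b * (1 - z)) * profile κ s b z - 1 / (4 : ℂ) ^ κ := by
  obtain ⟨F', hF, hode⟩ := hasDerivAt_eulerF (s := s) hb hz
  have hslit : 1 - z ∈ Complex.slitPlane := by
    have := one_sub_mul_mem_slitPlane hz (t := 1) (by simp)
    simpa using this
  have hne : 1 - z ≠ 0 := Complex.slitPlane_ne_zero hslit
  have hsub : ∀ d : ℂ, (1 - z) ^ (d - 1) = (1 - z) ^ d / (1 - z) := fun d => by
    rw [Complex.cpow_sub _ _ hne, Complex.cpow_one]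
  have h1 : HasDerivAt (fun z : ℂ => 1 - z) (-1) z := (hasDerivAt_id z).const_sub 1
  have h2 := h1.cpow_const (c := ((-s : ℝ) : ℂ)) hslit
  have h3 := (h2.const_mul (-(1 / ((4 : ℂ) ^ κ * b)))).mul hF
  refine ⟨_, h3, ?_⟩
  have h4 : (1 - z) ^ ((-s : ℝ) : ℂ) = (1 - z) ^ (((-s : ℝ) : ℂ) - 1) * (1 - z) := by
    rw [hsub]; field_simp
  have h5 : (1 - z) ^ (((-s : ℝ) : ℂ) - 1) * (1 - z) * ((1 - z) ^ ((s - 1 : ℝ) : ℂ) * (1 - z)) =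
      1 := by
    rw [← h4]
    have : (1 - z) ^ ((s - 1 : ℝ) : ℂ) * (1 - z) = (1 - z) ^ ((s : ℝ) : ℂ) := by
      rw [show ((s - 1 : ℝ) : ℂ) = (s : ℂ) - 1 by push_cast; ring,
        hsub]
      field_simp
    rw [this, ← Complex.cpow_add _ _ hne]
    simp
  have hb' : (b : ℂ) ≠ 0 := by exact_mod_cast hb.ne'
  have h4' : (4 : ℂ) ^ κ ≠ 0 := zpow_ne_zero _ (by norm_num)
  unfold profile
  rw [h4]
  push_cast at *
  generalize (1 - z) ^ (-(s : ℂ) - 1) = A at *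
  generalize (1 - z) ^ ((s : ℂ) - 1) = B at *
  field_simp
  linear_combination (-(1 - z) ^ 2 * A) * hode - b * h5

end Hypergeometric

end

end PolarHarmonic


namespace PolarHarmonic

open Module

noncomputable section

/-! ## The polar form as a Hodge dual -/

section Dual

variable {n : ℕ}

/-- The argument `q(l) / q(l_{Z^+})` of the hypergeometric function. -/
def hyperArg (l : QSpace n ℝ) (Z : WC n) : ℂ :=
  4 * ((qV l : ℝ) : ℂ) / (pairPsi l Z * (pairPsi l (conjW Z) / qC Z))

/-- The radial amplitude of the one-form dual to `p̃_Z(l)`. -/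
def ampl (κ : ℤ) (l : QSpace n ℝ) (Z : WC n) : ℂ :=
  4 ^ κ * pairPsi l Z ^ (-κ) * (pairPsi l (conjW Z) / qC Z)⁻¹ *
    profile κ (n / 2) (κ - n / 2) (hyperArg l Z)

/-- The components of the one-form dual to `p̃_Z(l)`. -/
def betaV (κ : ℤ) (l : QSpace n ℝ) (Z : WC n) : WC n := ampl κ l Z • thetaV l Z

theorem pairPsi_conjW_ne_zero {l : QSpace n ℝ} {Z : WC n} (hP : pairPsi l Z ≠ 0) :
    pairPsi l (conjW Z) ≠ 0 := by
  rw [pairPsi_conjW]; simpa using hP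

theorem qPlus_pos {l : QSpace n ℝ} {Z : WC n} (hZ : Z ∈ upperHalf n) (hP : pairPsi l Z ≠ 0) :
    0 < qPlus l Z := by
  rw [qPlus_eq l hZ]
  have h1 : 0 < Complex.normSq (pairPsi l Z) := Complex.normSq_pos.2 hP
  have h2 := hZ.1
  positivity

theorem hyperArg_eq {l : QSpace n ℝ} {Z : WC n} (hZ : Z ∈ upperHalf n) :
    hyperArg l Z = ((qV l / qPlus l Z : ℝ) : ℂ) := by
  rw [hyperArg, qPlus_eq l hZ, pairPsi_conjW, ← mul_div_assoc, Complex.mul_conj, qC]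
  push_cast
  have := qC_ne_zero hZ
  rw [qC] at this
  by_cases h : ((Complex.normSq (pairPsi l Z) : ℝ) : ℂ) = 0
  · simp [h]
  · field_simp

theorem hyperArg_re_lt {l : QSpace n ℝ} {Z : WC n} (hZ : Z ∈ upperHalf n) (hl : qV l < 0) :
    (hyperArg l Z).re < 1 := by
  rw [hyperArg_eq hZ, Complex.ofReal_re]
  have h1 : 0 ≤ qPlus l Z := by
    rw [qPlus_eq l hZ]
    have := hZ.1
    have := Complex.normSq_nonneg (pairPsi l Z)
    positivity
  have := div_nonpos_of_nonpos_of_nonneg hl.le h1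
  linarith

theorem profile_ofReal (κ : ℤ) {s b : ℝ} (hb : 0 < b) {x : ℝ} (hx : x < 1) :
    profile κ s b x =
      ((-(1 / ((4 : ℝ) ^ κ * b)) * (1 - x) ^ (-s) * gaussF (1 - s) b (b + 1) x : ℝ) : ℂ) := by
  rw [profile, ← gaussF_eq hb hx]
  have h : (1 - (x : ℂ)) ^ ((-s : ℝ) : ℂ) = (((1 - x) ^ (-s) : ℝ) : ℂ) := by
    rw [Complex.ofReal_cpow (by linarith)]
    push_cast; rfl
  rw [h]
  push_cast
  rfl

/-- The argument is real and below 1, and the profile is real there. Conjugating the amplitude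
therefore only exchanges the two pairings. -/
theorem conj_profile (κ : ℤ) {s b : ℝ} (hb : 0 < b) {l : QSpace n ℝ} {Z : WC n}
    (hZ : Z ∈ upperHalf n) (hl : qV l < 0) :
    (starRingEnd ℂ) (profile κ s b (hyperArg l Z)) = profile κ s b (hyperArg l Z) := by
  have h := hyperArg_re_lt hZ hl
  rw [hyperArg_eq hZ] at h ⊢
  rw [profile_ofReal κ hb (by simpa using h), Complex.conj_ofReal]

/-- The Hodge operator of weight `κ` on forms of type `(0, 1)`, in terms of their components. -/
def starOne {k : ℕ} (h : k + 1 = 2 * n) (κ : ℤ) (Z : WC n) : WC n →L[ℝ] Form n k :=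
  ∑ i, ∑ j, (qC Z ^ κ * ((4 * Complex.I * qC Z) ^ n)⁻¹ * (metricInv (imW Z) i j / 2)) •
    ((Complex.conjCLE : ℂ →L[ℝ] ℂ).comp
      (ContinuousLinearMap.proj (R := ℝ) (φ := fun _ : Fin n => ℂ) j)).smulRight
        (kap h (Pi.single i 1))

theorem starOne_apply {k : ℕ} (h : k + 1 = 2 * n) (κ : ℤ) (Z b : WC n) :
    starOne h κ Z b = (qC Z ^ κ * ((4 * Complex.I * qC Z) ^ n)⁻¹) •
      kap h ((1 / 2 : ℂ) • metricMap (imW Z) b) := by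
  rw [kap_eq_sum, Finset.smul_sum, starOne, sum_apply]
  refine Finset.sum_congr rfl fun i _ => ?_
  ext v
  rw [sum_apply, Pi.smul_apply, metricMap_apply, smul_eq_mul, map_mul, map_sum, Finset.mul_sum,
    ContinuousAlternatingMap.sum_apply, ContinuousAlternatingMap.smul_apply,
    ContinuousAlternatingMap.smul_apply, smul_eq_mul, smul_eq_mul, Finset.sum_mul, Finset.mul_sum]
  refine Finset.sum_congr rfl fun j _ => ?_
  rw [_root_.smul_apply, ContinuousLinearMap.smulRight_apply, smul_smul,
    ContinuousAlternatingMap.smul_apply, map_mul, Complex.conj_ofReal,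
    show (starRingEnd ℂ) (1 / 2) = 1 / 2 by rw [map_div₀, map_one, map_ofNat]]
  simp
  ring

theorem starOne_betaV {k : ℕ} (h : k + 1 = 2 * n) (κ : ℤ) (l : QSpace n ℝ) {Z : WC n}
    (hZ : Z ∈ upperHalf n) : starOne h κ Z (betaV κ l Z) =
      (qC Z ^ κ * ((4 * Complex.I * qC Z) ^ n)⁻¹ * (starRingEnd ℂ) (ampl κ l Z)) •
        kap h (gradV l Z) := by
  rw [starOne_apply, betaV, map_smul, smul_comm, half_metricMap_theta l Z (qC_ne_zero hZ),
    kap_smul, smul_smul]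

theorem conj_ampl {κ : ℤ} (hκ : (n : ℤ) < κ) {l : QSpace n ℝ} (hl : qV l < 0) {Z : WC n}
    (hZ : Z ∈ upperHalf n) : (starRingEnd ℂ) (ampl κ l Z) =
      4 ^ κ * pairPsi l (conjW Z) ^ (-κ) * (pairPsi l Z / qC Z)⁻¹ *
        profile κ (n / 2) (κ - n / 2) (hyperArg l Z) := by
  have hκ' : (n : ℝ) < κ := by exact_mod_cast hκ
  have hb : (0 : ℝ) < κ - n / 2 := by
    have : (0 : ℝ) ≤ n := n.cast_nonneg
    linarith
  rw [ampl, map_mul, map_mul, map_mul, conj_profile κ hb hZ hl, map_inv₀, map_div₀,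
    pairPsi_conjW, Complex.conj_conj, conj_qC, map_zpow₀, map_zpow₀, map_ofNat]

theorem hasDbarAt_hyperArg {l : QSpace n ℝ} {Z : WC n} (hZ : Z ∈ upperHalf n)
    (hP : pairPsi l Z ≠ 0) : HasDbarAt (hyperArg l)
      (fun k => -hyperArg l Z * (pairPsi l (conjW Z) / qC Z)⁻¹ * thetaV l Z k) Z := by
  have hq := qC_ne_zero hZ
  have hP' := pairPsi_conjW_ne_zero hP
  have hf := hasDbarAt_quotient l Z hq
  have hf0 : pairPsi l (conjW Z) / qC Z ≠ 0 := div_ne_zero hP' hq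
  refine ((((hasDbarAt_pairPsi l Z).mul hf).inv (mul_ne_zero hP hf0)).const_mul
    (4 * ((qV l : ℝ) : ℂ))).congr_deriv fun k => ?_
  simp only [Pi.zero_apply, mul_zero, add_zero, hyperArg]
  field_simp

/-- The amplitude is a function of the holomorphic pairing and of f = (l, ψ(conj Z))/q(Y) alone, so
its antiholomorphic derivative is proportional to θ = ∂̄f. Together with the symmetry of ∂̄θ this
makes β closed. -/
theorem hasDbarAt_ampl (κ : ℤ) (hκ : (n : ℤ) < κ) {l : QSpace n ℝ} (hl : qV l < 0) {Z : WC n}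
    (hZ : Z ∈ upperHalf n) (hP : pairPsi l Z ≠ 0) :
    ∃ c, HasDbarAt (ampl κ l) (fun k => c * thetaV l Z k) Z := by
  have hκ' : (n : ℝ) < κ := by exact_mod_cast hκ
  have hb : (0 : ℝ) < κ - n / 2 := by
    have : (0 : ℝ) ≤ n := n.cast_nonneg
    linarith
  have hq := qC_ne_zero hZ
  have hf0 : pairPsi l (conjW Z) / qC Z ≠ 0 := div_ne_zero (pairPsi_conjW_ne_zero hP) hq
  obtain ⟨S', hS, -⟩ := hasDerivAt_profile κ (s := n / 2) hb (hyperArg_re_lt hZ hl)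
  have h := ((((hasDbarAt_pairPsi l Z).zpow (-κ) hP).const_mul (4 ^ κ)).mul
    ((hasDbarAt_quotient l Z hq).inv hf0)).mul
    (HasDbarAt.comp hS (hasDbarAt_hyperArg hZ hP))
  set f := pairPsi l (conjW Z) / qC Z
  refine ⟨4 ^ κ * pairPsi l Z ^ (-κ) * f⁻¹ * (S' * (-hyperArg l Z * f⁻¹)) -
    profile κ (n / 2) (κ - n / 2) (hyperArg l Z) * (4 ^ κ * pairPsi l Z ^ (-κ) / f ^ 2),
    h.congr_deriv fun k => ?_⟩
  simp only [Pi.zero_apply]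
  ring

/-- θ is itself a ∂̄-derivative, so its second derivatives form a symmetric matrix; here the
symmetry is read off from explicit entries. -/
theorem hasDbarAt_thetaV (l : QSpace n ℝ) {Z : WC n} (hZ : Z ∈ upperHalf n) :
    ∃ T : Fin n → Fin n → ℂ, (∀ j k, T j k = T k j) ∧
      ∀ k, HasDbarAt (fun Z => thetaV l Z k) (fun j => T j k) Z := by
  have hq := qC_ne_zero hZ
  set N : Fin n → ℂ := fun k => 2 * eps ℂ k * (l.2.2 k - l.2.1 * (starRingEnd ℂ) (Z k)) with hN
  refine ⟨fun j k => -(2 * eps ℂ k * l.2.1 * (if j = k then 1 else 0)) / qC Z -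
    Complex.I * (N k * (eps ℂ j * (Z j).im) + N j * (eps ℂ k * (Z k).im)) / qC Z ^ 2 +
    pairPsi l (conjW Z) * eps ℂ k * (if j = k then 1 else 0) / (2 * qC Z ^ 2) -
    2 * pairPsi l (conjW Z) * (eps ℂ k * (Z k).im) * (eps ℂ j * (Z j).im) / qC Z ^ 3, ?_, ?_⟩
  · intro j k
    by_cases h : j = k
    · subst h; rfl
    · have h' : k ≠ j := fun h' => h h'.symm
      simp only [if_neg h, if_neg h']
      ring
  · intro k
    have h1 : HasDbarAt (fun Z => 2 * eps ℂ k * (l.2.2 k - l.2.1 * (starRingEnd ℂ) (Z k)))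
        (fun j => -(2 * eps ℂ k * l.2.1 * (if j = k then 1 else 0))) Z :=
      (((HasDbarAt.const _).sub ((hasDbarAt_conj Z k).const_mul _)).const_mul _).congr_deriv
        fun j => by simp
    have h2 := ((((hasDbarAt_pairPsi_conjW l Z).const_mul Complex.I).mul
      (HasDbarAt.const (eps ℂ k))).mul (hasDbarAt_im Z k))
    refine ((h1.div (hasDbarAt_qC Z) hq).sub
      (h2.div ((hasDbarAt_qC Z).pow 2) (pow_ne_zero 2 hq))).congr_deriv fun j => ?_
    simp only [hN, Pi.zero_apply]
    split_ifs with h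
    · subst h
      field_simp
      ring_nf
      simp only [Complex.I_sq]
      ring
    · field_simp
      ring_nf
      simp only [Complex.I_sq]
      ring

/-- This function is the conjugate amplitude divided by 4^κ q(Y)^(1-κ). The second assertion is the
equation of the profile for s = n/2 and b = κ - n/2, rewritten with P f x = 4 q(l), that is P f - 4
q(l) = P f (1 - x). -/
theorem hasDbarAt_radial (κ : ℤ) (hκ : (n : ℤ) < κ) {l : QSpace n ℝ} (hl : qV l < 0) {Z : WC n}
    (hZ : Z ∈ upperHalf n) (hP : pairPsi l Z ≠ 0) :
    ∃ g, HasDbarAt (fun Z => (pairPsi l (conjW Z) / qC Z) ^ (-κ) * (pairPsi l Z)⁻¹ *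
        profile κ (n / 2) (κ - n / 2) (hyperArg l Z)) (fun k => g * thetaV l Z k) Z ∧
      n / 2 * pairPsi l Z * ((pairPsi l (conjW Z) / qC Z) ^ (-κ) * (pairPsi l Z)⁻¹ *
        profile κ (n / 2) (κ - n / 2) (hyperArg l Z)) +
      (pairPsi l Z * (pairPsi l (conjW Z) / qC Z) - 4 * ((qV l : ℝ) : ℂ)) * g =
        (pairPsi l (conjW Z) / qC Z) ^ (-κ) / 4 ^ κ := by
  have hκ' : (n : ℝ) < κ := by exact_mod_cast hκ
  have hb : (0 : ℝ) < κ - n / 2 := by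
    have : (0 : ℝ) ≤ n := n.cast_nonneg
    linarith
  have hq := qC_ne_zero hZ
  have hf0 : pairPsi l (conjW Z) / qC Z ≠ 0 := div_ne_zero (pairPsi_conjW_ne_zero hP) hq
  obtain ⟨S', hS, hode⟩ := hasDerivAt_profile κ (s := n / 2) hb (hyperArg_re_lt hZ hl)
  have h := (((hasDbarAt_quotient l Z hq).zpow (-κ) hf0).mul
    ((hasDbarAt_pairPsi l Z).inv hP)).mul (HasDbarAt.comp hS (hasDbarAt_hyperArg hZ hP))
  have hx : pairPsi l Z * (pairPsi l (conjW Z) / qC Z) * hyperArg l Z = 4 * ((qV l : ℝ) : ℂ) := by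
    have hP' := pairPsi_conjW_ne_zero hP
    rw [hyperArg]; field_simp
  set f := pairPsi l (conjW Z) / qC Z
  set S := profile κ (n / 2) (κ - n / 2) (hyperArg l Z)
  have h4 : (4 : ℂ) ^ κ ≠ 0 := zpow_ne_zero _ (by norm_num)
  refine ⟨-(f ^ (-κ) * (pairPsi l Z)⁻¹ * f⁻¹ * (κ * S + S' * hyperArg l Z)),
    h.congr_deriv fun k => ?_, ?_⟩
  · simp only [Pi.zero_apply]
    rw [zpow_sub_one₀ hf0]
    push_cast
    ring
  · rw [← hx]
    push_cast at hode
    set x := hyperArg l Z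
    generalize f ^ (-κ) = F
    field_simp at hode ⊢
    linear_combination (-F) * hode

theorem sum_eps_y_conj_gradV (l : QSpace n ℝ) (Z : WC n) (hq : qC Z ≠ 0) :
    ∑ k, eps ℂ k * ((Z k).im : ℂ) * (starRingEnd ℂ) (gradV l Z k) =
      Complex.I * pairPsi l (conjW Z) - 2 * bW (yC Z) (wC l - (l.2.1 : ℂ) • conjW Z) := by
  have h : ∑ k, eps ℂ k * ((Z k).im : ℂ) * (starRingEnd ℂ) (gradV l Z k) =
      bW (yC Z) ((Complex.I * pairPsi l (conjW Z) / qC Z) • yC Z -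
        (2 : ℂ) • (wC l - (l.2.1 : ℂ) • conjW Z)) := by
    refine Finset.sum_congr rfl fun k _ => ?_
    congr 1
    simp only [gradV, Pi.sub_apply, Pi.neg_apply, Pi.smul_apply, smul_eq_mul, map_sub, map_neg,
      map_mul, map_div₀, Complex.conj_I, conj_qC, ← pairPsi_conjW, yC, wC, Complex.conj_ofReal,
      map_ofNat, conjW]
    ring
  rw [h, bW_sub_right, bW_smul_right, bW_smul_right, ← qC_eq]
  field_simp

theorem hasDbarAt_conj_gradV (l : QSpace n ℝ) {Z : WC n} (hq : qC Z ≠ 0) (k : Fin n) :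
    HasDbarAt (fun Z => (starRingEnd ℂ) (gradV l Z k))
      (fun j => Complex.I * thetaV l Z j * (Z k).im +
        (2 * l.2.1 - pairPsi l (conjW Z) / qC Z / 2) * if j = k then 1 else 0) Z := by
  have h := (((hasDbarAt_quotient l Z hq).mul (hasDbarAt_im Z k)).const_mul Complex.I).sub
    (((HasDbarAt.const (Z := Z) (l.2.2 k : ℂ)).sub
      ((hasDbarAt_conj Z k).const_mul l.2.1)).const_mul 2)
  refine (h.of_eventuallyEq (Filter.Eventually.of_forall fun W => ?_)).congr_deriv fun j => ?_
  · simp only [gradV, Pi.sub_apply, Pi.neg_apply, Pi.smul_apply, smul_eq_mul, map_sub, map_neg,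
      map_mul, map_div₀, Complex.conj_I, conj_qC, ← pairPsi_conjW, yC, wC, Complex.conj_ofReal,
      map_ofNat]
    ring
  · simp only [Pi.zero_apply]
    split_ifs
    · linear_combination (pairPsi l (conjW Z) / qC Z / 2) * Complex.I_sq
    · ring

/-- By `dbar_kap` this is the divergence of C q^(1-n) G conj(grad), with G the radial function of
`hasDbarAt_radial`. The terms with the coefficient of e'' and with the product of Y cancel by
`pairPsi_sub_conj`. What is left is (n/2 P G + (P f - 4 q(l)) g)/q, evaluated by the radial
equation. -/
theorem dbar_starOne_betaV {k : ℕ} (h : k + 1 = 2 * n) {κ : ℤ} (hκ : (n : ℤ) < κ)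
    {l : QSpace n ℝ} (hl : qV l < 0) {Z : WC n} (hZ : Z ∈ upperHalf n) (hP : pairPsi l Z ≠ 0) :
    dbar (fun Z => starOne h κ Z (betaV κ l Z)) Z =
      (((4 * Complex.I * qC Z) ^ n)⁻¹ * qC Z ^ κ * pairPsi l (conjW Z) ^ (-κ)) • detZ h := by
  have hq := qC_ne_zero hZ
  have hP' := pairPsi_conjW_ne_zero hP
  obtain ⟨g, hg, hgeq⟩ := hasDbarAt_radial κ hκ hl hZ hP
  set G : WC n → ℂ := fun Z => (pairPsi l (conjW Z) / qC Z) ^ (-κ) * (pairPsi l Z)⁻¹ *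
        profile κ (n / 2) (κ - n / 2) (hyperArg l Z) with hG
  set C : ℂ := 4 ^ κ * ((4 * Complex.I) ^ n)⁻¹ with hC
  have hΦ : ∀ k, HasDbarAt (fun Z => C * (qC Z ^ (1 - n : ℤ) * G Z *
      (starRingEnd ℂ) (gradV l Z k))) _ Z := fun k =>
    ((((hasDbarAt_qC Z).zpow (1 - n) hq).mul hg).mul (hasDbarAt_conj_gradV l hq k)).const_mul C
  -- Collecting powers of q(Y): from the weight, the volume form and the conjugate amplitude only
  -- q^(1-n) survives. The coefficients are then explicit enough to be differentiated one by one.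
  have hev : (fun Z => starOne h κ Z (betaV κ l Z)) =ᶠ[nhds Z]
      fun Z => kap h (conjW fun k => C * (qC Z ^ (1 - n : ℤ) * G Z *
        (starRingEnd ℂ) (gradV l Z k))) := by
    filter_upwards [isOpen_upperHalf.mem_nhds hZ] with W hW
    have hqW := qC_ne_zero hW
    rw [starOne_betaV h κ l hW, conj_ampl hκ hl hW]
    have : (conjW fun k => C * (qC W ^ (1 - n : ℤ) * G W * (starRingEnd ℂ) (gradV l W k))) =
        (starRingEnd ℂ) (C * (qC W ^ (1 - n : ℤ) * G W)) • gradV l W := by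
      funext k
      simp only [conjW, Pi.smul_apply, smul_eq_mul, map_mul, Complex.conj_conj]
      ring
    rw [this, kap_smul, Complex.conj_conj]
    congr 1
    simp only [hC, hG]
    rw [mul_pow, mul_inv, inv_div, div_zpow, zpow_sub₀ hqW, zpow_one, zpow_natCast, zpow_neg,
      zpow_neg]
    have := zpow_ne_zero κ hqW
    field_simp
  rw [dbar, hev.fderiv_eq, ← dbar, dbar_kap h _ Z
    (differentiableAt_pi.2 fun k => (hΦ k).differentiableAt)]
  congr 1
  rw [Finset.sum_congr rfl fun k _ => (hΦ k).dbarAt_eq k]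
  have h1 := sum_theta_mul_conj_grad l l Z hq
  have h2 := sum_eps_y_conj_gradV l Z hq
  have h3 := sum_y_mul_theta l Z hq
  have h4 := pairPsi_sub_conj l Z
  set B := bW (yC Z) (wC l - (l.2.1 : ℂ) • conjW Z)
  simp only [if_true, mul_one]
  have key : ∀ k, C * (qC Z ^ (1 - n : ℤ) * G Z * (Complex.I * thetaV l Z k * (Z k).im +
        (2 * l.2.1 - pairPsi l (conjW Z) / qC Z / 2)) +
      (starRingEnd ℂ) (gradV l Z k) * (qC Z ^ (1 - n : ℤ) * (g * thetaV l Z k) +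
        G Z * ((1 - n : ℤ) * qC Z ^ ((1 - n : ℤ) - 1) * (Complex.I * eps ℂ k * (Z k).im)))) =
      C * qC Z ^ (1 - n : ℤ) * (G Z * Complex.I * ((Z k).im * thetaV l Z k) +
        G Z * (2 * l.2.1 - pairPsi l (conjW Z) / qC Z / 2) +
        g * (thetaV l Z k * (starRingEnd ℂ) (gradV l Z k)) +
        G Z * (1 - n) / qC Z * Complex.I *
          (eps ℂ k * (Z k).im * (starRingEnd ℂ) (gradV l Z k))) := by
    intro k
    rw [zpow_sub_one₀ hq]
    push_cast
    ring
  rw [Finset.sum_congr rfl fun k _ => key k, ← Finset.mul_sum]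
  simp only [Finset.sum_add_distrib, ← Finset.mul_sum, h1, h2, h3, bV_self]
  rw [Finset.sum_const, Finset.card_univ, Fintype.card_fin, nsmul_eq_mul]
  have h4' : (4 : ℂ) ^ κ ≠ 0 := zpow_ne_zero _ (by norm_num)
  have h5 : (pairPsi l (conjW Z) / qC Z) ^ (-κ) = 4 ^ κ * (n / 2 * pairPsi l Z * G Z +
      (pairPsi l Z * (pairPsi l (conjW Z) / qC Z) - 4 * ((qV l : ℝ) : ℂ)) * g) := by
    rw [hgeq]; field_simp
  have h6 : qC Z ^ κ * pairPsi l (conjW Z) ^ (-κ) = (pairPsi l (conjW Z) / qC Z) ^ (-κ) := by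
    rw [div_zpow, zpow_neg (qC Z), div_inv_eq_mul, mul_comm]
  rw [mul_assoc _ (qC Z ^ κ), h6, h5, hC, mul_pow, mul_inv, zpow_sub₀ hq, zpow_one, zpow_natCast]
  push_cast
  generalize G Z = G' at *
  have hy : 4 * (l.2.1 : ℂ) * qC Z = pairPsi l Z - pairPsi l (conjW Z) - 4 * Complex.I * B := by
    linear_combination h4
  have hy' : (l.2.1 : ℂ) =
      (pairPsi l Z - pairPsi l (conjW Z) - 4 * Complex.I * B) / (4 * qC Z) := by
    rw [← hy]; field_simp
  rw [hy']
  have h7 : (4 * Complex.I : ℂ) ^ n ≠ 0 := pow_ne_zero _ (by simp)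
  field_simp
  ring_nf
  simp only [Complex.I_sq]
  ring

/-- The form `d conj(z_k)`. -/
def dzbar (k : Fin n) : Form n (0 + 1) :=
  haveI : Subsingleton (Fin (0 + 1)) := inferInstanceAs (Subsingleton (Fin 1))
  ContinuousAlternatingMap.ofSubsingleton ℝ (WC n) ℂ (0 : Fin (0 + 1))
    ((Complex.conjCLE : ℂ →L[ℝ] ℂ).comp
      (ContinuousLinearMap.proj (R := ℝ) (φ := fun _ : Fin n => ℂ) k))

/-- The form of type `(0, 1)` with given components. -/
def oneForm : WC n →L[ℝ] Form n (0 + 1) :=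
  ∑ k, (ContinuousLinearMap.proj (R := ℝ) (φ := fun _ : Fin n => ℂ) k).smulRight (dzbar k)

theorem oneForm_apply (b : WC n) (v : Fin (0 + 1) → WC n) :
    oneForm b v = ∑ k, b k * (starRingEnd ℂ) (v 0 k) := by
  rw [oneForm, sum_apply, ContinuousAlternatingMap.sum_apply]
  exact Finset.sum_congr rfl fun k _ => rfl

theorem starW_oneForm {k : ℕ} (h : k + (0 + 1) = 2 * n) (κ : ℤ) (β : WC n → WC n) (Z : WC n) :
    starW κ 0 h (fun Z => oneForm (β Z)) Z = starOne (k := k) h κ Z (β Z) := by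
  have h1 := starBar_one h (fun Z => oneForm (β Z)) Z (fun w => by
    rw [oneForm_apply, oneForm_apply, Finset.mul_sum]
    refine Finset.sum_congr rfl fun k _ => ?_
    simp only [Pi.smul_apply, smul_eq_mul, map_mul, Complex.conj_I]
    ring)
  have h2 : (fun j => oneForm (β Z) fun _ => Pi.single j 1) = β Z := by
    funext j
    rw [oneForm_apply, sum_mul_conj_single, map_one, mul_one]
  rw [h2] at h1
  rw [starW, h1, starOne_apply, smul_smul]
  rfl

/-- ∂̄ of a (0,1)-form is the antisymmetrisation of the matrix of antiholomorphic derivatives of its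
components. -/
theorem dbar_oneForm_eq_zero {β : WC n → WC n} {Z : WC n} {T : Fin n → Fin n → ℂ}
    (hT : ∀ j k, T j k = T k j) (hβ : ∀ k, HasDbarAt (fun Z => β Z k) (fun j => T j k) Z) :
    dbar (fun Z => oneForm (β Z)) Z = 0 := by
  choose F' hF hD using hβ
  have h1 : HasFDerivAt (fun Z => oneForm (β Z)) (oneForm.comp (ContinuousLinearMap.pi F')) Z :=
    oneForm.hasFDerivAt.comp Z (hasFDerivAt_pi.2 hF)
  have h2 : ∀ a b : WC n, ∑ k, (1 / 2 * (F' k a + Complex.I * F' k (Complex.I • a))) *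
      (starRingEnd ℂ) (b k) = ∑ k, ∑ j, T j k * (starRingEnd ℂ) (a j) * (starRingEnd ℂ) (b k) :=
    fun a b => Finset.sum_congr rfl fun k _ => by
      rw [antilinear_part_apply (F' k) (fun j => T j k) (hD k), Finset.sum_mul]
  have h3 : ∀ a b : WC n, ∑ k, (1 / 2 * (F' k a + Complex.I * F' k (Complex.I • a))) *
      (starRingEnd ℂ) (b k) = ∑ k, (1 / 2 * (F' k b + Complex.I * F' k (Complex.I • b))) *
      (starRingEnd ℂ) (a k) := by
    intro a b
    rw [h2, h2, Finset.sum_comm]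
    refine Finset.sum_congr rfl fun k _ => Finset.sum_congr rfl fun j _ => ?_
    rw [hT]; ring
  have h4 : ∀ (a : WC n) (v : Fin (0 + 1) → WC n), ((1 / 2 : ℂ) •
      (oneForm.comp (ContinuousLinearMap.pi F') +
        Complex.I • (oneForm.comp (ContinuousLinearMap.pi F')).comp (mulI n))) a v =
      ∑ k, (1 / 2 * (F' k a + Complex.I * F' k (Complex.I • a))) * (starRingEnd ℂ) (v 0 k) := by
    intro a v
    change (1 / 2 : ℂ) • (oneForm (fun k => F' k a) v +
      Complex.I • oneForm (fun k => F' k (mulI n a)) v) = _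
    rw [oneForm_apply, oneForm_apply, mulI_apply, smul_eq_mul, smul_eq_mul, Finset.mul_sum,
      ← Finset.sum_add_distrib, Finset.mul_sum]
    exact Finset.sum_congr rfl fun k _ => by ring
  ext v
  rw [dbar, h1.fderiv, ContinuousAlternatingMap.alternatizeUncurryFin_apply, Fin.sum_univ_two]
  rw [h4, h4, h3]
  simp [Fin.removeNth]

theorem dbar_oneForm_betaV {κ : ℤ} (hκ : (n : ℤ) < κ) {l : QSpace n ℝ} (hl : qV l < 0)
    {Z : WC n} (hZ : Z ∈ upperHalf n) (hP : pairPsi l Z ≠ 0) :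
    dbar (fun Z => oneForm (betaV κ l Z)) Z = 0 := by
  obtain ⟨c, hc⟩ := hasDbarAt_ampl κ hκ hl hZ hP
  obtain ⟨T, hT, hθ⟩ := hasDbarAt_thetaV l hZ
  refine dbar_oneForm_eq_zero (T := fun j k => ampl κ l Z * T j k +
    thetaV l Z k * (c * thetaV l Z j)) (fun j k => by rw [hT]; ring) fun k => hc.mul (hθ k)

/-- A form of type `(n, n - 1)` given by its dual one-form has the type `(n, n - 1)`. -/
theorem starOne_isOfType {m : ℕ} (κ : ℤ) (Z b : WC (m + 1)) :
    IsOfType (m + 1) m (starOne (k := 2 * m + 1) (by omega) κ Z b) := by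
  rw [starOne_apply]
  obtain ⟨h1, h2⟩ := kap_isOfType (m := m) (by omega) ((1 / 2 : ℂ) • metricMap (imW Z) b)
  refine ⟨h1, fun c v => ?_⟩
  rw [ContinuousAlternatingMap.smul_apply, ContinuousAlternatingMap.smul_apply, h2]
  simp only [smul_eq_mul]
  ring

/-- The factor q(Y)^κ is real, so it passes unchanged through the antilinear star and cancels the
opposite weight; *̄ *̄ = -1 does the rest. -/
theorem starW_starOne {k : ℕ} (h : k + (0 + 1) = 2 * n) (h' : (0 + 1) + k = 2 * n) (κ : ℤ)
    {Z : WC n} (hZ : Z ∈ upperHalf n) (b : WC n → WC n) :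
    starW (-κ) n h' (fun Z => starOne (k := k) h κ Z (b Z)) Z = -oneForm (b Z) := by
  have hq := qC_ne_zero hZ
  have h1 : ∀ Z, starOne (k := k) h κ Z (b Z) = qC Z ^ κ • starBar 0 h (fun Z => oneForm (b Z)) Z :=
    fun Z => (starW_oneForm h κ b Z).symm
  have h2 := starBar_starBar_one h h' (fun Z => oneForm (b Z)) Z hZ.1.ne'
    (starBar 0 h (fun Z => oneForm (b Z))) rfl
  have h3 : starBar n h' (fun Z => starOne (k := k) h κ Z (b Z)) Z =
      (qC Z ^ κ) • starBar n h' (starBar 0 h (fun Z => oneForm (b Z))) Z := by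
    ext v
    simp only [starBar, h1, ContinuousAlternatingMap.smul_apply, ContinuousAlternatingMap.sum_apply,
      smul_eq_mul, map_mul, map_zpow₀, conj_qC, mul_assoc, ← Finset.mul_sum]
    ring
  rw [starW, h3, h2]
  change qC Z ^ (-κ) • qC Z ^ κ • _ = _
  rw [smul_smul, ← zpow_add₀ hq, neg_add_cancel, zpow_zero, one_smul]

end Dual

/-- Since -q(l_{Z^-}) = q(l_{Z^+})(1 - x), the two half-integral powers combine to (1 - x)^(-n/2)
q(l_{Z^+})^(-κ), and q(l_{Z^+}) = P conj(P)/(4 q(Y)) turns the rest into the conjugate amplitude. -/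
theorem pTilde_eq_starOne {m : ℕ} {κ : ℤ} (hκ : ((m + 1 : ℕ) : ℤ) < κ) {l : QSpace (m + 1) ℝ}
    (hl : qV l < 0) {Z : WC (m + 1)} (hZ : Z ∈ upperHalf (m + 1)) (hP : pairPsi l Z ≠ 0) :
    pTilde κ l Z = starOne (k := 2 * m + 1) (by omega) κ Z (betaV κ l Z) := by
  have hκ' : ((m + 1 : ℕ) : ℝ) < κ := by exact_mod_cast hκ
  have hb : (0 : ℝ) < κ - ((m + 1 : ℕ) : ℝ) / 2 := by
    have : (0 : ℝ) ≤ ((m + 1 : ℕ) : ℝ) := Nat.cast_nonneg _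
    linarith
  have hq := qC_ne_zero hZ
  have hu := qPlus_pos hZ hP
  have hx : qV l / qPlus l Z < 1 := by
    have := div_neg_of_neg_of_pos hl hu
    linarith
  rw [starOne_betaV _ _ _ hZ, conj_ampl hκ hl hZ, hyperArg_eq hZ, profile_ofReal κ hb hx]
  unfold pTilde
  simp only
  rw [pForm_eq l hZ, smul_smul]
  congr 1
  have h1 : -qMinus l Z = qPlus l Z * (1 - qV l / qPlus l Z) := by
    rw [qMinus_eq l hZ]; field_simp; ring
  have h2 : (1 : ℝ) - qV l / qPlus l Z > 0 := by linarith
  rw [h1, Real.mul_rpow hu.le h2.le, sub_eq_add_neg (((m + 1 : ℕ) : ℝ) / 2), Real.rpow_add hu,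
    Real.rpow_neg hu.le, Real.rpow_neg hu.le (κ : ℝ), Real.rpow_intCast]
  have hu' : (qPlus l Z) ^ (((m + 1 : ℕ) : ℝ) / 2) ≠ 0 := (Real.rpow_pos_of_pos hu _).ne'
  have h3 : ((qPlus l Z : ℝ) : ℂ) = pairPsi l Z * pairPsi l (conjW Z) / (4 * qC Z) := by
    rw [qPlus_eq l hZ, pairPsi_conjW, Complex.mul_conj, qC]; push_cast; rfl
  have hP' := pairPsi_conjW_ne_zero hP
  set G := gaussF (1 - ((m + 1 : ℕ) : ℝ) / 2) (κ - ((m + 1 : ℕ) : ℝ) / 2)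
    (κ - ((m + 1 : ℕ) : ℝ) / 2 + 1) (qV l / qPlus l Z)
  set B := (1 - qV l / qPlus l Z) ^ (-(((m + 1 : ℕ) : ℝ) / 2))
  have h4 : -(1 / ((4 : ℝ) ^ κ * (κ - ((m + 1 : ℕ) : ℝ) / 2))) *
      ((qPlus l Z ^ (((m + 1 : ℕ) : ℝ) / 2))⁻¹ * B) *
      (qPlus l Z ^ (((m + 1 : ℕ) : ℝ) / 2) * (qPlus l Z ^ κ)⁻¹) * G =
      (-(1 / ((4 : ℝ) ^ κ * (κ - ((m + 1 : ℕ) : ℝ) / 2))) * B * G) * (qPlus l Z ^ κ)⁻¹ := by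
    field_simp
  rw [h4, Complex.ofReal_mul _ (qPlus l Z ^ κ)⁻¹, Complex.ofReal_inv, Complex.ofReal_zpow, h3]
  generalize ((-(1 / ((4 : ℝ) ^ κ * (κ - ((m + 1 : ℕ) : ℝ) / 2))) * B * G : ℝ) : ℂ) = R
  rw [zpow_sub_one₀ hP, div_zpow, mul_zpow, mul_zpow, zpow_neg]
  have h5 : pairPsi l Z ^ κ ≠ 0 := zpow_ne_zero _ hP
  have h6 : qC Z ^ κ ≠ 0 := zpow_ne_zero _ hq
  have h7 : pairPsi l (conjW Z) ^ κ ≠ 0 := zpow_ne_zero _ hP'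
  field_simp

end

end PolarHarmonic


namespace PolarHarmonic

open Module

noncomputable section

/-! ## Real analytic families and their sums -/

section Families

open Topology BoundedContinuousFunction

variable {C : Type} [TopologicalSpace C]
  {E : Type*} [NormedAddCommGroup E] [NormedSpace ℝ E]

/-- A family of complex functions which near `x` is given by one real analytic function with values
in the bounded families. -/
def UniformAnalyticAt (h : C → E → ℂ) (x : E) : Prop :=
  ∃ H : E → C →ᵇ ℂ, AnalyticAt ℝ H x ∧ ∀ᶠ y in 𝓝 x, ∀ c, H y c = h c y

namespace UniformAnalyticAt

variable {h h' : C → E → ℂ} {x : E}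

theorem congr (hh : UniformAnalyticAt h x) (he : ∀ᶠ y in 𝓝 x, ∀ c, h c y = h' c y) :
    UniformAnalyticAt h' x := by
  obtain ⟨H, h1, h2⟩ := hh
  refine ⟨H, h1, ?_⟩
  filter_upwards [h2, he] with y h3 h4 c
  rw [h3, h4]

theorem of_bounded [DiscreteTopology C] (b : C → ℂ) (M : ℝ) (hb : ∀ c, ‖b c‖ ≤ M) :
    UniformAnalyticAt (fun c (_ : E) => b c) x :=
  ⟨fun _ => ofNormedAddCommGroupDiscrete b M hb, analyticAt_const,
    Filter.Eventually.of_forall fun _ _ => rfl⟩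

theorem of_analyticAt {f : E → ℂ} (hf : AnalyticAt ℝ f x) :
    UniformAnalyticAt (fun (_ : C) y => f y) x := by
  refine ⟨fun y => (algebraMapCLM ℂ (C →ᵇ ℂ)).restrictScalars ℝ (f y),
    (((algebraMapCLM ℂ (C →ᵇ ℂ)).restrictScalars ℝ).analyticAt _).fun_comp hf,
    Filter.Eventually.of_forall fun y c => ?_⟩
  change (algebraMap ℂ (C →ᵇ ℂ) (f y)) c = f y
  rw [Algebra.algebraMap_eq_smul_one]
  simp

theorem add (hh : UniformAnalyticAt h x) (hh' : UniformAnalyticAt h' x) :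
    UniformAnalyticAt (fun c y => h c y + h' c y) x := by
  obtain ⟨H, h1, h2⟩ := hh
  obtain ⟨H', h1', h2'⟩ := hh'
  refine ⟨fun y => H y + H' y, h1.add h1', ?_⟩
  filter_upwards [h2, h2'] with y h3 h4 c
  rw [BoundedContinuousFunction.add_apply, h3, h4]

theorem mul (hh : UniformAnalyticAt h x) (hh' : UniformAnalyticAt h' x) :
    UniformAnalyticAt (fun c y => h c y * h' c y) x := by
  obtain ⟨H, h1, h2⟩ := hh
  obtain ⟨H', h1', h2'⟩ := hh'
  refine ⟨fun y => H y * H' y, h1.mul h1', ?_⟩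
  filter_upwards [h2, h2'] with y h3 h4 c
  rw [BoundedContinuousFunction.mul_apply, h3, h4]

theorem sum [DiscreteTopology C] {ι : Type*} (s : Finset ι) {h : ι → C → E → ℂ}
    (hh : ∀ i ∈ s, UniformAnalyticAt (h i) x) :
    UniformAnalyticAt (fun c y => ∑ i ∈ s, h i c y) x := by
  classical
  induction s using Finset.induction_on with
  | empty => exact of_bounded (fun _ => 0) 0 (by simp)
  | insert a s ha ih =>
    simp only [Finset.sum_insert ha]
    exact (hh a (Finset.mem_insert_self a s)).add
      (ih fun i hi => hh i (Finset.mem_insert_of_mem hi))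

theorem pow [DiscreteTopology C] (hh : UniformAnalyticAt h x) (N : ℕ) : UniformAnalyticAt (fun c y => h c y ^ N) x := by
  induction N with
  | zero => simpa using of_bounded (x := x) (fun _ : C => (1 : ℂ)) 1 (by simp)
  | succ N ih => simpa [pow_succ] using ih.mul hh

/-- A uniform lower bound makes the family a unit in the Banach algebra of bounded functions, where
inversion is analytic near units. This also gives a common neighbourhood on which no member
vanishes. -/
theorem inv_aux [DiscreteTopology C] (hh : UniformAnalyticAt h x) {δ : ℝ} (hδ : 0 < δ) (hb : ∀ c, δ ≤ ‖h c x‖) :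
    UniformAnalyticAt (fun c y => (h c y)⁻¹) x ∧ ∀ᶠ y in 𝓝 x, ∀ c, h c y ≠ 0 := by
  obtain ⟨H, h1, h2⟩ := hh
  have h3 : ∀ c, H x c = h c x := h2.self_of_nhds
  have h0 : ∀ c, h c x ≠ 0 := fun c hc => by
    have := hb c
    rw [hc, norm_zero] at this
    linarith
  set J : C →ᵇ ℂ := ofNormedAddCommGroupDiscrete (fun c => (h c x)⁻¹) δ⁻¹ fun c => by
    rw [norm_inv]; exact inv_anti₀ hδ (hb c)
  have hHJ : H x * J = 1 := by
    ext c
    change H x c * (h c x)⁻¹ = 1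
    rw [h3, mul_inv_cancel₀ (h0 c)]
  set u : (C →ᵇ ℂ)ˣ := Units.mkOfMulEqOne (H x) J hHJ
  have hu : (u : C →ᵇ ℂ) = H x := rfl
  have h4 : ∀ᶠ y in 𝓝 x, ∀ c, H y c * Ring.inverse (H y) c = 1 := by
    have h5 : ∀ᶠ y in 𝓝 x, IsUnit (H y) := h1.continuousAt.eventually (u.nhds)
    filter_upwards [h5] with y hy c
    have := congrArg (fun F : C →ᵇ ℂ => F c) (Ring.mul_inverse_cancel _ hy)
    simpa using this
  constructor
  · refine ⟨fun y => Ring.inverse (H y), ?_, ?_⟩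
    · have := analyticAt_inverse (𝕜 := ℝ) u
      rw [hu] at this
      exact this.fun_comp h1
    · filter_upwards [h2, h4] with y h5 h6 c
      rw [← h5]
      exact eq_inv_of_mul_eq_one_right (h6 c)
  · filter_upwards [h2, h4] with y h5 h6 c hc
    have := h6 c
    rw [h5, hc, zero_mul] at this
    exact zero_ne_one this

/-- A scalar power series acts on small bounded families. -/
theorem exists_analyticAt_zero {φ : ℂ → ℂ} (hφ : AnalyticAt ℂ φ 0) :
    ∃ Φ : (C →ᵇ ℂ) → (C →ᵇ ℂ), ∃ r > 0, (∀ h : C →ᵇ ℂ, ‖h‖ < r → AnalyticAt ℂ Φ h) ∧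
      ∀ h : C →ᵇ ℂ, ‖h‖ < r → ∀ c, Φ h c = φ (h c) := by
  obtain ⟨p, R, hp⟩ := hφ
  obtain ⟨r, hr0, hrR⟩ := ENNReal.lt_iff_exists_nnreal_btwn.1 hp.r_pos
  have hr0' : 0 < r := by exact_mod_cast hr0
  obtain ⟨K, hK, hKb⟩ := p.norm_mul_pow_le_of_lt_radius (hrR.trans_le hp.r_le)
  set P := FormalMultilinearSeries.ofScalars (C →ᵇ ℂ) p.coeff (𝕜 := ℂ)
  have hP : (r : ENNReal) ≤ P.radius := by
    refine P.le_radius_of_bound (max K ‖P 0‖) fun n => ?_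
    rcases Nat.eq_zero_or_pos n with rfl | hn
    · simp
    · refine le_trans ?_ (le_max_left _ _)
      refine le_trans (mul_le_mul_of_nonneg_right
        (FormalMultilinearSeries.ofScalars_norm_le (C →ᵇ ℂ) p.coeff n hn) (by positivity)) ?_
      rw [← FormalMultilinearSeries.norm_apply_eq_norm_coef]
      exact hKb n
  have hP0 : 0 < P.radius := hr0.trans_le hP
  have hball := P.hasFPowerSeriesOnBall hP0
  refine ⟨P.sum, r, by exact_mod_cast hr0', fun h hh => ?_, fun h hh c => ?_⟩
  · refine hball.analyticAt_of_mem ?_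
    refine Metric.eball_subset_eball hP ?_
    rw [Metric.mem_eball, edist_zero_right, ← ofReal_norm,
      ← ENNReal.ofReal_coe_nnreal]
    exact (ENNReal.ofReal_lt_ofReal_iff (by exact_mod_cast hr0')).2 hh
  · have hmem : ∀ {G : Type} [NormedAddCommGroup G] (g : G), ‖g‖ < r → ∀ ρ : ENNReal, r ≤ ρ →
        g ∈ Metric.eball (0 : G) ρ := by
      intro G _ g hg ρ hρ
      refine Metric.eball_subset_eball hρ ?_
      rw [Metric.mem_eball, edist_zero_right, ← ofReal_norm,
        ← ENNReal.ofReal_coe_nnreal]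
      exact (ENNReal.ofReal_lt_ofReal_iff (by exact_mod_cast hr0')).2 hg
    have h1 := hball.hasSum (hmem h hh _ hP)
    have h2 := hp.hasSum (hmem (h c) ((h.norm_coe_le_norm c).trans_lt hh) _ hrR.le)
    rw [zero_add] at h1 h2
    have h3 := h1.mapL (evalCLM ℂ c)
    refine h3.unique (h2.congr_fun ?_)
    intro n
    simp [P, FormalMultilinearSeries.ofScalars_apply_eq, mul_comm]

theorem apply (hh : UniformAnalyticAt h x) (c : C) : AnalyticAt ℝ (h c) x := by
  obtain ⟨H, h1, h2⟩ := hh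
  refine (((evalCLM ℝ c : (C →ᵇ ℂ) →L[ℝ] ℂ).analyticAt _).fun_comp h1).congr ?_
  filter_upwards [h2] with y hy
  exact hy c

/-- All but finitely many members are small, and there the power series of φ at 0 acts on the whole
family at once. The exceptional members are first replaced by 0, where φ takes the value φ(0), and
then corrected by finitely many single analytic functions. -/
theorem comp [DiscreteTopology C] {φ : ℂ → ℂ} (hφ : AnalyticAt ℂ φ 0) (hh : UniformAnalyticAt h x)
    (hφ' : ∀ c, AnalyticAt ℂ φ (h c x)) (h0 : Filter.Tendsto (fun c => h c x) Filter.cofinite (𝓝 0)) :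
    UniformAnalyticAt (fun c y => φ (h c y)) x := by
  classical
  obtain ⟨Φ, r, hr, hΦ, hΦ'⟩ := exists_analyticAt_zero (C := C) hφ
  have hfin : {c | ¬ ‖h c x‖ < r / 2}.Finite := by
    have := h0.norm.eventually (gt_mem_nhds (by rw [norm_zero]; positivity : ‖(0 : ℂ)‖ < r / 2))
    exact Filter.eventually_cofinite.1 this
  set s := hfin.toFinset with hs
  have hχ : UniformAnalyticAt (fun c (_ : E) => if c ∈ s then (0 : ℂ) else 1) x :=
    of_bounded _ 1 fun c => by split_ifs <;> simp
  obtain ⟨H, h1, h2⟩ := hχ.mul hh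
  have hH : ‖H x‖ < r := by
    refine lt_of_le_of_lt ((norm_le (by positivity)).2 fun c => ?_) (half_lt_self hr)
    rw [h2.self_of_nhds c]
    by_cases hc : c ∈ s
    · simp only [if_pos hc, zero_mul, norm_zero]; positivity
    · simp only [if_neg hc, one_mul]
      have : ¬ ¬ ‖h c x‖ < r / 2 := by simpa [hs] using hc
      exact (not_not.1 this).le
  have hA : UniformAnalyticAt (fun c y => φ ((if c ∈ s then (0 : ℂ) else 1) * h c y)) x := by
    refine ⟨fun y => Φ (H y), ((hΦ _ hH).restrictScalars (𝕜 := ℝ)).fun_comp h1, ?_⟩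
    filter_upwards [h2, h1.continuousAt.norm.eventually (gt_mem_nhds hH)] with y h3 h4 c
    rw [hΦ' _ h4, h3]
  have hB : UniformAnalyticAt (fun c y => ∑ d ∈ s, (if c = d then (1 : ℂ) else 0) *
      (φ (h d y) - φ 0)) x := by
    refine sum s fun d _ => (of_bounded _ 1 fun c => by split_ifs <;> simp).mul
      (of_analyticAt ?_)
    exact (((hφ' d).restrictScalars (𝕜 := ℝ)).fun_comp (hh.apply d)).sub analyticAt_const
  refine (hA.add hB).congr (Filter.Eventually.of_forall fun y c => ?_)
  simp only [ite_mul, one_mul, zero_mul, Finset.sum_ite_eq]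
  split_ifs <;> ring

end UniformAnalyticAt

end Families

section Sums

open Topology BoundedContinuousFunction

variable {C : Type} {E : Type*} [NormedAddCommGroup E] [NormedSpace ℝ E]

/-- Near `x` the series of the real analytic functions `g c` is dominated by a multiple of the
series `ω`, its sum is real analytic and can be differentiated term by term. -/
structure NormalSumAt {F : Type*} [NormedAddCommGroup F] [NormedSpace ℝ F]
    (ω : C → ℝ) (g : C → E → F) (x : E) : Prop where
  bound : ∃ M, ∀ᶠ y in 𝓝 x, ∀ c, ‖g c y‖ ≤ M * ω c
  differentiable : ∀ c, DifferentiableAt ℝ (g c) x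
  analytic : AnalyticAt ℝ (fun y => ∑' c, g c y) x
  hasSum_fderiv : HasSum (fun c => fderiv ℝ (g c) x) (fderiv ℝ (fun y => ∑' c, g c y) x)

namespace NormalSumAt

variable {F G : Type*} [NormedAddCommGroup F] [NormedSpace ℝ F] [NormedAddCommGroup G]
  [NormedSpace ℝ G] {ω : C → ℝ} {g g' : C → E → F} {x : E}

theorem congr (hg : NormalSumAt ω g x) (he : ∀ᶠ y in 𝓝 x, ∀ c, g c y = g' c y) :
    NormalSumAt ω g' x := by
  have h1 : ∀ c, g c =ᶠ[𝓝 x] g' c := fun c => by filter_upwards [he] with y hy using hy c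
  have h2 : (fun y => ∑' c, g c y) =ᶠ[𝓝 x] fun y => ∑' c, g' c y := by
    filter_upwards [he] with y hy using tsum_congr hy
  refine ⟨?_, fun c => (hg.differentiable c).congr_of_eventuallyEq (h1 c).symm,
    hg.analytic.congr h2, ?_⟩
  · obtain ⟨M, hM⟩ := hg.bound
    refine ⟨M, ?_⟩
    filter_upwards [hM, he] with y h3 h4 c
    rw [← h4]; exact h3 c
  · rw [← h2.fderiv_eq]
    simpa only [(h1 _).fderiv_eq] using hg.hasSum_fderiv

theorem eventually_summable [CompleteSpace F] (hω : Summable ω) (hg : NormalSumAt ω g x) :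
    ∀ᶠ y in 𝓝 x, Summable fun c => g c y := by
  obtain ⟨M, hM⟩ := hg.bound
  filter_upwards [hM] with y hy
  exact Summable.of_norm_bounded (hω.mul_left M) hy

theorem add [CompleteSpace F] (hω : Summable ω) (hg : NormalSumAt ω g x)
    (hg' : NormalSumAt ω g' x) : NormalSumAt ω (fun c y => g c y + g' c y) x := by
  have h1 : (fun y => ∑' c, (g c y + g' c y)) =ᶠ[𝓝 x]
      fun y => (∑' c, g c y) + ∑' c, g' c y := by
    filter_upwards [hg.eventually_summable hω, hg'.eventually_summable hω] with y h1 h2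
    exact h1.tsum_add h2
  refine ⟨?_, fun c => (hg.differentiable c).add (hg'.differentiable c),
    (hg.analytic.add hg'.analytic).congr h1.symm, ?_⟩
  · obtain ⟨M, hM⟩ := hg.bound
    obtain ⟨M', hM'⟩ := hg'.bound
    refine ⟨M + M', ?_⟩
    filter_upwards [hM, hM'] with y h3 h4 c
    rw [add_mul]
    exact (norm_add_le _ _).trans (add_le_add (h3 c) (h4 c))
  · rw [h1.fderiv_eq, fderiv_fun_add hg.analytic.differentiableAt hg'.analytic.differentiableAt]
    have : (fun c => fderiv ℝ (fun y => g c y + g' c y) x) =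
        fun c => fderiv ℝ (g c) x + fderiv ℝ (g' c) x :=
      funext fun c => fderiv_fun_add (hg.differentiable c) (hg'.differentiable c)
    rw [this]
    exact hg.hasSum_fderiv.add hg'.hasSum_fderiv

/-- This transfers the result for the one-forms β to their Hodge duals, since the star operator
depends on the point. -/
theorem clm_apply [CompleteSpace F] (hω : Summable ω) (hg : NormalSumAt ω g x) {A : E → F →L[ℝ] G} (hA : AnalyticAt ℝ A x) :
    NormalSumAt ω (fun c y => A y (g c y)) x := by
  have h1 : (fun y => ∑' c, A y (g c y)) =ᶠ[𝓝 x] fun y => A y (∑' c, g c y) := by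
    filter_upwards [hg.eventually_summable hω] with y hy
    exact ((A y).map_tsum hy).symm
  have hd := hA.differentiableAt
  refine ⟨?_, fun c => hd.clm_apply (hg.differentiable c), ?_, ?_⟩
  · obtain ⟨M, hM⟩ := hg.bound
    refine ⟨(‖A x‖ + 1) * M, ?_⟩
    have h2 := hA.continuousAt.norm.eventually (gt_mem_nhds (lt_add_one ‖A x‖))
    filter_upwards [hM, h2] with y h3 h4 c
    refine ((A y).le_opNorm _).trans ?_
    rw [mul_assoc]
    exact mul_le_mul h4.le (h3 c) (norm_nonneg _) (by positivity)
  · refine AnalyticAt.congr ?_ h1.symm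
    exact ((ContinuousLinearMap.id ℝ (F →L[ℝ] G)).analyticAt_bilinear _).comp₂ hA hg.analytic
  · rw [h1.fderiv_eq, fderiv_clm_apply hd hg.analytic.differentiableAt]
    have : (fun c => fderiv ℝ (fun y => A y (g c y)) x) =
        fun c => (A x).comp (fderiv ℝ (g c) x) + (fderiv ℝ A x).flip (g c x) :=
      funext fun c => fderiv_clm_apply hd (hg.differentiable c)
    rw [this]
    exact (hg.hasSum_fderiv.mapL (ContinuousLinearMap.compL ℝ E F G (A x))).add
      ((hg.eventually_summable hω).self_of_nhds.hasSum.mapL (fderiv ℝ A x).flip)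

theorem pi (hω : Summable ω) {n : ℕ} {g : C → E → WC n}
    (hg : ∀ k, NormalSumAt ω (fun c y => g c y k) x) : NormalSumAt ω g x := by
  have h1 : ∀ s : Finset (Fin n), NormalSumAt ω
      (fun c y => ∑ k ∈ s, (Pi.single k (g c y k) : WC n)) x := by
    intro s
    induction s using Finset.induction_on with
    | empty =>
      simp only [Finset.sum_empty]
      exact ⟨⟨0, by simp⟩, fun c => differentiableAt_const _, by simpa using analyticAt_const,
        by simp⟩
    | insert a s ha ih =>
      simp only [Finset.sum_insert ha]
      refine NormalSumAt.add hω ?_ ih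
      exact (hg a).clm_apply hω
        (A := fun _ => ContinuousLinearMap.single ℝ (fun _ : Fin n => ℂ) a) analyticAt_const
  refine (h1 Finset.univ).congr (Filter.Eventually.of_forall fun y c => ?_)
  exact Finset.univ_sum_single _

end NormalSumAt

/-- The series of evaluations weighted by `ω` converges in norm to one continuous linear functional.
The sum is this functional applied to a single analytic map, which gives analyticity and termwise
differentiation together. -/
theorem UniformAnalyticAt.normalSumAt [TopologicalSpace C] {h : C → E → ℂ} {x : E} (hh : UniformAnalyticAt h x)
    {ω : C → ℝ} (hω : Summable ω) (hω0 : ∀ c, 0 ≤ ω c) :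
    NormalSumAt ω (fun c y => (ω c : ℂ) * h c y) x := by
  obtain ⟨H, h1, h2⟩ := hh
  have hev : ∀ c, ‖(evalCLM ℝ c : (C →ᵇ ℂ) →L[ℝ] ℂ)‖ ≤ 1 := fun c =>
    ContinuousLinearMap.opNorm_le_bound _ zero_le_one fun f => by
      rw [one_mul]; exact f.norm_coe_le_norm c
  have hs : Summable fun c => ω c • (evalCLM ℝ c : (C →ᵇ ℂ) →L[ℝ] ℂ) := by
    refine Summable.of_norm_bounded hω fun c => ?_
    rw [norm_smul, Real.norm_of_nonneg (hω0 c)]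
    exact mul_le_of_le_one_right (hω0 c) (hev c)
  set Λ := ∑' c, ω c • (evalCLM ℝ c : (C →ᵇ ℂ) →L[ℝ] ℂ)
  have hterm : ∀ c, (fun y => (ω c : ℂ) * h c y) =ᶠ[𝓝 x]
      fun y => (ω c • (evalCLM ℝ c : (C →ᵇ ℂ) →L[ℝ] ℂ)) (H y) := fun c => by
    filter_upwards [h2] with y hy
    rw [← hy]
    simp
  have hsum : (fun y => ∑' c, (ω c : ℂ) * h c y) =ᶠ[𝓝 x] fun y => Λ (H y) := by
    filter_upwards [h2] with y hy
    have := (hs.hasSum.mapL ((ContinuousLinearMap.apply ℝ ℂ) (H y))).tsum_eq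
    refine Eq.trans (tsum_congr fun c => ?_) this
    rw [← hy]
    simp
  have hd := h1.differentiableAt
  refine ⟨⟨‖H x‖ + 1, ?_⟩, fun c => ?_, ?_, ?_⟩
  · filter_upwards [h2, h1.continuousAt.norm.eventually (gt_mem_nhds (lt_add_one ‖H x‖))]
      with y h3 h4 c
    rw [norm_mul, Complex.norm_real, Real.norm_of_nonneg (hω0 c), mul_comm, ← h3]
    exact mul_le_mul_of_nonneg_right (((H y).norm_coe_le_norm c).trans h4.le) (hω0 c)
  · exact ((ContinuousLinearMap.differentiableAt _).comp x hd).congr_of_eventuallyEq (hterm c)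
  · exact ((Λ.analyticAt _).fun_comp h1).congr hsum.symm
  · rw [hsum.fderiv_eq, show fderiv ℝ (fun y => Λ (H y)) x = Λ.comp (fderiv ℝ H x) from
      (Λ.hasFDerivAt.comp x hd.hasFDerivAt).fderiv]
    have : (fun c => fderiv ℝ (fun y => (ω c : ℂ) * h c y) x) =
        fun c => (ω c • (evalCLM ℝ c : (C →ᵇ ℂ) →L[ℝ] ℂ)).comp (fderiv ℝ H x) :=
      funext fun c => by
        rw [(hterm c).fderiv_eq]
        exact ((ω c • (evalCLM ℝ c : (C →ᵇ ℂ) →L[ℝ] ℂ)).hasFDerivAt.comp x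
          hd.hasFDerivAt).fderiv
    rw [this]
    exact hs.hasSum.mapL ((ContinuousLinearMap.compL ℝ E (C →ᵇ ℂ) ℂ).flip (fderiv ℝ H x))

end Sums

end

end PolarHarmonic


namespace PolarHarmonic

open Module

noncomputable section

/-! ## Definiteness and the majorant -/

section Majorant

variable {m : ℕ}

theorem eps_zero (R : Type) [CommRing R] : eps R (0 : Fin (m + 1)) = 1 := by simp [eps]

theorem eps_succ (R : Type) [CommRing R] (j : Fin m) : eps R j.succ = -1 := by simp [eps]

theorem qW_eq_sub (w : Fin (m + 1) → ℝ) : qW w = w 0 ^ 2 - ∑ j : Fin m, w j.succ ^ 2 := by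
  simp only [qW, Fin.sum_univ_succ, eps_zero, eps_succ, one_mul, neg_one_mul,
    Finset.sum_neg_distrib, sub_eq_add_neg]

/-- The reversed Cauchy-Schwarz inequality in a Lorentzian space. -/
theorem qW_neg_of_orthogonal {y w : Fin (m + 1) → ℝ} (hy : 0 < qW y)
    (h : ∑ j, eps ℝ j * w j * y j = 0) (hw : w ≠ 0) : qW w < 0 := by
  rw [qW_eq_sub] at *
  simp only [Fin.sum_univ_succ, eps_zero, eps_succ, one_mul, neg_mul,
    Finset.sum_neg_distrib] at h
  have hcs := Finset.sum_mul_sq_le_sq_mul_sq Finset.univ (fun j : Fin m => w j.succ)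
    (fun j : Fin m => y j.succ)
  set A := ∑ j : Fin m, w j.succ ^ 2 with hA
  set B := ∑ j : Fin m, y j.succ ^ 2 with hB
  set D := ∑ j : Fin m, w j.succ * y j.succ
  have hB0 : 0 ≤ B := Finset.sum_nonneg fun j _ => sq_nonneg _
  have hA0 : 0 ≤ A := Finset.sum_nonneg fun j _ => sq_nonneg _
  have hD : w 0 * y 0 = D := by linarith
  rw [← hD] at hcs
  have hy0 : 0 < y 0 ^ 2 := by linarith
  rcases hA0.eq_or_lt with hA1 | hA1
  · exfalso
    apply hw
    have h1 : ∀ j : Fin m, w j.succ = 0 := fun j => by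
      have := (Finset.sum_eq_zero_iff_of_nonneg (fun j _ => sq_nonneg _)).1 (hA.symm.trans hA1.symm)
        j (Finset.mem_univ j)
      simpa using this
    have h2 : w 0 = 0 := by
      rw [← hA1, zero_mul] at hcs
      have h3 : w 0 * y 0 = 0 := by nlinarith [sq_nonneg (w 0 * y 0)]
      rcases mul_eq_zero.1 h3 with h4 | h4
      · exact h4
      · rw [h4] at hy0; norm_num at hy0
    funext j
    exact Fin.cases h2 h1 j
  · have h1 : A * B < A * y 0 ^ 2 := by nlinarith
    have h2 : w 0 ^ 2 * y 0 ^ 2 < A * y 0 ^ 2 := by nlinarith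
    have := lt_of_mul_lt_mul_right h2 hy0.le
    linarith

/-- The complement of the positive plane is negative definite. In coordinates w = l_W - l_2 X, where
l_2 is the coefficient of e'', is orthogonal to Y, and q(l) = q(w) - l_2² q(Y), so the reversed
Cauchy-Schwarz inequality applies. -/
theorem qV_neg_of_pairPsi_eq_zero {Z : WC (m + 1)} (hZ : Z ∈ upperHalf (m + 1))
    {l : QSpace (m + 1) ℝ} (hl : l ≠ 0) (hP : pairPsi l Z = 0) : qV l < 0 := by
  set X : Fin (m + 1) → ℝ := fun j => (Z j).re with hX
  set Y := imW Z with hY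
  have h1 := congrArg Complex.re hP
  have h2 := congrArg Complex.im hP
  rw [pairPsi_eq] at h1 h2
  have hre : (bW Z Z).re = qW X - qW Y := by
    simp only [bW, qW, Complex.re_sum, ← eps_ofReal, ← Finset.sum_sub_distrib]
    refine Finset.sum_congr rfl fun j _ => ?_
    simp [hX, hY, imW]; ring
  have him : (bW Z Z).im = 2 * ∑ j, eps ℝ j * X j * Y j := by
    simp only [bW, Complex.im_sum, ← eps_ofReal, Finset.mul_sum]
    refine Finset.sum_congr rfl fun j _ => ?_
    simp [hX, hY, imW]; ring
  have hre' : (bW (wC l) Z).re = ∑ j, eps ℝ j * l.2.2 j * X j := by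
    simp only [bW, Complex.re_sum, ← eps_ofReal, wC]
    refine Finset.sum_congr rfl fun j _ => ?_
    simp [hX]
  have him' : (bW (wC l) Z).im = ∑ j, eps ℝ j * l.2.2 j * Y j := by
    simp only [bW, Complex.im_sum, ← eps_ofReal, wC]
    refine Finset.sum_congr rfl fun j _ => ?_
    simp [hY, imW]
  simp only [Complex.add_re, Complex.sub_re, Complex.ofReal_re, Complex.ofReal_im, hre,
    Complex.mul_re, Complex.re_ofNat, Complex.im_ofNat, zero_mul, sub_zero, hre',
    Complex.zero_re] at h1
  simp only [Complex.add_im, Complex.sub_im, Complex.ofReal_im, Complex.ofReal_re, him,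
    Complex.mul_im, Complex.re_ofNat, Complex.im_ofNat, zero_mul, add_zero, him',
    Complex.zero_im] at h2
  set w : Fin (m + 1) → ℝ := fun j => l.2.2 j - l.2.1 * X j with hw
  have horth : ∑ j, eps ℝ j * w j * Y j = 0 := by
    have : ∑ j, eps ℝ j * w j * Y j =
        ∑ j, eps ℝ j * l.2.2 j * Y j - l.2.1 * ∑ j, eps ℝ j * X j * Y j := by
      rw [Finset.mul_sum, ← Finset.sum_sub_distrib]
      exact Finset.sum_congr rfl fun j _ => by simp only [hw]; ring
    rw [this]; linarith
  have hqw : qW w = qW l.2.2 - 2 * l.2.1 * (∑ j, eps ℝ j * l.2.2 j * X j) + l.2.1 ^ 2 * qW X := by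
    simp only [qW, Finset.mul_sum, ← Finset.sum_sub_distrib, ← Finset.sum_add_distrib]
    exact Finset.sum_congr rfl fun j _ => by simp only [hw]; ring
  have hq : qV l = qW w - l.2.1 ^ 2 * qW Y := by
    rw [hqw, qV]; linear_combination l.2.1 * h1
  have hy := hZ.1
  rw [← hY] at hy
  rw [hq]
  by_cases hw0 : w = 0
  · have hw1 : qW w = 0 := by rw [hw0]; simp [qW]
    have hl1 : l.2.1 ≠ 0 := by
      intro h0
      apply hl
      have h5 : l.2.2 = 0 := by
        funext j
        have := congrFun hw0 j
        simpa [hw, h0] using this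
      have h4 : l.1 = 0 := by
        simpa [h0, h5] using h1
      exact Prod.ext h4 (Prod.ext h0 h5)
    have := sq_pos_of_ne_zero hl1
    rw [hw1]
    nlinarith
  · have := qW_neg_of_orthogonal hy horth hw0
    nlinarith [sq_nonneg l.2.1]

theorem pairPsi_sub_real {n : ℕ} (l l' : QSpace n ℝ) (Z : WC n) :
    pairPsi (l - l') Z = pairPsi l Z - pairPsi l' Z := by
  rw [pairPsi_eq, pairPsi_eq, pairPsi_eq]
  have : wC (l - l') = wC l - wC l' := by funext j; simp [wC]
  rw [this, bW_sub_left]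
  simp only [Prod.fst_sub, Prod.snd_sub]
  push_cast
  ring

theorem pairPsi_smul_real {n : ℕ} (t : ℝ) (l : QSpace n ℝ) (Z : WC n) :
    pairPsi (t • l) Z = t * pairPsi l Z := by
  rw [pairPsi_eq, pairPsi_eq]
  have : wC (t • l) = (t : ℂ) • wC l := by funext j; simp [wC]
  rw [this, bW_smul_left]
  simp only [Prod.smul_fst, Prod.smul_snd, smul_eq_mul]
  push_cast
  ring

theorem pairPsi_projPlus {n : ℕ} (l : QSpace n ℝ) {Z : WC n} (hZ : Z ∈ upperHalf n) :
    pairPsi (projPlus l Z) Z = pairPsi l Z := by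
  have hq := hZ.1.ne'
  obtain ⟨h1, h2, h3⟩ := bV_re_im_psi Z
  apply Complex.ext
  · rw [← pairPsi_re, ← pairPsi_re, projPlus, bV_add_left, bV_smul_left, bV_smul_left, h1, h2,
      bV_comm (imV (psi Z)), h3]
    field_simp
    ring
  · rw [← pairPsi_im, ← pairPsi_im, projPlus, bV_add_left, bV_smul_left, bV_smul_left, h1, h2, h3]
    field_simp
    ring

/-- The expression is q(l_{Z^+}) - q(l_{Z^-}), a sum of two nonnegative terms; if the first is zero
then `l` is orthogonal to the positive plane. -/
theorem majorant_pos {Z : WC (m + 1)} (hZ : Z ∈ upperHalf (m + 1)) {l : QSpace (m + 1) ℝ}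
    (hl : l ≠ 0) : 0 < 2 * qPlus l Z - qV l := by
  have hu : 0 ≤ qPlus l Z := by
    rw [qPlus_eq l hZ]
    have := hZ.1
    have := Complex.normSq_nonneg (pairPsi l Z)
    positivity
  have hm : qMinus l Z ≤ 0 := by
    have h0 : pairPsi (l - projPlus l Z) Z = 0 := by
      rw [pairPsi_sub_real, pairPsi_projPlus l hZ, sub_self]
    rw [qMinus]
    by_cases h : l - projPlus l Z = 0
    · rw [h]; simp [qV, qW]
    · exact (qV_neg_of_pairPsi_eq_zero hZ h h0).le
  rw [qMinus_eq l hZ] at hm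
  rcases hu.eq_or_lt with h | h
  · have hP : pairPsi l Z = 0 := by
      rw [qPlus_eq l hZ, eq_comm, div_eq_zero_iff] at h
      rcases h with h | h
      · exact Complex.normSq_eq_zero.1 h
      · exact absurd h (by have := hZ.1; positivity)
    have := qV_neg_of_pairPsi_eq_zero hZ hl hP
    linarith
  · linarith

theorem continuous_qV {n : ℕ} : Continuous (qV : QSpace n ℝ → ℝ) := by
  unfold qV qW
  fun_prop

theorem continuous_pairPsi_left {n : ℕ} (Z : WC n) :
    Continuous fun l : QSpace n ℝ => pairPsi l Z := by
  simp only [pairPsi_eq, bW, wC]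
  fun_prop

/-- A minimum on the unit sphere, extended by homogeneity of degree two. -/
theorem exists_majorant {Z : WC (m + 1)} (hZ : Z ∈ upperHalf (m + 1)) :
    ∃ c > 0, ∀ l : QSpace (m + 1) ℝ, c * ‖l‖ ^ 2 ≤ 2 * qPlus l Z - qV l := by
  have hcont : Continuous fun l : QSpace (m + 1) ℝ => 2 * qPlus l Z - qV l := by
    simp only [qPlus_eq _ hZ]
    exact (continuous_const.mul ((Complex.continuous_normSq.comp
      (continuous_pairPsi_left Z)).div_const _)).sub continuous_qV
  have hne : (Metric.sphere (0 : QSpace (m + 1) ℝ) 1).Nonempty := by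
    exact NormedSpace.sphere_nonempty.2 zero_le_one
  obtain ⟨l₀, hl₀, hmin⟩ := (isCompact_sphere (0 : QSpace (m + 1) ℝ) 1).exists_isMinOn hne
    hcont.continuousOn
  have hl₀' : l₀ ≠ 0 := by
    rintro rfl
    simp at hl₀
  refine ⟨_, majorant_pos hZ hl₀', fun l => ?_⟩
  rcases eq_or_ne l 0 with rfl | hl
  · have : pairPsi (0 : QSpace (m + 1) ℝ) Z = 0 := by
      have := pairPsi_sub_real (0 : QSpace (m + 1) ℝ) 0 Z
      simpa using this
    rw [qPlus_eq 0 hZ, this]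
    simp [qV, qW]
  · have hn : 0 < ‖l‖ := norm_pos_iff.2 hl
    have h1 := hmin (show ‖l‖⁻¹ • l ∈ Metric.sphere (0 : QSpace (m + 1) ℝ) 1 by
      rw [mem_sphere_zero_iff_norm, norm_smul, norm_inv, norm_norm, inv_mul_cancel₀ hn.ne'])
    have h2 : qPlus (‖l‖⁻¹ • l) Z = (‖l‖⁻¹) ^ 2 * qPlus l Z := by
      rw [qPlus_eq _ hZ, qPlus_eq _ hZ, pairPsi_smul_real, Complex.normSq_mul,
        Complex.normSq_ofReal]
      ring
    simp only [Set.mem_ofPred_eq, h2, qV_smul] at h1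
    have h3 : (2 * ((‖l‖⁻¹) ^ 2 * qPlus l Z) - (‖l‖⁻¹) ^ 2 * qV l) * ‖l‖ ^ 2 =
        2 * qPlus l Z - qV l := by
      field_simp
    rw [← h3]
    exact mul_le_mul_of_nonneg_right h1 (by positivity)

end Majorant

end

end PolarHarmonic


namespace PolarHarmonic

open Module

noncomputable section

/-! ## The families attached to vectors of fixed norm -/

section VectorFamilies

open Topology Filter

variable {m : ℕ}

theorem exists_le_of_cofinite {C : Type} {f : C → ℝ} (hf : ∀ c, 0 < f c) {δ : ℝ} (hδ : 0 < δ)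
    (h : ∀ᶠ c in cofinite, δ ≤ f c) : ∃ δ' > 0, ∀ c, δ' ≤ f c := by
  classical
  have hfin : {c | ¬ δ ≤ f c}.Finite := eventually_cofinite.1 h
  have key : ∀ s : Finset C, ∃ δ' > 0, ∀ c ∈ s, δ' ≤ f c := by
    intro s
    induction s using Finset.induction_on with
    | empty => exact ⟨1, one_pos, by simp⟩
    | insert a s ha ih =>
      obtain ⟨δ', h0, h1⟩ := ih
      refine ⟨min δ' (f a), lt_min h0 (hf a), fun c hc => ?_⟩
      rcases Finset.mem_insert.1 hc with rfl | hc
      · exact min_le_right _ _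
      · exact (min_le_left _ _).trans (h1 c hc)
  obtain ⟨δ', h0, h1⟩ := key hfin.toFinset
  refine ⟨min δ δ', lt_min hδ h0, fun c => ?_⟩
  by_cases hc : δ ≤ f c
  · exact (min_le_left _ _).trans hc
  · exact (min_le_right _ _).trans (h1 c (by simpa using hc))

/-- Vectors of fixed negative norm for which the series of `‖l‖^(-K)` converges. -/
structure IsSummableFamily {C : Type} (K : ℕ) (M : ℝ) (l : C → QSpace (m + 1) ℝ) : Prop where
  norm_eq : ∀ c, qV (l c) = M
  neg : M < 0
  summable : Summable fun c => (‖l c‖ ^ K)⁻¹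

namespace IsSummableFamily

variable {C : Type} {K : ℕ} {M : ℝ} {l : C → QSpace (m + 1) ℝ}

theorem norm_pos (h : IsSummableFamily K M l) (c : C) : 0 < ‖l c‖ := by
  rw [norm_pos_iff]
  intro h0
  have h1 := h.norm_eq c
  have h2 := h.neg
  rw [h0] at h1
  simp [qV, qW] at h1
  linarith

theorem tendsto_norm (h : IsSummableFamily K M l) :
    Tendsto (fun c => ‖l c‖) cofinite atTop := by
  refine tendsto_atTop.2 fun R => ?_
  have h1 := h.summable.tendsto_cofinite_zero
  set R' := max R 1
  have hR' : 0 < R' := lt_of_lt_of_le one_pos (le_max_right _ _)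
  have h2 := h1.eventually (gt_mem_nhds (by positivity : (0 : ℝ) < (R' ^ K)⁻¹))
  filter_upwards [h2] with c hc
  have h3 : R' ^ K < ‖l c‖ ^ K := by
    refine (inv_lt_inv₀ (by have := h.norm_pos c; positivity) (by positivity)).1 hc
  exact (le_max_left _ _).trans (lt_of_pow_lt_pow_left₀ K (norm_nonneg _) h3).le

/-- For large ‖l‖ the fixed norm M is at most half of the majorant bound a ‖l‖², whence |P|² ≥ a
q(Y) ‖l‖². The finitely many remaining vectors are covered by the assumption that no pairing
vanishes at Z. -/
theorem exists_lower_bound (h : IsSummableFamily K M l) {Z : WC (m + 1)}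
    (hZ : Z ∈ upperHalf (m + 1)) (hP : ∀ c, pairPsi (l c) Z ≠ 0) :
    ∃ δ > 0, ∀ c, δ ≤ ‖pairPsi (l c) Z / ‖l c‖‖ := by
  obtain ⟨a, ha, hmaj⟩ := exists_majorant hZ
  have hq := hZ.1
  refine exists_le_of_cofinite (fun c => ?_) (δ := Real.sqrt (qW (imW Z) * a))
    (Real.sqrt_pos.2 (by positivity)) ?_
  · have h1 : (‖l c‖ : ℂ) ≠ 0 := by exact_mod_cast (h.norm_pos c).ne'
    exact norm_pos_iff.2 (div_ne_zero (hP c) h1)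
  · have h1 := h.tendsto_norm.eventually_ge_atTop (Real.sqrt (2 * |M| / a))
    filter_upwards [h1] with c hc
    have hn := h.norm_pos c
    have h2 : 2 * |M| / a ≤ ‖l c‖ ^ 2 := by
      rw [← Real.sq_sqrt (by positivity : 0 ≤ 2 * |M| / a)]
      exact pow_le_pow_left₀ (Real.sqrt_nonneg _) hc 2
    have h3 : 2 * |M| ≤ a * ‖l c‖ ^ 2 := by
      rw [div_le_iff₀ ha] at h2; linarith
    have h4 := hmaj (l c)
    rw [h.norm_eq, qPlus_eq _ hZ, Complex.normSq_eq_norm_sq] at h4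
    have h5 := neg_abs_le M
    have h6 : a * ‖l c‖ ^ 2 / 2 ≤ 2 * (‖pairPsi (l c) Z‖ ^ 2 / (4 * qW (imW Z))) := by linarith
    have h7 : 2 * (‖pairPsi (l c) Z‖ ^ 2 / (4 * qW (imW Z))) * (2 * qW (imW Z)) =
        ‖pairPsi (l c) Z‖ ^ 2 := by field_simp; ring
    have h8 : a * ‖l c‖ ^ 2 / 2 * (2 * qW (imW Z)) ≤ ‖pairPsi (l c) Z‖ ^ 2 := by
      rw [← h7]
      exact mul_le_mul_of_nonneg_right h6 (by positivity)
    rw [norm_div, Complex.norm_real, norm_norm, le_div_iff₀ hn]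
    refine (pow_le_pow_iff_left₀ (by positivity) (norm_nonneg _) two_ne_zero).1 ?_
    rw [mul_pow, Real.sq_sqrt (by positivity)]
    linarith

theorem norm_coord_le (v : QSpace (m + 1) ℝ) :
    |v.1| ≤ ‖v‖ ∧ |v.2.1| ≤ ‖v‖ ∧ ∀ j, |v.2.2 j| ≤ ‖v‖ := by
  refine ⟨norm_fst_le v, (norm_fst_le v.2).trans (norm_snd_le v), fun j => ?_⟩
  exact (norm_le_pi_norm v.2.2 j).trans ((norm_snd_le v.2).trans (norm_snd_le v))

theorem norm_div_le_one {r t : ℝ} (h : |t| ≤ r) : ‖((t / r : ℝ) : ℂ)‖ ≤ 1 := by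
  rw [Complex.norm_real, Real.norm_eq_abs, abs_div]
  have h0 : 0 ≤ r := (abs_nonneg t).trans h
  rw [abs_of_nonneg h0]
  exact div_le_one_of_le₀ h h0

theorem analyticAt_coord (Z : WC (m + 1)) (j : Fin (m + 1)) :
    AnalyticAt ℝ (fun Z : WC (m + 1) => Z j) Z :=
  (ContinuousLinearMap.proj (R := ℝ) (φ := fun _ : Fin (m + 1) => ℂ) j).analyticAt Z

theorem analyticAt_conj_coord (Z : WC (m + 1)) (j : Fin (m + 1)) :
    AnalyticAt ℝ (fun Z : WC (m + 1) => (starRingEnd ℂ) (Z j)) Z :=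
  ((Complex.conjCLE : ℂ →L[ℝ] ℂ).comp
    (ContinuousLinearMap.proj (R := ℝ) (φ := fun _ : Fin (m + 1) => ℂ) j)).analyticAt Z

theorem analyticAt_im_coord (Z : WC (m + 1)) (j : Fin (m + 1)) :
    AnalyticAt ℝ (fun Z : WC (m + 1) => ((Z j).im : ℂ)) Z :=
  ((Complex.ofRealCLM.comp Complex.imCLM).comp
    (ContinuousLinearMap.proj (R := ℝ) (φ := fun _ : Fin (m + 1) => ℂ) j)).analyticAt Z

theorem analyticAt_qC (Z : WC (m + 1)) : AnalyticAt ℝ (qC : WC (m + 1) → ℂ) Z := by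
  have : (qC : WC (m + 1) → ℂ) = fun Z => ∑ j, eps ℂ j * ((Z j).im : ℂ) ^ 2 := by
    funext Z
    rw [qC_eq]
    exact Finset.sum_congr rfl fun j _ => by simp only [yC]; ring
  rw [this]
  exact Finset.univ.analyticAt_fun_sum fun j _ =>
    analyticAt_const.mul ((analyticAt_im_coord Z j).pow 2)

variable [TopologicalSpace C] [DiscreteTopology C]

/-- The coordinates of l/‖l‖ are bounded by 1, so the family is a finite combination of bounded
constant families with fixed analytic coefficients. The map `f` is the identity or conjugation in
the applications. -/
theorem uniformAnalyticAt_pairPsi (l : C → QSpace (m + 1) ℝ) {f : WC (m + 1) → WC (m + 1)}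
    {Z : WC (m + 1)} (hf : ∀ j, AnalyticAt ℝ (fun Z => f Z j) Z) :
    UniformAnalyticAt (fun c Z => pairPsi (l c) (f Z) / ‖l c‖) Z := by
  have h1 : UniformAnalyticAt (fun c (_ : WC (m + 1)) => (((l c).1 / ‖l c‖ : ℝ) : ℂ)) Z :=
    .of_bounded _ 1 fun c => norm_div_le_one (norm_coord_le (l c)).1
  have h2 : UniformAnalyticAt (fun c (_ : WC (m + 1)) => (((l c).2.1 / ‖l c‖ : ℝ) : ℂ)) Z :=
    .of_bounded _ 1 fun c => norm_div_le_one (norm_coord_le (l c)).2.1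
  have h3 : ∀ j, UniformAnalyticAt
      (fun c (_ : WC (m + 1)) => (((l c).2.2 j / ‖l c‖ : ℝ) : ℂ)) Z :=
    fun j => .of_bounded _ 1 fun c => norm_div_le_one ((norm_coord_le (l c)).2.2 j)
  have h4 : AnalyticAt ℝ (fun Z => -bW (f Z) (f Z)) Z :=
    (Finset.univ.analyticAt_fun_sum fun j _ => (analyticAt_const.mul (hf j)).mul (hf j)).neg
  have h5 := (h1.add (h2.mul (.of_analyticAt h4))).add
    (.sum Finset.univ fun j _ => (h3 j).mul (.of_analyticAt
      ((analyticAt_const (v := 2 * eps ℂ j)).fun_mul (hf j))))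
  refine h5.congr (Eventually.of_forall fun W c => ?_)
  rw [pairPsi_eq]
  simp only [bW, wC, Finset.mul_sum, add_div, sub_div, Finset.sum_div]
  push_cast
  simp only [Finset.mul_sum, sub_eq_add_neg, ← Finset.sum_neg_distrib]
  congr 1
  · congr 1
    exact Finset.sum_congr rfl fun j _ => by ring
  · exact Finset.sum_congr rfl fun j _ => by ring

theorem uniformAnalyticAt_thetaV (l : C → QSpace (m + 1) ℝ) {Z : WC (m + 1)}
    (hZ : Z ∈ upperHalf (m + 1)) (k : Fin (m + 1)) :
    UniformAnalyticAt (fun c Z => thetaV (l c) Z k / ‖l c‖) Z := by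
  have hqi : AnalyticAt ℝ (fun Z : WC (m + 1) => (qC Z)⁻¹) Z :=
    (analyticAt_qC Z).fun_inv (qC_ne_zero hZ)
  have h1 := uniformAnalyticAt_pairPsi l (f := conjW) (Z := Z) (analyticAt_conj_coord Z)
  have h2 : UniformAnalyticAt (fun c (_ : WC (m + 1)) => (((l c).2.1 / ‖l c‖ : ℝ) : ℂ)) Z :=
    .of_bounded _ 1 fun c => norm_div_le_one (norm_coord_le (l c)).2.1
  have h3 : UniformAnalyticAt (fun c (_ : WC (m + 1)) => (((l c).2.2 k / ‖l c‖ : ℝ) : ℂ)) Z :=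
    .of_bounded _ 1 fun c => norm_div_le_one ((norm_coord_le (l c)).2.2 k)
  have h4 := ((h3.mul (.of_analyticAt ((analyticAt_const (v := 2 * eps ℂ k)).fun_mul hqi))).add
    (h2.mul (.of_analyticAt (((analyticAt_const (v := -2 * eps ℂ k)).fun_mul
      (analyticAt_conj_coord Z k)).fun_mul hqi)))).add
    (h1.mul (.of_analyticAt (((analyticAt_const (v := -Complex.I * eps ℂ k)).fun_mul
      (analyticAt_im_coord Z k)).fun_mul (hqi.fun_pow 2))))
  refine h4.congr (Eventually.of_forall fun W c => ?_)
  simp only [thetaV]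
  push_cast
  ring

theorem analyticAt_profile (κ : ℤ) {s b : ℝ} (hb : 0 < b) {z : ℂ} (hz : z.re < 1) :
    AnalyticAt ℂ (profile κ s b) z := by
  have ho : IsOpen {z : ℂ | z.re < 1} := isOpen_lt Complex.continuous_re continuous_const
  have hd : DifferentiableOn ℂ (profile κ s b) {z : ℂ | z.re < 1} := fun w hw =>
    let ⟨_, h, _⟩ := hasDerivAt_profile κ (s := s) hb hw
    h.differentiableAt.differentiableWithinAt
  exact hd.analyticAt (ho.mem_nhds hz)

theorem uniformAnalyticAt_inv_pairPsi (h : IsSummableFamily K M l) {Z : WC (m + 1)}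
    (hZ : Z ∈ upperHalf (m + 1)) (hP : ∀ c, pairPsi (l c) Z ≠ 0) :
    UniformAnalyticAt (fun c Z => (pairPsi (l c) Z / ‖l c‖)⁻¹) Z ∧
      UniformAnalyticAt (fun c Z => (pairPsi (l c) (conjW Z) / ‖l c‖)⁻¹) Z ∧
        ∀ᶠ Z in 𝓝 Z, ∀ c, pairPsi (l c) Z ≠ 0 := by
  obtain ⟨δ, hδ, hb⟩ := h.exists_lower_bound hZ hP
  obtain ⟨h1, h2⟩ := (uniformAnalyticAt_pairPsi l (f := id) (analyticAt_coord Z)).inv_aux hδ hb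
  have hb' : ∀ c, δ ≤ ‖pairPsi (l c) (conjW Z) / ‖l c‖‖ := fun c => by
    refine (hb c).trans_eq ?_
    rw [norm_div, norm_div, pairPsi_conjW, RCLike.norm_conj]
  obtain ⟨h3, -⟩ := (uniformAnalyticAt_pairPsi l (f := conjW)
    (analyticAt_conj_coord Z)).inv_aux hδ hb'
  refine ⟨h1, h3, ?_⟩
  filter_upwards [h2] with W hW c hc
  apply hW c
  simp only [id, hc, zero_div]

/-- As the norm of the vectors is fixed, the argument 4 M q(Y)/(P conj P) is of order ‖l‖^(-2). It
tends to 0 along the family, so `UniformAnalyticAt.comp` applies. -/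
theorem uniformAnalyticAt_profile (h : IsSummableFamily K M l) (κ : ℤ) {s b : ℝ} (hb : 0 < b)
    {Z : WC (m + 1)} (hZ : Z ∈ upperHalf (m + 1)) (hP : ∀ c, pairPsi (l c) Z ≠ 0) :
    UniformAnalyticAt (fun c Z => profile κ s b (hyperArg (l c) Z)) Z := by
  obtain ⟨h1, h2, -⟩ := h.uniformAnalyticAt_inv_pairPsi hZ hP
  obtain ⟨δ, hδ, hlow⟩ := h.exists_lower_bound hZ hP
  have ht : Tendsto (fun c => (‖l c‖ ^ 2)⁻¹) cofinite (𝓝 0) :=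
    ((tendsto_pow_atTop two_ne_zero).comp h.tendsto_norm).inv_tendsto_atTop
  obtain ⟨B, hB⟩ := ht.bddAbove_range_of_cofinite
  have h3 : UniformAnalyticAt (fun c (_ : WC (m + 1)) => (((‖l c‖ ^ 2)⁻¹ : ℝ) : ℂ)) Z :=
    .of_bounded _ B fun c => by
      rw [Complex.norm_real, Real.norm_of_nonneg (by positivity)]
      exact hB ⟨c, rfl⟩
  have heq : ∀ c, ∀ W : WC (m + 1), (((‖l c‖ ^ 2)⁻¹ : ℝ) : ℂ) *
      ((pairPsi (l c) W / ‖l c‖)⁻¹ * (pairPsi (l c) (conjW W) / ‖l c‖)⁻¹) *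
        (4 * ((M : ℝ) : ℂ) * qC W) = hyperArg (l c) W := by
    intro c W
    have hn : (‖l c‖ : ℂ) ≠ 0 := by exact_mod_cast (h.norm_pos c).ne'
    rw [hyperArg, h.norm_eq, inv_div, inv_div]
    push_cast
    field_simp
  have h4 : UniformAnalyticAt (fun c Z => hyperArg (l c) Z) Z :=
    ((h3.mul (h1.mul h2)).mul (.of_analyticAt
      ((analyticAt_const (v := 4 * ((M : ℝ) : ℂ))).fun_mul (analyticAt_qC Z)))).congr
      (Eventually.of_forall fun W c => heq c W)
  refine h4.comp (analyticAt_profile κ hb (by simp)) (fun c => analyticAt_profile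
    κ hb (hyperArg_re_lt hZ (by rw [h.norm_eq]; exact h.neg))) ?_
  rw [tendsto_zero_iff_norm_tendsto_zero]
  have ht' := ht.mul_const (δ⁻¹ * δ⁻¹ * ‖4 * ((M : ℝ) : ℂ) * qC Z‖)
  rw [zero_mul] at ht'
  refine squeeze_zero (fun c => norm_nonneg _) (fun c => ?_) ht'
  rw [← heq c Z, norm_mul, norm_mul, norm_mul, norm_inv, norm_inv, Complex.norm_real,
    Real.norm_of_nonneg (by positivity), mul_assoc]
  refine mul_le_mul_of_nonneg_left (mul_le_mul_of_nonneg_right ?_ (norm_nonneg _)) (by positivity)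
  have hlow' : δ ≤ ‖pairPsi (l c) (conjW Z) / ‖l c‖‖ := by
    refine (hlow c).trans_eq ?_
    rw [norm_div, norm_div, pairPsi_conjW, RCLike.norm_conj]
  exact mul_le_mul (inv_anti₀ hδ (hlow c)) (inv_anti₀ hδ hlow') (by positivity) (by positivity)

theorem normalSumAt_inv_pow (h : IsSummableFamily K M l) {Z : WC (m + 1)}
    (hZ : Z ∈ upperHalf (m + 1)) (hP : ∀ c, pairPsi (l c) Z ≠ 0) :
    NormalSumAt (fun c => (‖l c‖ ^ K)⁻¹) (fun c Z => pairPsi (l c) Z ^ (-(K : ℤ))) Z := by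
  obtain ⟨h1, -, -⟩ := h.uniformAnalyticAt_inv_pairPsi hZ hP
  refine ((h1.pow K).normalSumAt h.summable fun c => by positivity).congr
    (Eventually.of_forall fun W c => ?_)
  have hn : (‖l c‖ : ℂ) ≠ 0 := by exact_mod_cast (h.norm_pos c).ne'
  rw [inv_div, div_pow, zpow_neg, zpow_natCast]
  push_cast
  field_simp

/-- In ‖l‖ the factors P^(-K), f⁻¹ and θ have orders -K, -1 and 1, and the profile is bounded. After
removing ‖l‖^(-K) the family is uniformly analytic. -/
theorem normalSumAt_betaV (h : IsSummableFamily K M l) (hK : m + 1 < K) {Z : WC (m + 1)}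
    (hZ : Z ∈ upperHalf (m + 1)) (hP : ∀ c, pairPsi (l c) Z ≠ 0) :
    NormalSumAt (fun c => (‖l c‖ ^ K)⁻¹) (fun c Z => betaV K (l c) Z) Z := by
  obtain ⟨h1, h2, -⟩ := h.uniformAnalyticAt_inv_pairPsi hZ hP
  have hb : (0 : ℝ) < ((K : ℤ) : ℝ) - ((m + 1 : ℕ) : ℝ) / 2 := by
    have h3 : ((m + 1 : ℕ) : ℝ) < K := by exact_mod_cast hK
    have : (0 : ℝ) ≤ ((m + 1 : ℕ) : ℝ) := Nat.cast_nonneg _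
    push_cast at *
    linarith
  have h3 := h.uniformAnalyticAt_profile (K : ℤ) (s := ((m + 1 : ℕ) : ℝ) / 2) hb hZ hP
  refine NormalSumAt.pi h.summable fun k => ?_
  have h4 := ((((h1.pow K).mul h2).mul (.of_analyticAt
    ((analyticAt_const (v := (4 : ℂ) ^ (K : ℤ))).fun_mul (analyticAt_qC Z)))).mul h3).mul
      (uniformAnalyticAt_thetaV l hZ k)
  refine (h4.normalSumAt h.summable fun c => by positivity).congr
    (Eventually.of_forall fun W c => ?_)
  have hn : (‖l c‖ : ℂ) ≠ 0 := by exact_mod_cast (h.norm_pos c).ne'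
  rw [betaV, Pi.smul_apply, ampl, inv_div, inv_div, inv_div, div_pow, zpow_neg, zpow_natCast,
    zpow_natCast, smul_eq_mul]
  push_cast
  field_simp

end IsSummableFamily

end VectorFamilies

end

end PolarHarmonic


namespace PolarHarmonic

open Module

noncomputable section

/-! ## Counting lattice vectors of fixed norm -/

section Divisors

theorem succ_pow_four_le (a : ℕ) : (a + 1) ^ 4 ≤ 256 * 2 ^ a := by
  have h1 : a + 1 ≤ 4 * 2 ^ (a / 4) := by
    have : a / 4 + 1 ≤ 2 ^ (a / 4) := Nat.lt_two_pow_self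
    omega
  calc (a + 1) ^ 4 ≤ (4 * 2 ^ (a / 4)) ^ 4 := Nat.pow_le_pow_left h1 4
    _ = 256 * 2 ^ (a / 4 * 4) := by rw [mul_pow, ← pow_mul]; norm_num
    _ ≤ 256 * 2 ^ a :=
      Nat.mul_le_mul_left _ (Nat.pow_le_pow_right two_pos (Nat.div_mul_le_self a 4))

/-- For p ≥ 16 one has (a + 1)⁴ ≤ 16^a ≤ p^a, so only the fewer than 16 smaller primes cost a
factor, each at most 256. The fourth power makes the divisor function of a quadratic expression in w
grow at most like ‖w‖^(1/2). -/
theorem exists_card_divisors_pow_four_le :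
    ∃ C : ℕ, ∀ k : ℕ, k ≠ 0 → k.divisors.card ^ 4 ≤ C * k := by
  refine ⟨256 ^ 16, fun k hk => ?_⟩
  have h1 : ∀ p ∈ k.primeFactors, (k.factorization p + 1) ^ 4 ≤
      (if p < 16 then 256 else 1) * p ^ k.factorization p := by
    intro p hp
    have hp2 := (Nat.prime_of_mem_primeFactors hp).two_le
    split_ifs with h
    · exact (succ_pow_four_le _).trans (Nat.mul_le_mul_left _ (Nat.pow_le_pow_left hp2 _))
    · rw [one_mul]
      calc (k.factorization p + 1) ^ 4 ≤ (2 ^ k.factorization p) ^ 4 :=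
            Nat.pow_le_pow_left Nat.lt_two_pow_self 4
        _ = 16 ^ k.factorization p := by rw [← pow_mul, mul_comm, pow_mul]; norm_num
        _ ≤ _ := Nat.pow_le_pow_left (by omega) _
  have h2 : ∏ p ∈ k.primeFactors, p ^ k.factorization p = k := Nat.prod_factorization_pow_eq_self hk
  have h3 : ∏ p ∈ k.primeFactors, (if p < 16 then 256 else 1) ≤ 256 ^ 16 := by
    rw [← Finset.prod_filter, Finset.prod_const]
    refine Nat.pow_le_pow_right (by norm_num) ?_
    have : k.primeFactors.filter (· < 16) ⊆ Finset.range 16 := fun p hp =>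
      Finset.mem_range.2 (Finset.mem_filter.1 hp).2
    simpa using Finset.card_le_card this
  rw [Nat.card_divisors hk, ← Finset.prod_pow]
  refine (Finset.prod_le_prod' h1).trans ?_
  rw [Finset.prod_mul_distrib, h2]
  exact Nat.mul_le_mul_right _ h3

theorem card_factor_pairs_le {k : ℤ} (hk : k ≠ 0) (s : Finset (ℤ × ℤ))
    (hs : ∀ x ∈ s, x.1 * x.2 = k) : s.card ≤ 2 * k.natAbs.divisors.card := by
  classical
  have h1 : s.card = (s.image Prod.fst).card := by
    rw [Finset.card_image_of_injOn]
    intro x hx y hy hxy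
    have hx' := hs x hx
    rw [← hs y hy, ← hxy] at hx'
    refine Prod.ext hxy (mul_left_cancel₀ ?_ hx')
    rintro h0
    have := hs x hx
    rw [h0, zero_mul] at this
    exact hk this.symm
  have h2 : s.image Prod.fst ⊆ k.natAbs.divisors.image (fun d : ℕ => (d : ℤ)) ∪
      k.natAbs.divisors.image (fun d : ℕ => -(d : ℤ)) := by
    intro a ha
    obtain ⟨x, hx, rfl⟩ := Finset.mem_image.1 ha
    have hd : x.1.natAbs ∈ k.natAbs.divisors := by
      rw [Nat.mem_divisors]
      exact ⟨Int.natAbs_dvd_natAbs.2 ⟨x.2, (hs x hx).symm⟩, Int.natAbs_ne_zero.2 hk⟩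
    rw [Finset.mem_union]
    rcases Int.natAbs_eq x.1 with h | h
    · left; exact Finset.mem_image.2 ⟨_, hd, h.symm⟩
    · right; exact Finset.mem_image.2 ⟨_, hd, h.symm⟩
  rw [h1, two_mul]
  refine (Finset.card_le_card h2).trans ((Finset.card_union_le _ _).trans ?_)
  exact add_le_add Finset.card_image_le Finset.card_image_le

theorem summable_of_card_fiber {S W : Type*} {f : S → ℝ} (hf : ∀ x, 0 ≤ f x) (p : S → Prop)
    [DecidablePred p] (π : S → W) (N B : W → ℝ) (hB : ∀ w, 0 ≤ B w) (hN0 : ∀ w, 0 ≤ N w)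
    (hNB : Summable fun w => N w * B w) (hfB : ∀ x, p x → f x ≤ B (π x))
    (hN : ∀ w, ∀ s : Finset S, (∀ x ∈ s, p x ∧ π x = w) → (s.card : ℝ) ≤ N w) :
    Summable fun x => if p x then f x else 0 := by
  classical
  refine summable_of_sum_le (c := ∑' w, N w * B w)
    (fun x => by dsimp only; split_ifs; exacts [hf x, le_rfl]) fun s => ?_
  rw [← Finset.sum_filter, ← Finset.sum_fiberwise_of_maps_to
    (t := (s.filter p).image π) (g := π) fun x hx => Finset.mem_image_of_mem π hx]
  refine (Finset.sum_le_sum fun w _ => ?_).trans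
    (hNB.sum_le_tsum _ fun w _ => mul_nonneg (hN0 w) (hB w))
  refine (Finset.sum_le_card_nsmul _ _ (B w) fun x hx => ?_).trans ?_
  · obtain ⟨h1, rfl⟩ := Finset.mem_filter.1 hx
    exact hfB x (Finset.mem_filter.1 h1).2
  · rw [nsmul_eq_mul]
    refine mul_le_mul_of_nonneg_right (hN w _ fun x hx => ?_) (hB w)
    obtain ⟨h1, h2⟩ := Finset.mem_filter.1 hx
    exact ⟨(Finset.mem_filter.1 h1).2, h2⟩

/-- The rank of a discrete subgroup is the dimension of its real span, hence at most that of `F`.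
The shift by 1 keeps the bound meaningful at w = 0. -/
theorem summable_one_add_norm_rpow {V : Type*} [NormedAddCommGroup V] [NormedSpace ℝ V]
    [FiniteDimensional ℝ V] (Λ : Submodule ℤ V) [DiscreteTopology Λ] (F : Submodule ℝ V)
    (hΛ : ∀ x ∈ Λ, x ∈ F) {r : ℝ} (hr : (finrank ℝ F : ℝ) < r) :
    Summable fun w : Λ => (1 + ‖(w : V)‖) ^ (-r) := by
  have h0 : Submodule.span ℤ (Λ : Set V) = Λ := Submodule.span_eq Λ
  have h1 : finrank ℤ Λ ≤ finrank ℝ F := by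
    have hd : DiscreteTopology (Submodule.span ℤ (Λ : Set V)) := by rw [h0]; infer_instance
    have h2 := Real.finrank_eq_int_finrank_of_discrete hd
    rw [Set.finrank, Set.finrank, h0] at h2
    rw [← h2]
    exact Submodule.finrank_mono (Submodule.span_le.2 hΛ)
  have h2 : Summable fun w : Λ => ‖w‖ ^ (-r) := by
    refine ZLattice.summable_norm_rpow Λ (-r) ?_
    have : ((finrank ℤ Λ : ℕ) : ℝ) ≤ finrank ℝ F := by exact_mod_cast h1
    linarith
  have hr0 : 0 < r := lt_of_le_of_lt (Nat.cast_nonneg _) hr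
  refine Summable.of_norm_bounded_eventually h2 ?_
  have hfin : ({0} : Set Λ).Finite := Set.finite_singleton 0
  filter_upwards [hfin.compl_mem_cofinite] with w hw
  have hw0 : 0 < ‖w‖ := norm_pos_iff.2 hw
  rw [Real.norm_of_nonneg (by positivity), Real.rpow_neg (by positivity), Real.rpow_neg hw0.le]
  refine inv_anti₀ (by positivity) (Real.rpow_le_rpow hw0.le ?_ hr0.le)
  change ‖(w : V)‖ ≤ 1 + ‖(w : V)‖
  linarith

end Divisors

end

end PolarHarmonic


namespace PolarHarmonic

open Module

noncomputable section

/-! ### Fibring the vectors of fixed norm over the complement of a hyperbolic pair -/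

section Counting

variable {n : ℕ}

/-- The linear functional `x ↦ (x, v)`. -/
def bLin (v : QSpace n ℝ) : QSpace n ℝ →ₗ[ℝ] ℝ where
  toFun x := bV x v
  map_add' x y := bV_add_left x y v
  map_smul' c x := bV_smul_left c x v

theorem bLin_apply (v x : QSpace n ℝ) : bLin v x = bV x v := rfl

theorem eq_zero_of_bV {x : QSpace n ℝ} (h : ∀ y, bV x y = 0) : x = 0 := by
  have h1 := h (0, 1, 0)
  have h2 := h (1, 0, 0)
  simp [bV] at h1 h2
  refine Prod.ext h1 (Prod.ext h2 (funext fun j => ?_))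
  have h3 := h (0, 0, Pi.single j 1)
  have he : eps ℝ j ≠ 0 := by unfold eps; split_ifs <;> norm_num
  simpa [bV, Pi.single_apply, he] using h3

theorem finrank_ker_inf {V : Type*} [AddCommGroup V] [Module ℝ V] [FiniteDimensional ℝ V]
    (f g : V →ₗ[ℝ] ℝ) (a b : V) (hfa : f a ≠ 0) (hga : g a = 0) (hgb : g b ≠ 0) (hfb : f b = 0) :
    finrank ℝ (LinearMap.ker f ⊓ LinearMap.ker g : Submodule ℝ V) + 2 = finrank ℝ V := by
  have h1 : LinearMap.range (f.prod g) = ⊤ := by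
    rw [LinearMap.range_eq_top]
    rintro ⟨s, t⟩
    refine ⟨(s / f a) • a + (t / g b) • b, ?_⟩
    simp only [map_add, map_smul, LinearMap.prod_apply, Function.prod, hga, hfb, smul_eq_mul, Prod.smul_mk,
      Prod.mk_add_mk, mul_zero, add_zero, zero_add]
    rw [div_mul_cancel₀ _ hfa, div_mul_cancel₀ _ hgb]
  have h2 := LinearMap.finrank_range_add_finrank_ker (f.prod g)
  rw [h1, finrank_top, LinearMap.ker_prod] at h2
  have h3 : finrank ℝ (ℝ × ℝ) = 2 := by simp
  omega

theorem finrank_QSpace : finrank ℝ (QSpace n ℝ) = n + 2 := by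
  simp [QSpace]; omega

theorem abs_qV_le (x : QSpace n ℝ) : |qV x| ≤ (1 + n) * ‖x‖ ^ 2 := by
  have h0 := norm_nonneg x
  have h1 : |x.1| ≤ ‖x‖ := norm_fst_le x
  have h2 : |x.2.1| ≤ ‖x‖ := (norm_fst_le x.2).trans (norm_snd_le x)
  have h3 : ∀ j, |x.2.2 j| ≤ ‖x‖ := fun j =>
    (norm_le_pi_norm x.2.2 j).trans ((norm_snd_le x.2).trans (norm_snd_le x))
  have h4 : |qW x.2.2| ≤ n * ‖x‖ ^ 2 := by
    refine (Finset.abs_sum_le_sum_abs _ _).trans ?_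
    refine (Finset.sum_le_card_nsmul _ _ (‖x‖ ^ 2) fun j _ => ?_).trans (by simp)
    have he : |eps ℝ j| = 1 := by unfold eps; split_ifs <;> simp
    rw [abs_mul, he, one_mul, abs_pow]
    exact pow_le_pow_left₀ (abs_nonneg _) (h3 j) 2
  have h5 : |x.1 * x.2.1| ≤ ‖x‖ ^ 2 := by
    rw [abs_mul, sq]; exact mul_le_mul h1 h2 (abs_nonneg _) h0
  rw [qV]
  refine (abs_add_le _ _).trans ?_
  linarith

/-- A nonzero value of the quadratic form keeps ‖x‖ away from 0, so the constant 1 can be absorbed.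
-/
theorem exists_one_add_norm_le {M : ℝ} (hM : M ≠ 0) (T : QSpace n ℝ →ₗ[ℝ] QSpace n ℝ) :
    ∃ A > 0, ∀ x, qV x = M → 1 + ‖T x‖ ≤ A * ‖x‖ := by
  set δ : ℝ := Real.sqrt (|M| / (1 + n)) with hδ
  have hM' : 0 < |M| := abs_pos.2 hM
  have hδ0 : 0 < δ := Real.sqrt_pos.2 (by positivity)
  set T' := LinearMap.toContinuousLinearMap T
  refine ⟨δ⁻¹ + ‖T'‖, by positivity, fun x hx => ?_⟩
  have h1 : δ ≤ ‖x‖ := by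
    rw [hδ]
    refine Real.sqrt_le_iff.2 ⟨norm_nonneg _, ?_⟩
    rw [div_le_iff₀ (by positivity), mul_comm, ← hx]
    exact abs_qV_le x
  have h2 : 1 ≤ δ⁻¹ * ‖x‖ := by
    rw [← div_eq_inv_mul, one_le_div hδ0]; exact h1
  have h3 : ‖T x‖ ≤ ‖T'‖ * ‖x‖ := T'.le_opNorm x
  rw [add_mul]
  exact add_le_add h2 h3

/-- Integrality of the bilinear form on a submodule. -/
def IsIntegralOn (L : Submodule ℤ (QSpace n ℝ)) : Prop :=
  ∀ x ∈ L, ∀ y ∈ L, ∃ k : ℤ, bV x y = k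

theorem zsmul_mem_real {L : Submodule ℤ (QSpace n ℝ)} {x : QSpace n ℝ} (hx : x ∈ L) {t : ℝ}
    (ht : ∃ k : ℤ, t = k) : t • x ∈ L := by
  obtain ⟨k, rfl⟩ := ht
  have : ((k : ℤ) : ℝ) • x = k • x := Int.cast_smul_eq_zsmul ℝ k x
  rw [this]
  exact L.smul_mem k hx

/-- The image of a discrete module under a linear map preserving it. -/
theorem summable_one_add_norm_map (L : Submodule ℤ (QSpace n ℝ)) (hd : DiscreteTopology L)
    (T : QSpace n ℝ →ₗ[ℝ] QSpace n ℝ) (hT : ∀ x ∈ L, T x ∈ L) (F : Submodule ℝ (QSpace n ℝ))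
    (hF : ∀ x, T x ∈ F) {r : ℝ} (hr : (finrank ℝ F : ℝ) < r) :
    Summable fun w : L.map (T.restrictScalars ℤ) => (1 + ‖(w : QSpace n ℝ)‖) ^ (-r) := by
  have hle : (L.map (T.restrictScalars ℤ) : Set (QSpace n ℝ)) ⊆ L := by
    rintro _ ⟨x, hx, rfl⟩
    exact hT x hx
  have : DiscreteTopology (L.map (T.restrictScalars ℤ)) := DiscreteTopology.of_subset hd hle
  refine summable_one_add_norm_rpow _ F ?_ hr
  rintro _ ⟨x, _, rfl⟩
  exact hF x

theorem inv_norm_pow_le {A : ℝ} {x w : QSpace n ℝ} (h : 1 + ‖w‖ ≤ A * ‖x‖) (K : ℕ) :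
    (‖x‖ ^ K)⁻¹ ≤ A ^ K * (1 + ‖w‖) ^ (-(K : ℝ)) := by
  have h0 : 0 < 1 + ‖w‖ := by positivity
  have hx : 0 < ‖x‖ := by
    by_contra hx
    have : ‖x‖ = 0 := le_antisymm (not_lt.1 hx) (norm_nonneg x)
    rw [this, mul_zero] at h
    linarith
  rw [Real.rpow_neg h0.le, Real.rpow_natCast, ← div_eq_mul_inv, ← one_div,
    div_le_div_iff₀ (by positivity) (by positivity), one_mul, ← mul_pow]
  exact pow_le_pow_left₀ h0.le h K

/-- The sum over a subset of the vectors of norm `M` which is fibred, with fibres of bounded growth,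
over the image of the lattice in a subspace. -/
theorem summable_of_fiber_growth (L : Submodule ℤ (QSpace n ℝ)) (hd : DiscreteTopology L) {M : ℝ}
    (hM : M ≠ 0) (T : QSpace n ℝ →ₗ[ℝ] QSpace n ℝ) (hT : ∀ x ∈ L, T x ∈ L)
    (F : Submodule ℝ (QSpace n ℝ)) (hF : ∀ x, T x ∈ F) {K : ℕ} {D a : ℝ} (hD : 0 ≤ D)
    (hK : (finrank ℝ F : ℝ) < K - a) (p : {x : QSpace n ℝ // x ∈ L ∧ qV x = M} → Prop)
    [DecidablePred p]
    (hcard : ∀ (w : QSpace n ℝ) (s : Finset {x : QSpace n ℝ // x ∈ L ∧ qV x = M}),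
      (∀ x ∈ s, p x ∧ T x.1 = w) → (s.card : ℝ) ≤ D * (1 + ‖w‖) ^ a) :
    Summable fun x => if p x then (‖x.1‖ ^ K)⁻¹ else 0 := by
  obtain ⟨A, hA, hAx⟩ := exists_one_add_norm_le hM T
  have hs := summable_one_add_norm_map L hd T hT F hF hK
  set W := L.map (T.restrictScalars ℤ)
  set π : {x : QSpace n ℝ // x ∈ L ∧ qV x = M} → W := fun x =>
    ⟨T x.1, Submodule.mem_map_of_mem (f := T.restrictScalars ℤ) x.2.1⟩
  have hπ : ∀ x, (π x : QSpace n ℝ) = T x.1 := fun x => rfl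
  clear_value π
  refine summable_of_card_fiber (fun x => by positivity) p π
    (fun w => D * (1 + ‖(w : QSpace n ℝ)‖) ^ a)
    (fun w => A ^ K * (1 + ‖(w : QSpace n ℝ)‖) ^ (-(K : ℝ))) (fun w => by positivity)
    (fun w => by positivity) ?_ (fun x _ => ?_) fun w s hsw => hcard w s fun x hx => ?_
  · refine (hs.mul_left (D * A ^ K)).congr fun w => ?_
    have h0 : 0 < 1 + ‖(w : QSpace n ℝ)‖ := by positivity
    rw [show -((K : ℝ) - a) = a + -(K : ℝ) by ring, Real.rpow_add h0]
    ring
  · have h1 := hAx x.1 x.2.2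
    rw [← hπ] at h1
    exact inv_norm_pow_le h1 K
  · obtain ⟨h1, h2⟩ := hsw x hx
    exact ⟨h1, by rw [← hπ, h2]⟩

/-- Two isotropic vectors of `L` with nonzero product. -/
structure IsHyperbolicPair (L : Submodule ℤ (QSpace n ℝ)) (e e' : QSpace n ℝ) : Prop where
  mem : e ∈ L
  mem' : e' ∈ L
  isotropic : qV e = 0
  isotropic' : qV e' = 0
  pairing : bV e e' ≠ 0

theorem IsHyperbolicPair.symm {L : Submodule ℤ (QSpace n ℝ)} {e e' : QSpace n ℝ}
    (h : IsHyperbolicPair L e e') : IsHyperbolicPair L e' e :=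
  ⟨h.mem', h.mem, h.isotropic', h.isotropic, by rw [bV_comm]; exact h.pairing⟩

variable {L : Submodule ℤ (QSpace n ℝ)} {e e' : QSpace n ℝ} {M : ℝ} {K : ℕ}

theorem bV_eq_floor (hL : IsIntegralOn L) {x y : QSpace n ℝ} (hx : x ∈ L) (hy : y ∈ L) :
    bV x y = (⌊bV x y⌋ : ℤ) := by
  obtain ⟨k, hk⟩ := hL x hx y hy
  rw [hk, Int.floor_intCast]

/-- The scaled projection to the complement of a hyperbolic pair. -/
def projHyp (e e' : QSpace n ℝ) : QSpace n ℝ →ₗ[ℝ] QSpace n ℝ :=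
  bV e e' • LinearMap.id - (bLin e).smulRight e' - (bLin e').smulRight e

theorem projHyp_apply (e e' x : QSpace n ℝ) :
    projHyp e e' x = bV e e' • x - bV x e • e' - bV x e' • e := rfl

theorem IsHyperbolicPair.bV_self (h : IsHyperbolicPair L e e') : bV e e = 0 ∧ bV e' e' = 0 := by
  rw [PolarHarmonic.bV_self, PolarHarmonic.bV_self, h.isotropic, h.isotropic']
  simp

theorem IsHyperbolicPair.projHyp_orth (h : IsHyperbolicPair L e e') (x : QSpace n ℝ) :
    bV (projHyp e e' x) e = 0 ∧ bV (projHyp e e' x) e' = 0 := by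
  obtain ⟨h1, h2⟩ := h.bV_self
  rw [projHyp_apply]
  simp only [bV_sub_left, bV_smul_left, h1, h2, bV_comm e' e]
  constructor <;> ring

theorem qV_sub (x y : QSpace n ℝ) : qV (x - y) = qV x + qV y - bV x y := by
  have h : ∀ x : QSpace n ℝ, qV x = bV x x / 2 := fun x => by
    rw [PolarHarmonic.bV_self]; ring
  rw [h, h x, h y, bV_sub_left, bV_sub_right, bV_sub_right, bV_comm y x]
  ring

/-- For vectors of fixed norm, the projection therefore determines the product of the two pairings.
-/
theorem IsHyperbolicPair.qV_projHyp (h : IsHyperbolicPair L e e') (x : QSpace n ℝ) :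
    qV (projHyp e e' x) = bV e e' ^ 2 * qV x - bV e e' * (bV x e' * bV x e) := by
  rw [projHyp_apply, qV_sub, qV_sub, qV_smul, qV_smul, qV_smul, h.isotropic, h.isotropic']
  simp only [bV_sub_left, bV_smul_left, bV_smul_right, bV_comm e' e]
  ring

theorem IsHyperbolicPair.projHyp_mem (h : IsHyperbolicPair L e e') (hL : IsIntegralOn L)
    {x : QSpace n ℝ} (hx : x ∈ L) : projHyp e e' x ∈ L := by
  rw [projHyp_apply]
  exact L.sub_mem (L.sub_mem (zsmul_mem_real hx (hL _ h.mem _ h.mem'))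
    (zsmul_mem_real h.mem' (hL _ hx _ h.mem))) (zsmul_mem_real h.mem (hL _ hx _ h.mem'))

theorem exists_card_divisors_le {C₀ : ℝ} (hC₀ : 0 < C₀) : ∃ D ≥ 0, ∀ (k : ℤ) (t : ℝ), k ≠ 0 →
    0 < t → |(k : ℝ)| ≤ C₀ * t ^ 2 → 2 * (k.natAbs.divisors.card : ℝ) ≤ D * t ^ (1 / 2 : ℝ) := by
  obtain ⟨C, hC⟩ := exists_card_divisors_pow_four_le
  refine ⟨2 * ((C : ℝ) * C₀) ^ (1 / 4 : ℝ), by positivity, fun k t hk ht hkt => ?_⟩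
  have h1 : (k.natAbs : ℝ) = |(k : ℝ)| := by
    rw [← Int.cast_abs, Int.abs_eq_natAbs, Int.cast_natCast]
  have h9 : ((k.natAbs.divisors.card : ℝ)) ^ 4 ≤ (C : ℝ) * k.natAbs := by
    exact_mod_cast hC k.natAbs (Int.natAbs_ne_zero.2 hk)
  have h8 : ((k.natAbs.divisors.card : ℝ)) ^ 4 ≤ (C : ℝ) * C₀ * t ^ 2 := by
    rw [mul_assoc]
    rw [← h1] at hkt
    exact h9.trans (mul_le_mul_of_nonneg_left hkt (by positivity))
  have h10 : (((k.natAbs.divisors.card : ℝ)) ^ 4) ^ (1 / 4 : ℝ) = k.natAbs.divisors.card := by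
    rw [← Real.rpow_natCast, ← Real.rpow_mul (Nat.cast_nonneg _)]
    norm_num
  have h11 : (t ^ 2) ^ (1 / 4 : ℝ) = t ^ (1 / 2 : ℝ) := by
    rw [← Real.rpow_natCast, ← Real.rpow_mul ht.le]
    norm_num
  rw [mul_assoc, ← h10, ← h11, ← Real.mul_rpow (by positivity) (by positivity)]
  exact mul_le_mul_of_nonneg_left (Real.rpow_le_rpow (by positivity) h8 (by norm_num)) (by norm_num)

/-- Over `w` a vector is determined by the integers (x, e) and (x, e'). Their product is a fixed
nonzero integer of size O((1 + ‖w‖)²), so the fibre is bounded by twice its number of divisors. -/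
theorem IsHyperbolicPair.exists_card_fiber_le (h : IsHyperbolicPair L e e') (hL : IsIntegralOn L)
    (M : ℝ) : ∃ D ≥ 0, ∀ (w : QSpace n ℝ) (s : Finset {x : QSpace n ℝ // x ∈ L ∧ qV x = M}),
      (∀ x ∈ s, bV x.1 e' * bV x.1 e ≠ 0 ∧ projHyp e e' x.1 = w) →
      (s.card : ℝ) ≤ D * (1 + ‖w‖) ^ (1 / 2 : ℝ) := by
  classical
  have hc0 : bV e e' ≠ 0 := h.pairing
  set c := bV e e'
  have hc0' : 0 < |c| := abs_pos.2 hc0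
  obtain ⟨D, hD, hdiv⟩ := exists_card_divisors_le
    (C₀ := (c ^ 2 * |M| + (1 + n)) / |c|) (by positivity)
  refine ⟨D, hD, fun w s hsw => ?_⟩
  rcases s.eq_empty_or_nonempty with rfl | ⟨x₀, hx₀⟩
  · simp only [Finset.card_empty, Nat.cast_zero]; positivity
  have hprod : ∀ x ∈ s, c * (bV x.1 e' * bV x.1 e) = c ^ 2 * M - qV w := by
    intro x hx
    have h1 := h.qV_projHyp x.1
    rw [(hsw x hx).2, x.2.2] at h1
    linarith
  have hfl : ∀ x : {x : QSpace n ℝ // x ∈ L ∧ qV x = M},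
      bV x.1 e' = (⌊bV x.1 e'⌋ : ℤ) ∧ bV x.1 e = (⌊bV x.1 e⌋ : ℤ) := fun x =>
    ⟨bV_eq_floor hL x.2.1 h.mem', bV_eq_floor hL x.2.1 h.mem⟩
  obtain ⟨k, hk⟩ : ∃ k : ℤ, k = ⌊bV x₀.1 e'⌋ * ⌊bV x₀.1 e⌋ := ⟨_, rfl⟩
  have hkr : ((k : ℤ) : ℝ) = bV x₀.1 e' * bV x₀.1 e := by
    rw [hk, Int.cast_mul, ← (hfl x₀).1, ← (hfl x₀).2]
  have hk0 : k ≠ 0 := by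
    intro h0
    apply (hsw x₀ hx₀).1
    rw [← hkr, h0, Int.cast_zero]
  have hcard : s.card = (s.image fun x => (⌊bV x.1 e'⌋, ⌊bV x.1 e⌋)).card := by
    rw [Finset.card_image_of_injOn]
    intro x hx y hy hxy
    have h1 := congrArg Prod.fst hxy
    have h2 := congrArg Prod.snd hxy
    simp only at h1 h2
    have h3 : bV x.1 e' = bV y.1 e' := by rw [(hfl x).1, (hfl y).1, h1]
    have h4 : bV x.1 e = bV y.1 e := by rw [(hfl x).2, (hfl y).2, h2]
    have h5 : projHyp e e' x.1 = projHyp e e' y.1 := (hsw x hx).2.trans (hsw y hy).2.symm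
    rw [projHyp_apply, projHyp_apply, h3, h4, sub_left_inj, sub_left_inj] at h5
    exact Subtype.ext (smul_right_injective _ hc0 h5)
  have hle : s.card ≤ 2 * k.natAbs.divisors.card := by
    rw [hcard]
    refine card_factor_pairs_le hk0 _ fun z hz => ?_
    obtain ⟨x, hx, rfl⟩ := Finset.mem_image.1 hz
    have h1 : c * (bV x.1 e' * bV x.1 e) = c * (bV x₀.1 e' * bV x₀.1 e) := by
      rw [hprod x hx, hprod x₀ hx₀]
    have h2 := mul_left_cancel₀ hc0 h1
    rw [← hkr, (hfl x).1, (hfl x).2] at h2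
    exact_mod_cast h2
  have h12 : (s.card : ℝ) ≤ 2 * (k.natAbs.divisors.card : ℝ) := by exact_mod_cast hle
  refine h12.trans (hdiv k _ hk0 (by positivity) ?_)
  rw [div_mul_eq_mul_div, le_div_iff₀ hc0', ← abs_mul, hkr, mul_comm, hprod x₀ hx₀]
  refine (abs_sub _ _).trans ?_
  rw [abs_mul, abs_of_nonneg (sq_nonneg c)]
  have h3 := abs_qV_le w
  have h4 := norm_nonneg w
  have h5 : 0 ≤ c ^ 2 * |M| := by positivity
  have h6 : (0 : ℝ) ≤ 1 + n := by positivity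
  nlinarith [mul_nonneg h5 h4, mul_nonneg h6 h4, mul_nonneg h5 (sq_nonneg ‖w‖)]

/-- The projection lands in a space of dimension n. The divisor bound costs an exponent 1/2, which
is affordable because K ≥ n + 1. -/
theorem IsHyperbolicPair.summable_generic (h : IsHyperbolicPair L e e') (hL : IsIntegralOn L)
    (hd : DiscreteTopology L) (hM : M ≠ 0) (hK : n < K) :
    Summable fun x : {x : QSpace n ℝ // x ∈ L ∧ qV x = M} =>
      open Classical in if bV x.1 e' * bV x.1 e ≠ 0 then (‖x.1‖ ^ K)⁻¹ else 0 := by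
  classical
  obtain ⟨D, hD, hcard⟩ := h.exists_card_fiber_le hL M
  set F : Submodule ℝ (QSpace n ℝ) := LinearMap.ker (bLin e) ⊓ LinearMap.ker (bLin e')
  have hF : finrank ℝ F = n := by
    have := finrank_ker_inf (bLin e) (bLin e') e' e (by rw [bLin_apply, bV_comm]; exact h.pairing)
      h.bV_self.2 h.pairing h.bV_self.1
    rw [finrank_QSpace] at this
    exact Nat.add_right_cancel this
  refine summable_of_fiber_growth L hd hM (projHyp e e') (fun x hx => h.projHyp_mem hL hx) F
    (fun x => ⟨(h.projHyp_orth x).1, (h.projHyp_orth x).2⟩) hD ?_ _ hcard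
  rw [hF]
  have : (n : ℝ) + 1 ≤ K := by exact_mod_cast hK
  linarith

/-- The scaled projection which keeps only the component along `e` and the complement of
`e, e', v`. -/
def projLine (e e' v : QSpace n ℝ) : QSpace n ℝ →ₗ[ℝ] QSpace n ℝ :=
  (bV v v * bV e e') • LinearMap.id - (bV v v • bLin e).smulRight e' -
    (bV e e' • bLin v).smulRight v

theorem projLine_apply (e e' v x : QSpace n ℝ) : projLine e e' v x =
    (bV v v * bV e e') • x - (bV v v * bV x e) • e' - (bV e e' * bV x v) • v := rfl

/-- An anisotropic vector of `L` orthogonal to `e` and `e'`. -/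
structure IsComplementVector (L : Submodule ℤ (QSpace n ℝ)) (e e' v : QSpace n ℝ) : Prop where
  mem : v ∈ L
  orth : bV v e = 0
  orth' : bV v e' = 0
  anisotropic : bV v v ≠ 0

theorem IsComplementVector.symm {v : QSpace n ℝ} (h : IsComplementVector L e e' v) :
    IsComplementVector L e' e v := ⟨h.mem, h.orth', h.orth, h.anisotropic⟩

variable {v : QSpace n ℝ}

/-- If (x, e) = 0, the projection determines x up to its pairing with v, and the norm equation fixes
the square of that pairing. -/
theorem card_line_fiber_le (h : IsHyperbolicPair L e e') (hv : IsComplementVector L e e' v)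
    (w : QSpace n ℝ) (s : Finset {x : QSpace n ℝ // x ∈ L ∧ qV x = M})
    (hs : ∀ x ∈ s, bV x.1 e = 0 ∧ projLine e e' v x.1 = w) : s.card ≤ 2 := by
  classical
  have hc0 : bV e e' ≠ 0 := h.pairing
  have hd0 : bV v v ≠ 0 := hv.anisotropic
  rcases s.eq_empty_or_nonempty with rfl | ⟨x₀, hx₀⟩
  · simp
  have hx : ∀ x ∈ s, (bV v v * bV e e') • x.1 = w + (bV e e' * bV x.1 v) • v := by
    intro x hx
    obtain ⟨h1, h2⟩ := hs x hx
    rw [projLine_apply, h1, mul_zero, zero_smul, sub_zero] at h2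
    rw [← h2, sub_add_cancel]
  have hwv : bV w v = 0 := by
    have h1 := congrArg (fun y => bV y v) (hx x₀ hx₀)
    simp only [bV_add_left, bV_smul_left] at h1
    linear_combination -h1
  have hq : ∀ x ∈ s, (bV v v * bV e e') ^ 2 * M =
      qV w + (bV e e' * bV x.1 v) ^ 2 * qV v := by
    intro x hx'
    have h1 := congrArg qV (hx x hx')
    rw [qV_smul, x.2.2, qV_add, qV_smul, bV_smul_right, hwv] at h1
    linarith
  have hqv : qV v ≠ 0 := by
    intro h0
    apply hd0
    rw [PolarHarmonic.bV_self, h0, mul_zero]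
  have hinj : s.card = (s.image fun x => bV x.1 v).card := by
    rw [Finset.card_image_of_injOn]
    intro x hx1 y hy1 hxy
    simp only at hxy
    have h1 := (hx x hx1).trans (by rw [hxy, ← hx y hy1])
    exact Subtype.ext (smul_right_injective _ (mul_ne_zero hd0 hc0) h1)
  rw [hinj]
  refine (Finset.card_le_card (t := {bV x₀.1 v, -bV x₀.1 v}) fun t ht => ?_).trans
    Finset.card_le_two
  obtain ⟨x, hx1, rfl⟩ := Finset.mem_image.1 ht
  have h1 := (hq x hx1).symm.trans (hq x₀ hx₀)
  rw [add_right_inj] at h1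
  have h2 := mul_right_cancel₀ hqv h1
  rw [mul_pow, mul_pow] at h2
  have h3 := mul_left_cancel₀ (pow_ne_zero 2 hc0) h2
  rw [Finset.mem_insert, Finset.mem_singleton]
  exact sq_eq_sq_iff_eq_or_eq_neg.1 h3

/-- When (x, e) = 0 the norm equation does not restrict (x, e'), so `projHyp` is of no use. Keeping
the e-component and dropping v instead again gives an n-dimensional target, with fibres of at most
two elements. -/
theorem IsHyperbolicPair.summable_line (h : IsHyperbolicPair L e e')
    (hv : IsComplementVector L e e' v) (hL : IsIntegralOn L)
    (hd : DiscreteTopology L) (hM : M ≠ 0) (hK : n < K) :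
    Summable fun x : {x : QSpace n ℝ // x ∈ L ∧ qV x = M} =>
      open Classical in if bV x.1 e = 0 then (‖x.1‖ ^ K)⁻¹ else 0 := by
  classical
  have hev := hv.orth
  have hev' := hv.orth'
  rw [bV_comm] at hev hev'
  set F : Submodule ℝ (QSpace n ℝ) := LinearMap.ker (bLin v) ⊓ LinearMap.ker (bLin e)
  have hF : finrank ℝ F = n := by
    have := finrank_ker_inf (bLin v) (bLin e) v e' hv.anisotropic hv.orth
      (by rw [bLin_apply, bV_comm]; exact h.pairing) hev'
    rw [finrank_QSpace] at this
    exact Nat.add_right_cancel this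
  have hmem : ∀ x ∈ L, projLine e e' v x ∈ L := by
    intro x hx
    have hmul : ∀ a b : ℝ, (∃ k : ℤ, a = k) → (∃ k : ℤ, b = k) → ∃ k : ℤ, a * b = k := by
      rintro _ _ ⟨k, rfl⟩ ⟨l, rfl⟩
      exact ⟨k * l, by push_cast; rfl⟩
    have h1 := hL _ h.mem _ h.mem'
    have h2 := hL _ hv.mem _ hv.mem
    rw [projLine_apply]
    exact L.sub_mem (L.sub_mem (zsmul_mem_real hx (hmul _ _ h2 h1))
      (zsmul_mem_real h.mem' (hmul _ _ h2 (hL _ hx _ h.mem))))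
      (zsmul_mem_real hv.mem (hmul _ _ h1 (hL _ hx _ hv.mem)))
  have horth : ∀ x, projLine e e' v x ∈ F := by
    intro x
    have h1 : bV (projLine e e' v x) v = 0 := by
      rw [projLine_apply]
      simp only [bV_sub_left, bV_smul_left, hev']
      ring
    have h2 : bV (projLine e e' v x) e = 0 := by
      rw [projLine_apply]
      simp only [bV_sub_left, bV_smul_left, hv.orth, bV_comm e' e]
      ring
    exact ⟨h1, h2⟩
  refine summable_of_fiber_growth L hd hM (projLine e e' v) hmem F horth (D := 2) (a := 0)
    zero_le_two ?_ _ fun w s hsw => ?_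
  · rw [hF, sub_zero]
    exact_mod_cast hK
  · rw [Real.rpow_zero, mul_one]
    exact_mod_cast card_line_fiber_le h hv w s hsw

theorem summable_of_hyperbolic (h : IsHyperbolicPair L e e') (hv : IsComplementVector L e e' v)
    (hL : IsIntegralOn L) (hd : DiscreteTopology L) (hM : M ≠ 0) (hK : n < K) :
    Summable fun x : {x : QSpace n ℝ // x ∈ L ∧ qV x = M} => (‖x.1‖ ^ K)⁻¹ := by
  classical
  refine Summable.of_nonneg_of_le (fun x => by positivity) (fun x => ?_)
    (((h.summable_generic hL hd hM hK).add (h.summable_line hv hL hd hM hK)).add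
      (h.symm.summable_line hv.symm hL hd hM hK))
  have h0 : 0 ≤ (‖x.1‖ ^ K)⁻¹ := by positivity
  by_cases h1 : bV x.1 e = 0
  · simp only [h1, mul_zero, ne_eq, not_true_eq_false, if_true, if_false, zero_add]
    split_ifs <;> linarith
  · by_cases h2 : bV x.1 e' = 0
    · simp [h1, h2]
    · simp [h1, h2]

/-- The sum over the vectors of fixed nonzero norm in the lattice. -/
theorem IsAdmissibleLattice.summable {m : ℕ} {L : Submodule ℤ (QSpace (m + 1) ℝ)}
    (h : IsAdmissibleLattice L) {M : ℝ} (hM : M ≠ 0) {K : ℕ} (hK : m + 1 < K) :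
    Summable fun x : {x : QSpace (m + 1) ℝ // x ∈ L ∧ qV x = M} => (‖x.1‖ ^ K)⁻¹ := by
  have hL : IsIntegralOn L := by
    intro x hx y hy
    obtain ⟨a, ha⟩ := h.even x hx
    obtain ⟨b, hb⟩ := h.even y hy
    obtain ⟨c, hc⟩ := h.even (x + y) (L.add_mem hx hy)
    refine ⟨c - a - b, ?_⟩
    rw [qV_add, ha, hb] at hc
    push_cast
    linarith
  set e : QSpace (m + 1) ℝ := (1, 0, 0) with he
  have hqe : qV e = 0 := by simp [he, qV, qW]
  obtain ⟨y, hy, hye⟩ : ∃ y ∈ L, bV y e ≠ 0 := by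
    by_contra! hcon
    have h1 : Submodule.span ℝ (L : Set (QSpace (m + 1) ℝ)) ≤ LinearMap.ker (bLin e) :=
      Submodule.span_le.2 fun y hy => hcon y hy
    rw [h.spans] at h1
    have h2 : bV ((0, 1, 0) : QSpace (m + 1) ℝ) e = 0 := h1 Submodule.mem_top
    simp [he, bV] at h2
  -- This combination is isotropic because q((y, e) y) = (y, e)² q(y) is cancelled by the cross term
  -- with e; the pairing of e with it is (y, e)².
  set e' : QSpace (m + 1) ℝ := bV y e • y - qV y • e with he'
  have hpair : IsHyperbolicPair L e e' := by
    refine ⟨h.e_mem, L.sub_mem (zsmul_mem_real hy (hL y hy e h.e_mem))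
      (zsmul_mem_real h.e_mem (h.even y hy)), hqe, ?_, ?_⟩
    · rw [he', qV_sub, qV_smul, qV_smul, hqe, bV_smul_left, bV_smul_right]
      ring
    · have h1 : bV e e' = bV y e ^ 2 := by
        rw [he', bV_sub_right, bV_smul_right, bV_smul_right, bV_self, hqe, bV_comm e y]
        ring
      rw [h1]
      exact pow_ne_zero 2 hye
  -- Otherwise polarisation, extended linearly from the lattice to the whole space, would make every
  -- vector orthogonal to e and e' orthogonal to everything. Such nonzero vectors exist because the
  -- complement has dimension m + 1 ≥ 1, which contradicts nondegeneracy.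
  obtain ⟨x₁, hx₁, hq₁⟩ : ∃ x ∈ L, qV (projHyp e e' x) ≠ 0 := by
    by_contra! hcon
    have hc0 := hpair.pairing
    have h1 : ∀ x ∈ L, bV e e' * qV x = bV x e' * bV x e := by
      intro x hx
      have h2 := hcon x hx
      rw [hpair.qV_projHyp] at h2
      have h3 : bV e e' * (bV e e' * qV x) = bV e e' * (bV x e' * bV x e) := by linarith
      exact mul_left_cancel₀ hc0 h3
    have h2 : ∀ x ∈ L, ∀ z ∈ L, bV e e' * bV x z = bV x e' * bV z e + bV z e' * bV x e := by
      intro x hx z hz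
      have h3 := h1 (x + z) (L.add_mem hx hz)
      rw [qV_add, bV_add_left, bV_add_left] at h3
      linear_combination h3 - h1 x hx - h1 z hz
    have h4 : ∀ x ∈ L, ∀ z, bV e e' * bV z x = bV x e' * bV z e + bV z e' * bV x e := by
      intro x hx z
      have h5 : Submodule.span ℝ (L : Set (QSpace (m + 1) ℝ)) ≤ LinearMap.ker
          (bV e e' • bLin x - bV x e' • bLin e - bV x e • bLin e') := by
        refine Submodule.span_le.2 fun z hz => ?_
        have h6 := h2 x hx z hz
        change bV e e' * bV z x - bV x e' * bV z e - bV x e * bV z e' = 0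
        rw [bV_comm z x]
        linarith
      rw [h.spans] at h5
      have h6 : bV e e' * bV z x - bV x e' * bV z e - bV x e * bV z e' = 0 :=
        h5 (Submodule.mem_top (x := z))
      linarith
    have h7 := finrank_ker_inf (bLin e) (bLin e') e' e
      (by rw [bLin_apply, bV_comm]; exact hpair.pairing) hpair.bV_self.2 hpair.pairing
      hpair.bV_self.1
    rw [finrank_QSpace] at h7
    have h8 : (LinearMap.ker (bLin e) ⊓ LinearMap.ker (bLin e')) ≠ ⊥ := by
      intro h9
      rw [h9, finrank_bot] at h7
      omega
    obtain ⟨z, ⟨hz1, hz2⟩, hz0⟩ := Submodule.exists_mem_ne_zero_of_ne_bot h8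
    have hz1' : bV z e = 0 := hz1
    have hz2' : bV z e' = 0 := hz2
    apply hz0
    refine eq_zero_of_bV fun x => ?_
    have h10 : Submodule.span ℝ (L : Set (QSpace (m + 1) ℝ)) ≤ LinearMap.ker (bLin z) := by
      refine Submodule.span_le.2 fun x hx => ?_
      have h11 := h4 x hx z
      rw [hz1', hz2', mul_zero, zero_mul, add_zero] at h11
      have h12 := (mul_eq_zero.1 h11).resolve_left hc0
      change bV x z = 0
      rw [bV_comm]; exact h12
    rw [h.spans] at h10
    rw [bV_comm]
    exact h10 (Submodule.mem_top (x := x))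
  refine summable_of_hyperbolic hpair (v := projHyp e e' x₁) ⟨hpair.projHyp_mem hL hx₁,
    (hpair.projHyp_orth x₁).1, (hpair.projHyp_orth x₁).2, ?_⟩ hL h.discrete hM hK
  rw [bV_self]
  exact mul_ne_zero two_ne_zero hq₁

end Counting

end

end PolarHarmonic


namespace PolarHarmonic

open Module

noncomputable section

/-! ## The form `∑ p̃_Z(l)` of a summable family of vectors -/

section SumIdentities

open Topology Filter

/-- The operator `∂̄` as a continuous linear function of the derivative. -/
def dbarCLM (n k : ℕ) : (WC n →L[ℝ] Form n k) →L[ℝ] Form n (k + 1) :=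
  (ContinuousAlternatingMap.alternatizeUncurryFinCLM ℝ (WC n) ℂ).comp
    (ContinuousLinearMap.compL ℝ (WC n) (Form n k) (Form n k)
      (((1 / 2 : ℂ) • ContinuousLinearMap.id ℂ (Form n k)).restrictScalars ℝ) +
    (ContinuousLinearMap.compL ℝ (WC n) (Form n k) (Form n k)
      (((1 / 2 * Complex.I : ℂ) • ContinuousLinearMap.id ℂ (Form n k)).restrictScalars ℝ)).comp
    ((ContinuousLinearMap.compL ℝ (WC n) (WC n) (Form n k)).flip (mulI n)))
theorem dbar_eq_dbarCLM {n k : ℕ} (α : WC n → Form n k) (Z : WC n) :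
    dbar α Z = dbarCLM n k (fderiv ℝ α Z) := by
  rw [dbar, dbarCLM, ContinuousLinearMap.comp_apply, ContinuousAlternatingMap.alternatizeUncurryFinCLM_apply]
  congr 1
  ext v w
  simp [mul_assoc]

theorem dbar_add {n k : ℕ} {α β : WC n → Form n k} {Z : WC n} (hα : DifferentiableAt ℝ α Z)
    (hβ : DifferentiableAt ℝ β Z) : dbar (α + β) Z = dbar α Z + dbar β Z := by
  rw [dbar_eq_dbarCLM, dbar_eq_dbarCLM, dbar_eq_dbarCLM, fderiv_add hα hβ, map_add]

theorem dbarCLM_smul {n k : ℕ} (c : ℂ) (T : WC n →L[ℝ] Form n k) :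
    dbarCLM n k (c • T) = c • dbarCLM n k T := by
  rw [dbarCLM, ContinuousLinearMap.comp_apply, ContinuousLinearMap.comp_apply,
    ContinuousAlternatingMap.alternatizeUncurryFinCLM_apply,
    ContinuousAlternatingMap.alternatizeUncurryFinCLM_apply,
    ← ContinuousAlternatingMap.alternatizeUncurryFin_smul]
  congr 1
  ext v w
  simp [mul_left_comm]

theorem dbarCLM_neg {n k : ℕ} (T : WC n →L[ℝ] Form n k) : dbarCLM n k (-T) = -dbarCLM n k T := by
  have h : -T = (-1 : ℂ) • T := by ext v w; simp
  rw [h, dbarCLM_smul]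
  ext v
  simp

theorem dbar_smul {n k : ℕ} (c : ℂ) {α : WC n → Form n k} {Z : WC n}
    (hα : DifferentiableAt ℝ α Z) : dbar (c • α) Z = c • dbar α Z := by
  rw [dbar_eq_dbarCLM, dbar_eq_dbarCLM, fderiv_const_smul hα, dbarCLM_smul]

theorem dbar_congr {n k : ℕ} {α β : WC n → Form n k} {Z : WC n} (h : α =ᶠ[𝓝 Z] β) :
    dbar α =ᶠ[𝓝 Z] dbar β := by
  filter_upwards [h.eventuallyEq_nhds] with W hW
  rw [dbar_eq_dbarCLM, dbar_eq_dbarCLM, hW.fderiv_eq]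

theorem dbar_zero {n k : ℕ} (Z : WC n) : dbar (fun _ => (0 : Form n k)) Z = 0 := by
  rw [dbar_eq_dbarCLM]; simp

theorem starBar_eq_of_eq {n k l : ℕ} {p : ℕ} {h : l + k = 2 * n} {α β : WC n → Form n k} {Z : WC n}
    (hαβ : α Z = β Z) : starBar p h α Z = starBar p h β Z := by
  simp only [starBar, hαβ]

theorem starW_eq_of_eq {n k l : ℕ} {κ : ℤ} {p : ℕ} {h : l + k = 2 * n} {α β : WC n → Form n k}
    {Z : WC n} (hαβ : α Z = β Z) : starW κ p h α Z = starW κ p h β Z := by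
  rw [starW, starW, starBar_eq_of_eq hαβ]

theorem starW_congr {n k l : ℕ} {κ : ℤ} {p : ℕ} {h : l + k = 2 * n} {α β : WC n → Form n k}
    {Z : WC n} (hαβ : α =ᶠ[𝓝 Z] β) : starW κ p h α =ᶠ[𝓝 Z] starW κ p h β :=
  hαβ.mono fun _ hW => starW_eq_of_eq hW

theorem starW_eq_zero {n k l : ℕ} {κ : ℤ} {p : ℕ} {h : l + k = 2 * n} {β : WC n → Form n k}
    {Z : WC n} (hβ : β Z = 0) : starW κ p h β Z = 0 := by
  ext v
  simp [starW, starBar, hβ, ContinuousAlternatingMap.sum_apply]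

theorem starW_add {n k l : ℕ} {κ : ℤ} {p : ℕ} {h : l + k = 2 * n} {α β γ : WC n → Form n k}
    {Z : WC n} (hγ : γ Z = α Z + β Z) : starW κ p h γ Z = starW κ p h α Z + starW κ p h β Z := by
  ext v
  simp [starW, starBar, hγ, ContinuousAlternatingMap.sum_apply, add_mul, Finset.sum_add_distrib,
    mul_add]

theorem starW_smul {n k l : ℕ} {κ : ℤ} {p : ℕ} {h : l + k = 2 * n} {β γ : WC n → Form n k} (c : ℂ)
    {Z : WC n} (hγ : γ Z = c • β Z) :
    starW κ p h γ Z = (starRingEnd ℂ) c • starW κ p h β Z := by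
  ext v
  simp only [starW, starBar, hγ, ContinuousAlternatingMap.sum_apply,
    ContinuousAlternatingMap.smul_apply, smul_eq_mul, map_mul, Finset.mul_sum]
  refine Finset.sum_congr rfl fun a _ => ?_
  ring

theorem NormalSumAt.hasSum_dbar {C : Type} {ω : C → ℝ} {n k : ℕ} {g : C → WC n → Form n k}
    {Z : WC n} (hg : NormalSumAt ω g Z) :
    HasSum (fun c => dbar (g c) Z) (dbar (fun Z => ∑' c, g c Z) Z) := by
  simpa only [dbar_eq_dbarCLM] using hg.hasSum_fderiv.mapL (dbarCLM n k)

theorem xiTop_congr {m : ℕ} {κ : ℤ} {α β : WC (m + 1) → Form (m + 1) (2 * m + 1)} {Z : WC (m + 1)}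
    (h : α =ᶠ[𝓝 Z] β) : xiTop κ α Z = xiTop κ β Z :=
  starW_eq_of_eq (dbar_congr h).self_of_nhds

theorem laplaceTop_congr {m : ℕ} {κ : ℤ} {α β : WC (m + 1) → Form (m + 1) (2 * m + 1)}
    {Z : WC (m + 1)} (h : α =ᶠ[𝓝 Z] β) : laplaceTop κ α Z = laplaceTop κ β Z := by
  rw [laplaceTop, laplace, laplaceTop, laplace,
    starW_eq_of_eq (dbar_congr (starW_congr (dbar_congr h))).self_of_nhds,
    (dbar_congr (starW_congr (dbar_congr (starW_congr h)))).self_of_nhds]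

theorem zeroForm_add (n : ℕ) (a b : ℂ) : zeroForm n (a + b) = zeroForm n a + zeroForm n b := by
  ext v; simp [zeroForm]

theorem zeroForm_smul (n : ℕ) (c a : ℂ) : zeroForm n (c * a) = c • zeroForm n a := by
  ext v; simp [zeroForm]

theorem dbar_zeroForm_eq_zero {n : ℕ} {F : WC n → ℂ} {Z : WC n} (h : HasDbarAt F 0 Z) :
    dbar (fun Z => zeroForm n (F Z)) Z = 0 := by
  ext v
  rw [dbar_zeroForm h]
  simp

theorem analyticAt_smul_const {n k : ℕ} {f : WC n → ℂ} {Z : WC n} (hf : AnalyticAt ℝ f Z)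
    (T : WC n →L[ℝ] Form n k) : AnalyticAt ℝ (fun Z => f Z • T) Z := by
  have h : (fun Z => f Z • T) =
      fun Z => Complex.reCLM.smulRight T (f Z) + Complex.imCLM.smulRight (Complex.I • T) (f Z) := by
    funext W
    ext v w
    change f W * T v w = ((f W).re : ℂ) * T v w + ((f W).im : ℂ) * (Complex.I * T v w)
    conv_lhs => rw [← Complex.re_add_im (f W), add_mul, mul_assoc]
  rw [h]
  exact ((ContinuousLinearMap.analyticAt _ _).comp hf).add
    ((ContinuousLinearMap.analyticAt _ _).comp hf)

theorem analyticAt_starOne {n k : ℕ} {m : ℕ} (hn : n = m + 1) (h : k + 1 = 2 * n) (κ : ℤ)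
    {Z : WC n} (hZ : Z ∈ upperHalf n) : AnalyticAt ℝ (fun Z => starOne h κ Z) Z := by
  subst hn
  have hq := qC_ne_zero hZ
  have h1 := IsSummableFamily.analyticAt_qC Z
  have h2 : ∀ i j, AnalyticAt ℝ (fun Z : WC (m + 1) => ((metricInv (imW Z) i j : ℝ) : ℂ)) Z := by
    intro i j
    have h3 : (fun Z : WC (m + 1) => ((metricInv (imW Z) i j : ℝ) : ℂ)) = fun Z =>
        4 * ((Z i).im : ℂ) * ((Z j).im : ℂ) - (if i = j then 2 * eps ℂ i else 0) * qC Z := by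
      funext W
      rw [metricInv, qC]
      split_ifs with h
      · simp only [imW]
        push_cast
        rw [eps_ofReal]
        ring
      · simp [imW]
    rw [h3]
    exact ((analyticAt_const.mul (IsSummableFamily.analyticAt_im_coord Z i)).mul
      (IsSummableFamily.analyticAt_im_coord Z j)).sub (analyticAt_const.mul h1)
  have h4 : AnalyticAt ℝ (fun Z : WC (m + 1) => qC Z ^ κ * ((4 * Complex.I * qC Z) ^ (m + 1))⁻¹) Z :=
    (h1.zpow hq).mul ((((analyticAt_const.mul h1).pow _)).inv
      (pow_ne_zero _ (by simp [hq])))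
  unfold starOne
  refine Finset.analyticAt_fun_sum _ fun i _ => Finset.analyticAt_fun_sum _ fun j _ => ?_
  exact analyticAt_smul_const (h4.mul ((h2 i j).div_const)) _

end SumIdentities

end

end PolarHarmonic


namespace PolarHarmonic

open Module

noncomputable section

/-! ### ξ and the Laplacian on the sum over a summable family -/

section FamilySum

open Topology Filter

variable {m : ℕ} {C : Type} {K : ℕ} {M : ℝ}

/-- The points of the upper half plane that lie on none of the divisors of the family `l`. -/
def offDivisors (l : C → QSpace (m + 1) ℝ) : Set (WC (m + 1)) :=
  {Z | Z ∈ upperHalf (m + 1) ∧ ∀ c, pairPsi (l c) Z ≠ 0}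

namespace IsSummableFamily

variable {l : C → QSpace (m + 1) ℝ}

theorem offDivisors_mem_nhds (h : IsSummableFamily K M l) {Z : WC (m + 1)}
    (hZ : Z ∈ offDivisors l) : offDivisors l ∈ 𝓝 Z := by
  let _ : TopologicalSpace C := ⊥
  have : DiscreteTopology C := ⟨rfl⟩
  exact Filter.inter_mem (isOpen_upperHalf.mem_nhds hZ.1)
    (h.uniformAnalyticAt_inv_pairPsi hZ.1 hZ.2).2.2

theorem pTilde_eq (h : IsSummableFamily K M l) (hK : m + 1 < K) {Z : WC (m + 1)}
    (hZ : Z ∈ offDivisors l) (c : C) :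
    pTilde K (l c) Z = starOne (k := 2 * m + 1) (by omega) K Z (betaV K (l c) Z) :=
  pTilde_eq_starOne (by exact_mod_cast hK) (by rw [h.norm_eq c]; exact h.neg) hZ.1 (hZ.2 c)

theorem normalSumAt_beta (h : IsSummableFamily K M l) (hK : m + 1 < K) {Z : WC (m + 1)}
    (hZ : Z ∈ offDivisors l) :
    NormalSumAt (fun c => (‖l c‖ ^ K)⁻¹) (fun c Z => betaV K (l c) Z) Z := by
  let _ : TopologicalSpace C := ⊥
  have : DiscreteTopology C := ⟨rfl⟩
  exact h.normalSumAt_betaV hK hZ.1 hZ.2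

theorem normalSumAt_mero (h : IsSummableFamily K M l) {Z : WC (m + 1)} (hZ : Z ∈ offDivisors l) :
    NormalSumAt (fun c => (‖l c‖ ^ K)⁻¹) (fun c Z => pairPsi (l c) Z ^ (-(K : ℤ))) Z := by
  let _ : TopologicalSpace C := ⊥
  have : DiscreteTopology C := ⟨rfl⟩
  exact h.normalSumAt_inv_pow hZ.1 hZ.2

theorem normalSumAt_pTilde (h : IsSummableFamily K M l) (hK : m + 1 < K) {Z : WC (m + 1)}
    (hZ : Z ∈ offDivisors l) :
    NormalSumAt (fun c => (‖l c‖ ^ K)⁻¹) (fun c Z => pTilde K (l c) Z) Z := by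
  refine ((h.normalSumAt_beta hK hZ).clm_apply h.summable
    (analyticAt_starOne rfl (k := 2 * m + 1) (by omega) K hZ.1)).congr ?_
  filter_upwards [h.offDivisors_mem_nhds hZ] with W hW c
  exact (h.pTilde_eq hK hW c).symm

theorem summable_mero (h : IsSummableFamily K M l) {Z : WC (m + 1)} (hZ : Z ∈ offDivisors l) :
    Summable fun c => pairPsi (l c) Z ^ (-(K : ℤ)) :=
  ((h.normalSumAt_mero hZ).eventually_summable h.summable).self_of_nhds

theorem tsum_pTilde_eq (h : IsSummableFamily K M l) (hK : m + 1 < K) {Z : WC (m + 1)}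
    (hZ : Z ∈ offDivisors l) : ∑' c, pTilde K (l c) Z =
      starOne (k := 2 * m + 1) (by omega) K Z (∑' c, betaV K (l c) Z) := by
  rw [tsum_congr (h.pTilde_eq hK hZ), ContinuousLinearMap.map_tsum _
    ((h.normalSumAt_beta hK hZ).eventually_summable h.summable).self_of_nhds]

theorem tsum_pTilde_isOfType (h : IsSummableFamily K M l) (hK : m + 1 < K) {Z : WC (m + 1)}
    (hZ : Z ∈ offDivisors l) : IsOfType (m + 1) m (∑' c, pTilde K (l c) Z) := by
  rw [h.tsum_pTilde_eq hK hZ]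
  exact starOne_isOfType K Z _

theorem dbar_pTilde (h : IsSummableFamily K M l) (hK : m + 1 < K) {Z : WC (m + 1)}
    (hZ : Z ∈ offDivisors l) (c : C) : dbar (pTilde K (l c)) Z =
      (((4 * Complex.I * qC Z) ^ (m + 1))⁻¹ * qC Z ^ (K : ℤ) *
        (starRingEnd ℂ) (pairPsi (l c) Z ^ (-(K : ℤ)))) • detZ (by omega) := by
  have h1 : pTilde K (l c) =ᶠ[𝓝 Z]
      fun Z => starOne (k := 2 * m + 1) (by omega) K Z (betaV K (l c) Z) := by
    filter_upwards [h.offDivisors_mem_nhds hZ] with W hW using h.pTilde_eq hK hW c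
  rw [(dbar_congr h1).self_of_nhds, dbar_starOne_betaV _ (by exact_mod_cast hK)
    (by rw [h.norm_eq c]; exact h.neg) hZ.1 (hZ.2 c), map_zpow₀, pairPsi_conjW]

theorem dbar_tsum_pTilde (h : IsSummableFamily K M l) (hK : m + 1 < K) {Z : WC (m + 1)}
    (hZ : Z ∈ offDivisors l) : dbar (fun Z => ∑' c, pTilde K (l c) Z) Z =
      (((4 * Complex.I * qC Z) ^ (m + 1))⁻¹ * qC Z ^ (K : ℤ) *
        (starRingEnd ℂ) (∑' c, pairPsi (l c) Z ^ (-(K : ℤ)))) • detZ (by omega) := by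
  have h1 := (h.normalSumAt_pTilde hK hZ).hasSum_dbar
  simp only [h.dbar_pTilde hK hZ] at h1
  refine h1.unique ?_
  have h2 := ((Complex.conjCLE : ℂ →L[ℝ] ℂ).hasSum (h.summable_mero hZ).hasSum).mul_left
    (((4 * Complex.I * qC Z) ^ (m + 1))⁻¹ * qC Z ^ (K : ℤ))
  exact h2.smul_const _

/-- The termwise formula for ∂̄ gives the conjugate of the holomorphic sum; the antilinear star
undoes the conjugation and the weight cancels q(Y)^K. -/
theorem xiTop_tsum_pTilde (h : IsSummableFamily K M l) (hK : m + 1 < K) {Z : WC (m + 1)}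
    (hZ : Z ∈ offDivisors l) : xiTop (-(K : ℤ)) (fun Z => ∑' c, pTilde K (l c) Z) Z =
      zeroForm (m + 1) (∑' c, pairPsi (l c) Z ^ (-(K : ℤ))) := by
  have hq := qC_ne_zero hZ.1
  have hq' : ((4 * Complex.I * qC Z) ^ (m + 1)) ≠ 0 := pow_ne_zero _ (by simp [hq])
  rw [xiTop, xi, starW, starBar_top (Nat.succ_ne_zero m) _ (by omega) _ Z hZ.1.1.ne' _
    (h.dbar_tsum_pTilde hK hZ), ← zeroForm_smul]
  congr 1
  change qC Z ^ (-(K : ℤ)) * (starRingEnd ℂ) (_ * (4 * Complex.I * qC Z) ^ (m + 1)) = _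
  have h1 : ∀ x : ℂ, ((4 * Complex.I * qC Z) ^ (m + 1))⁻¹ * qC Z ^ (K : ℤ) * x *
      (4 * Complex.I * qC Z) ^ (m + 1) = qC Z ^ (K : ℤ) * x := fun x => by
    field_simp
  rw [h1, map_mul, Complex.conj_conj, map_zpow₀, conj_qC, zpow_neg, inv_mul_cancel_left₀]
  exact zpow_ne_zero _ hq

/-- Each term is holomorphic, and the derivative of the sum is the sum of the derivatives. -/
theorem dbar_mero_eq_zero (h : IsSummableFamily K M l) {Z : WC (m + 1)} (hZ : Z ∈ offDivisors l) :
    dbar (fun Z => zeroForm (m + 1) (∑' c, pairPsi (l c) Z ^ (-(K : ℤ)))) Z = 0 := by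
  have hN := h.normalSumAt_mero hZ
  have h0 : ∀ c k, 1 / 2 * (fderiv ℝ (fun Z => pairPsi (l c) Z ^ (-(K : ℤ))) Z (Pi.single k 1) +
      Complex.I * fderiv ℝ (fun Z => pairPsi (l c) Z ^ (-(K : ℤ))) Z (Pi.single k Complex.I)) =
        0 := by
    intro c k
    have h1 := ((hasDbarAt_pairPsi (l c) Z).zpow (-(K : ℤ)) (hZ.2 c)).dbarAt_eq k
    rw [dbarAt] at h1
    rw [h1]
    simp
  refine dbar_zeroForm_eq_zero ⟨_, hN.analytic.differentiableAt.hasFDerivAt, fun k => ?_⟩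
  have h1 := hN.hasSum_fderiv.mapL (ContinuousLinearMap.apply ℝ ℂ (Pi.single k 1 : WC (m + 1)))
  have h2 := hN.hasSum_fderiv.mapL
    (ContinuousLinearMap.apply ℝ ℂ (Pi.single k Complex.I : WC (m + 1)))
  have h3 := (h1.add (h2.mul_left Complex.I)).mul_left (1 / 2)
  simp only [ContinuousLinearMap.apply_apply, h0] at h3
  exact h3.unique hasSum_zero

theorem dbar_oneForm_tsum_eq_zero (h : IsSummableFamily K M l) (hK : m + 1 < K) {Z : WC (m + 1)}
    (hZ : Z ∈ offDivisors l) :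
    dbar (fun Z => oneForm (∑' c, betaV K (l c) Z)) Z = 0 := by
  have h1 := (h.normalSumAt_beta hK hZ).clm_apply h.summable
    (analyticAt_const (v := (oneForm (n := m + 1))))
  have h2 := h1.hasSum_dbar
  have h3 : (fun Z => ∑' c, oneForm (betaV K (l c) Z)) =ᶠ[𝓝 Z]
      fun Z => oneForm (∑' c, betaV K (l c) Z) := by
    filter_upwards [(h.normalSumAt_beta hK hZ).eventually_summable h.summable] with W hW
    exact (ContinuousLinearMap.map_tsum _ hW).symm
  rw [(dbar_congr h3).self_of_nhds] at h2
  refine h2.unique ?_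
  have h4 : ∀ c, dbar (fun Z => oneForm (betaV K (l c) Z)) Z = 0 := fun c =>
    dbar_oneForm_betaV (by exact_mod_cast hK) (by rw [h.norm_eq c]; exact h.neg) hZ.1 (hZ.2 c)
  simpa only [h4] using hasSum_zero

/-- In the first half, ξ of the sum is a holomorphic function and is killed by ∂̄. In the second,
the star returns minus the sum of the forms β, which is ∂̄-closed. -/
theorem laplaceTop_tsum_pTilde (h : IsSummableFamily K M l) (hK : m + 1 < K) {Z : WC (m + 1)}
    (hZ : Z ∈ offDivisors l) : laplaceTop (-(K : ℤ)) (fun Z => ∑' c, pTilde K (l c) Z) Z = 0 := by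
  have hU := h.offDivisors_mem_nhds hZ
  rw [laplaceTop, laplace]
  have h1 : starW (l := 0) (k := 2 * m + 1 + 1) (-(K : ℤ)) (m + 1) (by omega)
      (dbar fun Z => ∑' c, pTilde K (l c) Z) =ᶠ[𝓝 Z]
        fun Z => zeroForm (m + 1) (∑' c, pairPsi (l c) Z ^ (-(K : ℤ))) := by
    filter_upwards [hU] with W hW using h.xiTop_tsum_pTilde hK hW
  have h2 : starW (l := 0 + 1) (k := 2 * m + 1) (-(K : ℤ)) (m + 1) (by omega)
      (fun Z => ∑' c, pTilde K (l c) Z) =ᶠ[𝓝 Z] fun Z => -oneForm (∑' c, betaV K (l c) Z) := by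
    filter_upwards [hU] with W hW
    exact (starW_eq_of_eq (h.tsum_pTilde_eq hK hW)).trans
      (starW_starOne (k := 2 * m + 1) (by omega) (by omega) K hW.1
        fun Z => ∑' c, betaV K (l c) Z)
  have h3 : dbar (starW (l := 0 + 1) (k := 2 * m + 1) (-(K : ℤ)) (m + 1) (by omega)
      (fun Z => ∑' c, pTilde K (l c) Z)) =ᶠ[𝓝 Z] fun _ => 0 := by
    filter_upwards [dbar_congr h2, hU] with W hW hW'
    rw [hW, dbar_eq_dbarCLM, fderiv_fun_neg, dbarCLM_neg, ← dbar_eq_dbarCLM,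
      h.dbar_oneForm_tsum_eq_zero hK hW', neg_zero]
  have h4 : starW (l := 2 * m) (k := 0 + 1 + 1) (-(-(K : ℤ))) (m + 1 - (m + 1)) (by omega)
      (dbar (starW (l := 0 + 1) (k := 2 * m + 1) (-(K : ℤ)) (m + 1) (by omega)
        (fun Z => ∑' c, pTilde K (l c) Z))) =ᶠ[𝓝 Z] fun _ => 0 := by
    filter_upwards [h3] with W hW using starW_eq_zero hW
  rw [starW_eq_zero, (dbar_congr h4).self_of_nhds, dbar_zero, add_zero]
  rw [(dbar_congr h1).self_of_nhds, h.dbar_mero_eq_zero hZ]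

end IsSummableFamily

end FamilySum

end

end PolarHarmonic


namespace PolarHarmonic

open Module

noncomputable section

/-! ## The family of vectors attached to the cosets `Γ_ν \ Γ` -/

section CosetFamily

open Topology Filter

variable {m : ℕ} {L : Submodule ℤ (QSpace (m + 1) ℝ)} {Γ : Subgroup (LinAut (m + 1))}
  {v : QSpace (m + 1) ℝ}

/-- The vector `γ⁻¹ ν` attached to the coset `Γ_ν γ`. -/
def cosetVec (Γ : Subgroup (LinAut (m + 1))) (v : QSpace (m + 1) ℝ) (c : Cosets Γ v) :
    QSpace (m + 1) ℝ := ((c.out : LinAut (m + 1)))⁻¹ v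

theorem apply_inv_apply (g : LinAut (m + 1)) (x : QSpace (m + 1) ℝ) : g (g⁻¹ x) = x :=
  g.apply_symm_apply x

theorem inv_apply_apply (g : LinAut (m + 1)) (x : QSpace (m + 1) ℝ) : g⁻¹ (g x) = x :=
  g.symm_apply_apply x

/-- The coset Γ_ν γ corresponds to the point γ⁻¹ν of the orbit of ν, so sums over cosets become sums
over distinct vectors. -/
theorem mk_eq_mk_iff (g h : Γ) :
    (Quotient.mk _ g : Cosets Γ v) = Quotient.mk _ h ↔
      (g : LinAut (m + 1))⁻¹ v = (h : LinAut (m + 1))⁻¹ v := by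
  rw [Quotient.eq, QuotientGroup.rightRel_apply, MulAction.mem_stabilizer_iff]
  change (h : LinAut (m + 1)) ((g : LinAut (m + 1))⁻¹ v) = v ↔ _
  constructor
  · intro H
    rw [← inv_apply_apply (h : LinAut (m + 1)) ((g : LinAut (m + 1))⁻¹ v), H]
  · intro H
    rw [H, apply_inv_apply]

theorem cosetVec_mk (g : Γ) : cosetVec Γ v (Quotient.mk _ g) = (g : LinAut (m + 1))⁻¹ v := by
  rw [cosetVec, ← mk_eq_mk_iff, Quotient.out_eq]

theorem cosetVec_injective : Function.Injective (cosetVec Γ v) := fun c d h => by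
  rw [← Quotient.out_eq c, ← Quotient.out_eq d, mk_eq_mk_iff]
  exact h

/-- Right translation of the cosets `Γ_ν \ Γ`. -/
def cosetMul (g : Γ) (c : Cosets Γ v) : Cosets Γ v := Quotient.mk _ (c.out * g)

theorem cosetVec_cosetMul (g : Γ) (c : Cosets Γ v) :
    cosetVec Γ v (cosetMul g c) = (g : LinAut (m + 1))⁻¹ (cosetVec Γ v c) := by
  rw [cosetMul, cosetVec_mk, Subgroup.coe_mul, mul_inv_rev]
  rfl

theorem cosetMul_bijective (g : Γ) : Function.Bijective (cosetMul g : Cosets Γ v → Cosets Γ v) := by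
  refine ⟨fun c d h => cosetVec_injective ?_, fun d => ⟨cosetMul g⁻¹ d, cosetVec_injective ?_⟩⟩
  · have h1 := congrArg (cosetVec Γ v) h
    rw [cosetVec_cosetMul, cosetVec_cosetMul] at h1
    exact ((g : LinAut (m + 1))⁻¹).injective h1
  · rw [cosetVec_cosetMul, cosetVec_cosetMul, Subgroup.coe_inv, inv_inv, inv_apply_apply]

/-- A multiple N ν lies in the lattice, which Γ preserves. The vectors N γ⁻¹ν are distinct lattice
vectors of norm N² q(ν), and rescaling only changes the sum by a constant. -/
theorem isSummableFamily_cosetVec (hL : IsAdmissibleLattice L)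
    (hΓ : ∀ g ∈ Γ, IsOPlusLattice L g) (hv : IsRationalVec L v) (hneg : qV v < 0) {K : ℕ}
    (hK : m + 1 < K) : IsSummableFamily K (qV v) (cosetVec Γ v) := by
  have hq : ∀ c : Cosets Γ v, qV (cosetVec Γ v c) = qV v := fun c =>
    (hΓ _ (Γ.inv_mem c.out.2)).1.1 v
  refine ⟨hq, hneg, ?_⟩
  obtain ⟨N, hN, hNv⟩ := hv
  have hN' : (N : ℝ) ≠ 0 := by exact_mod_cast hN
  have hqN : ∀ x : QSpace (m + 1) ℝ, qV (N • x) = (N : ℝ) ^ 2 * qV x := fun x => by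
    rw [← Int.cast_smul_eq_zsmul ℝ]
    simp only [qV, qW, Prod.smul_fst, Prod.smul_snd, Pi.smul_apply, smul_eq_mul, mul_add,
      Finset.mul_sum]
    congr 1
    · ring
    · exact Finset.sum_congr rfl fun j _ => by ring
  have hmem : ∀ c : Cosets Γ v, N • cosetVec Γ v c ∈ L ∧
      qV (N • cosetVec Γ v c) = (N : ℝ) ^ 2 * qV v := fun c => by
    refine ⟨?_, by rw [hqN, hq]⟩
    have h1 := ((hΓ _ (Γ.inv_mem c.out.2)).2 (N • v)).2 hNv
    rwa [map_zsmul] at h1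
  have h1 := (hL.summable (mul_ne_zero (pow_ne_zero 2 hN') hneg.ne) hK).comp_injective
    (i := fun c : Cosets Γ v => ⟨N • cosetVec Γ v c, hmem c⟩) (fun c d h => by
      refine cosetVec_injective ?_
      have h2 : N • cosetVec Γ v c = N • cosetVec Γ v d := congrArg Subtype.val h
      rw [← Int.cast_smul_eq_zsmul ℝ, ← Int.cast_smul_eq_zsmul ℝ] at h2
      exact smul_right_injective _ hN' h2)
  refine (h1.mul_left (|(N : ℝ)| ^ K)).congr fun c => ?_
  have h3 : |(N : ℝ)| ^ K ≠ 0 := pow_ne_zero _ (abs_ne_zero.2 hN')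
  change |(N : ℝ)| ^ K * (‖N • cosetVec Γ v c‖ ^ K)⁻¹ = _
  rw [← Int.cast_smul_eq_zsmul ℝ, norm_smul, Real.norm_eq_abs, mul_pow,
    mul_inv, mul_inv_cancel_left₀ h3]

theorem slashForm_pTilde_inv (hΓ : ∀ g ∈ Γ, IsOPlusLattice L g) (κ : ℤ) {g : LinAut (m + 1)}
    (hg : g ∈ Γ) {Z : WC (m + 1)} (hZ : Z ∈ upperHalf (m + 1)) (x : QSpace (m + 1) ℝ) :
    slashForm (-κ) g (pTilde κ x) Z = pTilde κ (g⁻¹ x) Z := by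
  conv_lhs => rw [← apply_inv_apply g x]
  exact slashForm_pTilde κ (hΓ g hg).1 hZ _

theorem polarTerm_eq (hΓ : ∀ g ∈ Γ, IsOPlusLattice L g) (κ : ℤ) (c : Cosets Γ v)
    {Z : WC (m + 1)} (hZ : Z ∈ upperHalf (m + 1)) :
    polarTerm κ Γ v c Z = pTilde κ (cosetVec Γ v c) Z :=
  slashForm_pTilde_inv hΓ κ c.out.2 hZ v

theorem pairPsi_act_inv (hΓ : ∀ g ∈ Γ, IsOPlusLattice L g) {g : LinAut (m + 1)}
    (hg : g ∈ Γ) {Z : WC (m + 1)} (hZ : Z ∈ upperHalf (m + 1)) (x : QSpace (m + 1) ℝ) :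
    autFactor g Z * pairPsi x (act g Z) = pairPsi (g⁻¹ x) Z := by
  rw [← pairPsi_act (hΓ g hg).1 hZ (g⁻¹ x), apply_inv_apply]

theorem meroTerm_eq (hΓ : ∀ g ∈ Γ, IsOPlusLattice L g) (κ : ℤ) (c : Cosets Γ v)
    {Z : WC (m + 1)} (hZ : Z ∈ upperHalf (m + 1)) :
    meroTerm κ Γ v c Z = pairPsi (cosetVec Γ v c) Z ^ (-κ) := by
  rw [meroTerm, slashFun, cosetVec, ← pairPsi_act_inv hΓ c.out.2 hZ, mul_zpow, zpow_neg (pairPsi _ _),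
    one_div]

theorem qPlus_eq_zero_iff {x : QSpace (m + 1) ℝ} {Z : WC (m + 1)} (hZ : Z ∈ upperHalf (m + 1)) :
    qPlus x Z = 0 ↔ pairPsi x Z = 0 := by
  have := hZ.1.ne'
  rw [qPlus_eq x hZ]
  simp [this]

/-- The translate of the divisor of ν by γ⁻¹ is the divisor of γ⁻¹ν, by the transformation law of
the pairing. -/
theorem regularSet_eq_offDivisors (hΓ : ∀ g ∈ Γ, IsOPlusLattice L g) :
    regularSet Γ v = offDivisors (cosetVec Γ v) := by
  ext Z
  refine and_congr_right fun hZ => ?_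
  rw [singularSet, Set.mem_ofPred_eq, not_iff_comm]
  push Not
  constructor
  · rintro ⟨c, hc⟩
    have hg := c.out.2
    have hgZ := (hΓ _ hg).1.2 Z hZ
    refine ⟨_, Γ.inv_mem hg, act c.out Z, ⟨hgZ, (qPlus_eq_zero_iff hgZ).2 ?_⟩, ?_⟩
    · have h1 := pairPsi_act_inv hΓ hg hZ v
      change _ = pairPsi (cosetVec Γ v c) Z at h1
      rw [hc] at h1
      exact (mul_eq_zero.1 h1).resolve_left (autFactor_ne_zero (hΓ _ hg).1 hZ)
    · have h1 := act_act_inv (hΓ _ (Γ.inv_mem hg)).1 (g := (c.out : LinAut (m + 1))⁻¹)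
        (by rw [inv_inv]; exact (hΓ _ hg).1) hZ
      rw [inv_inv] at h1
      exact h1.symm
  · rintro ⟨g, hg, Z₀, ⟨hZ₀, h0⟩, rfl⟩
    refine ⟨Quotient.mk _ ⟨g⁻¹, Γ.inv_mem hg⟩, ?_⟩
    rw [cosetVec_mk]
    have h1 := pairPsi_act_inv hΓ hg hZ₀ (g v)
    rw [inv_apply_apply, (qPlus_eq_zero_iff hZ₀).1 h0] at h1
    simpa using (mul_eq_zero.1 h1).resolve_left (autFactor_ne_zero (hΓ _ hg).1 hZ₀)

theorem act_mem_offDivisors (hΓ : ∀ g ∈ Γ, IsOPlusLattice L g) {g : LinAut (m + 1)} (hg : g ∈ Γ)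
    {Z : WC (m + 1)} (hZ : Z ∈ offDivisors (cosetVec Γ v)) :
    act g Z ∈ offDivisors (cosetVec Γ v) := by
  refine ⟨(hΓ g hg).1.2 Z hZ.1, fun c h0 => hZ.2 (cosetMul ⟨g, hg⟩ c) ?_⟩
  rw [cosetVec_cosetMul, ← pairPsi_act_inv hΓ hg hZ.1, h0, mul_zero]

theorem polarMaass_eq (hΓ : ∀ g ∈ Γ, IsOPlusLattice L g) (κ : ℤ) {Z : WC (m + 1)}
    (hZ : Z ∈ upperHalf (m + 1)) :
    polarMaass κ Γ v Z = ∑' c, pTilde κ (cosetVec Γ v c) Z :=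
  tsum_congr fun c => polarTerm_eq hΓ κ c hZ

theorem polarMaass_eventuallyEq (hΓ : ∀ g ∈ Γ, IsOPlusLattice L g) (κ : ℤ) {Z : WC (m + 1)}
    (hZ : Z ∈ upperHalf (m + 1)) :
    polarMaass κ Γ v =ᶠ[𝓝 Z] fun Z => ∑' c, pTilde κ (cosetVec Γ v c) Z := by
  filter_upwards [isOpen_upperHalf.mem_nhds hZ] with W hW using polarMaass_eq hΓ κ hW

theorem meroForm_eq (hΓ : ∀ g ∈ Γ, IsOPlusLattice L g) (κ : ℤ) {Z : WC (m + 1)}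
    (hZ : Z ∈ upperHalf (m + 1)) :
    meroForm κ Γ v Z = ∑' c, pairPsi (cosetVec Γ v c) Z ^ (-κ) :=
  tsum_congr fun c => meroTerm_eq hΓ κ c hZ

/-- The slash operator at a point is a continuous linear map, so it passes through the sum; right
translation by `g` then permutes the cosets. -/
theorem slashForm_polarMaass (hΓ : ∀ g ∈ Γ, IsOPlusLattice L g) {K : ℕ} {M : ℝ}
    (h : IsSummableFamily K M (cosetVec Γ v)) (hK : m + 1 < K) {g : LinAut (m + 1)} (hg : g ∈ Γ)
    {Z : WC (m + 1)} (hZ : Z ∈ offDivisors (cosetVec Γ v)) :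
    slashForm (-(K : ℤ)) g (polarMaass K Γ v) Z = polarMaass K Γ v Z := by
  have hgZ := act_mem_offDivisors hΓ hg hZ
  have h1 := ((h.normalSumAt_pTilde hK hgZ).eventually_summable h.summable).self_of_nhds.hasSum
  have h2 := (h1.mapL (ContinuousAlternatingMap.compContinuousLinearMapCLM
    (fderiv ℝ (act g) Z))).const_smul (autFactor g Z ^ (-(-(K : ℤ))))
  rw [polarMaass_eq hΓ _ hZ.1, slashForm, polarMaass_eq hΓ _ hgZ.1]
  refine h2.tsum_eq.symm.trans ?_
  rw [← (Equiv.ofBijective _ (cosetMul_bijective (v := v) ⟨g, hg⟩)).tsum_eq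
    fun c => pTilde K (cosetVec Γ v c) Z]
  refine tsum_congr fun c => ?_
  rw [Equiv.ofBijective_apply, cosetVec_cosetMul]
  exact slashForm_pTilde_inv hΓ K hg hZ.1 _

end CosetFamily

theorem NormalSumAt.exists_mem_nhds {C : Type} {E F : Type*} [NormedAddCommGroup E] [NormedSpace ℝ E]
    [NormedAddCommGroup F] [NormedSpace ℝ F] {ω : C → ℝ} {g : C → E → F} {x : E}
    (hg : NormalSumAt ω g x) (hω : Summable ω) :
    ∃ t ∈ nhds x, ∃ u : C → ℝ, Summable u ∧ ∀ c, ∀ y ∈ t, ‖g c y‖ ≤ u c := by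
  obtain ⟨M, hM⟩ := hg.bound
  exact ⟨_, hM, _, hω.mul_left M, fun c y hy => hy c⟩

/-! ## The map between the spans -/

section Spans

variable {m : ℕ} {κ : ℤ} {L : Submodule ℤ (QSpace (m + 1) ℝ)} {Γ : Subgroup (LinAut (m + 1))}

/-- Off finitely many divisors `F` is differentiable and `ξ_κ F = f`. -/
def XiRelated (κ : ℤ) (L : Submodule ℤ (QSpace (m + 1) ℝ)) (Γ : Subgroup (LinAut (m + 1)))
    (F : WC (m + 1) → Form (m + 1) (2 * m + 1)) (f : WC (m + 1) → ℂ) : Prop :=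
  ∃ s : Set (QSpace (m + 1) ℝ), s.Finite ∧ (∀ v ∈ s, IsRationalVec L v ∧ qV v < 0) ∧
    ∀ Z ∈ upperHalf (m + 1), (∀ v ∈ s, Z ∉ singularSet Γ v) →
      DifferentiableAt ℝ F Z ∧ xiTop κ F Z = zeroForm (m + 1) (f Z)

namespace XiRelated

variable {F G : WC (m + 1) → Form (m + 1) (2 * m + 1)} {f g : WC (m + 1) → ℂ}

theorem eqAwayFromDivisors (h : XiRelated κ L Γ F f) :
    EqAwayFromDivisors L Γ (xiTop κ F) (fun Z => zeroForm (m + 1) (f Z)) := by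
  obtain ⟨s, h1, h2, h3⟩ := h
  exact ⟨s, h1, h2, fun Z hZ hs => (h3 Z hZ hs).2⟩

theorem zero : XiRelated κ L Γ 0 0 := by
  refine ⟨∅, Set.finite_empty, by simp, fun Z _ _ => ⟨differentiableAt_const 0, ?_⟩⟩
  refine (starW_eq_zero (dbar_zero Z)).trans ?_
  ext v
  simp [zeroForm]

theorem add (hF : XiRelated κ L Γ F f) (hG : XiRelated κ L Γ G g) :
    XiRelated κ L Γ (F + G) (f + g) := by
  obtain ⟨s, h1, h2, h3⟩ := hF
  obtain ⟨t, h1', h2', h3'⟩ := hG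
  refine ⟨s ∪ t, h1.union h1', fun v hv => hv.elim (h2 v) (h2' v), fun Z hZ hs => ?_⟩
  obtain ⟨h4, h5⟩ := h3 Z hZ fun v hv => hs v (Or.inl hv)
  obtain ⟨h6, h7⟩ := h3' Z hZ fun v hv => hs v (Or.inr hv)
  refine ⟨h4.add h6, ?_⟩
  rw [Pi.add_apply, zeroForm_add, ← h5, ← h7]
  exact starW_add (dbar_add h4 h6)

/-- ξ is antilinear because the Hodge star is. -/
theorem smul (hF : XiRelated κ L Γ F f) (c : ℂ) :
    XiRelated κ L Γ (c • F) ((starRingEnd ℂ) c • f) := by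
  obtain ⟨s, h1, h2, h3⟩ := hF
  refine ⟨s, h1, h2, fun Z hZ hs => ?_⟩
  obtain ⟨h4, h5⟩ := h3 Z hZ hs
  refine ⟨h4.const_smul c, ?_⟩
  rw [Pi.smul_apply, smul_eq_mul, zeroForm_smul, ← h5]
  exact starW_smul c (dbar_smul c h4)

end XiRelated

/-- The induction over the span runs on `XiRelated` because ∂̄ is additive only where both forms are
differentiable; the exceptional sets of divisors are united along the way. -/
theorem exists_meroSpace (hgen : ∀ v, IsRationalVec L v → qV v < 0 →
      XiRelated (-κ) L Γ (polarMaass κ Γ v) (meroForm κ Γ v))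
    {F : WC (m + 1) → Form (m + 1) (2 * m + 1)} (hF : F ∈ polarSpace κ L Γ) :
    ∃ f ∈ meroSpace κ L Γ, XiRelated (-κ) L Γ F f := by
  induction hF using Submodule.span_induction with
  | mem F hF =>
    obtain ⟨v, h1, h2, rfl⟩ := hF
    exact ⟨_, Submodule.subset_span ⟨v, h1, h2, rfl⟩, hgen v h1 h2⟩
  | zero => exact ⟨0, zero_mem _, .zero⟩
  | add F G _ _ hF hG =>
    obtain ⟨f, hf, h1⟩ := hF
    obtain ⟨g, hg, h2⟩ := hG
    exact ⟨f + g, add_mem hf hg, h1.add h2⟩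
  | smul c F _ hF =>
    obtain ⟨f, hf, h1⟩ := hF
    exact ⟨_, Submodule.smul_mem _ _ hf, h1.smul c⟩

theorem exists_polarSpace (hgen : ∀ v, IsRationalVec L v → qV v < 0 →
      XiRelated (-κ) L Γ (polarMaass κ Γ v) (meroForm κ Γ v))
    {f : WC (m + 1) → ℂ} (hf : f ∈ meroSpace κ L Γ) :
    ∃ F ∈ polarSpace κ L Γ, XiRelated (-κ) L Γ F f := by
  induction hf using Submodule.span_induction with
  | mem f hf =>
    obtain ⟨v, h1, h2, rfl⟩ := hf
    exact ⟨_, Submodule.subset_span ⟨v, h1, h2, rfl⟩, hgen v h1 h2⟩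
  | zero => exact ⟨0, zero_mem _, .zero⟩
  | add f g _ _ hf hg =>
    obtain ⟨F, hF, h1⟩ := hf
    obtain ⟨G, hG, h2⟩ := hg
    exact ⟨F + G, add_mem hF hG, h1.add h2⟩
  | smul c f _ hf =>
    obtain ⟨F, hF, h1⟩ := hf
    -- The preimage is scaled by the conjugate, since ξ conjugates scalars.
    refine ⟨_, Submodule.smul_mem _ ((starRingEnd ℂ) c) hF, ?_⟩
    have h2 := h1.smul ((starRingEnd ℂ) c)
    rwa [Complex.conj_conj] at h2

end Spans

end

end PolarHarmonic

/-! ### Proof of the main theorem -/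

open PolarHarmonic
theorem mainTheorem6 (m : ℕ) (L : Submodule ℤ (QSpace (m + 1) ℝ)) (hL : IsAdmissibleLattice L)
    (Γ : Subgroup (LinAut (m + 1)))
    (hΓ : IsCongruenceSubgroup L Γ) (hneat : IsNeat Γ)
    (κ : ℤ) (hκ : ((m + 1 : ℕ) : ℤ) < κ) :
    (∀ v : QSpace (m + 1) ℝ, IsRationalVec L v → qV v < 0 →
      -- the summands depend only on the coset
      (∀ g ∈ Γ, g v = v → ∀ Z ∈ upperHalf (m + 1) \ specialDivisor v,
        slashForm (-κ) g (pTilde κ v) Z = pTilde κ v Z) ∧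
      -- absolute and locally uniform convergence
      SummableLocallyUniformlyOn (fun c Z => ‖polarTerm κ Γ v c Z‖) (regularSet Γ v) ∧
      HasSumLocallyUniformlyOn (polarTerm κ Γ v) (polarMaass κ Γ v) (regularSet Γ v) ∧
      -- a real analytic form of type `(n, n - 1)` and weight `-κ`
      AnalyticOnNhd ℝ (polarMaass κ Γ v) (regularSet Γ v) ∧
      (∀ Z ∈ regularSet Γ v, IsOfType (m + 1) m (polarMaass κ Γ v Z)) ∧
      (∀ g ∈ Γ, ∀ Z ∈ regularSet Γ v,
        slashForm (-κ) g (polarMaass κ Γ v) Z = polarMaass κ Γ v Z) ∧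
      -- `ξ_{-κ} Ω = ω`
      (∀ Z ∈ regularSet Γ v, Summable (fun c => meroTerm κ Γ v c Z) ∧
        xiTop (-κ) (polarMaass κ Γ v) Z = zeroForm (m + 1) (meroForm κ Γ v Z)) ∧
      -- harmonicity
      (∀ Z ∈ regularSet Γ v, laplaceTop (-κ) (polarMaass κ Γ v) Z = 0)) ∧
    -- `ξ_{-κ}` maps the space of polar harmonic Maass forms onto the span of the `ω_ν`
    (∀ F ∈ polarSpace κ L Γ, ∃ f ∈ meroSpace κ L Γ, EqAwayFromDivisors L Γ
      (xiTop (-κ) F) (fun Z => zeroForm (m + 1) (f Z))) ∧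
    (∀ f ∈ meroSpace κ L Γ, ∃ F ∈ polarSpace κ L Γ, EqAwayFromDivisors L Γ
      (xiTop (-κ) F) (fun Z => zeroForm (m + 1) (f Z))) := by
  -- The weight exceeds n, hence is positive; natural exponents suit the bounds by powers of ‖l‖.
  lift κ to ℕ using by omega
  have hK : m + 1 < κ := by exact_mod_cast hκ
  have hO := hΓ.1
  have key : ∀ v, IsRationalVec L v → qV v < 0 → ∀ Z ∈ regularSet Γ v,
      xiTop (-(κ : ℤ)) (polarMaass κ Γ v) Z = zeroForm (m + 1) (meroForm κ Γ v Z) ∧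
        AnalyticAt ℝ (polarMaass κ Γ v) Z := by
    intro v hv hneg Z hZ
    have hfam := isSummableFamily_cosetVec hL hO hv hneg hK
    rw [regularSet_eq_offDivisors hO] at hZ
    have he := polarMaass_eventuallyEq (v := v) hO κ hZ.1
    refine ⟨?_, (hfam.normalSumAt_pTilde hK hZ).analytic.congr he.symm⟩
    rw [xiTop_congr he, hfam.xiTop_tsum_pTilde hK hZ, meroForm_eq hO _ hZ.1]
  have hgen : ∀ v, IsRationalVec L v → qV v < 0 →
      XiRelated (-(κ : ℤ)) L Γ (polarMaass κ Γ v) (meroForm κ Γ v) := fun v hv hneg =>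
    ⟨{v}, Set.finite_singleton v, by rintro w rfl; exact ⟨hv, hneg⟩, fun Z hZ hs =>
      have h := key v hv hneg Z ⟨hZ, hs v rfl⟩
      ⟨h.2.differentiableAt, h.1⟩⟩
  refine ⟨fun v hv hneg => ?_, fun F hF => ?_, fun f hf => ?_⟩
  · have hfam := isSummableFamily_cosetVec hL hO hv hneg hK
    have hreg := regularSet_eq_offDivisors (v := v) hO
    -- A local Weierstrass bound; it gives local uniform convergence both of the series and of the
    -- series of norms.
    have hbound : ∀ Z ∈ regularSet Γ v, ∃ t ∈ nhdsWithin Z (regularSet Γ v),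
        ∃ u : Cosets Γ v → ℝ, Summable u ∧ ∀ c, ∀ y ∈ t, ‖polarTerm κ Γ v c y‖ ≤ u c := by
      intro Z hZ
      rw [hreg] at hZ
      have h1 : NormalSumAt _ (polarTerm κ Γ v) Z :=
        (hfam.normalSumAt_pTilde hK hZ).congr <| by
          filter_upwards [isOpen_upperHalf.mem_nhds hZ.1] with W hW c
            using (polarTerm_eq hO κ c hW).symm
      obtain ⟨t, ht, h2⟩ := h1.exists_mem_nhds hfam.summable
      exact ⟨t, mem_nhdsWithin_of_mem_nhds ht, h2⟩
    refine ⟨fun g hg hgv Z hZ => ?_, ?_, ?_, fun Z hZ => (key v hv hneg Z hZ).2, fun Z hZ => ?_,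
      fun g hg Z hZ => ?_, fun Z hZ => ⟨?_, (key v hv hneg Z hZ).1⟩, fun Z hZ => ?_⟩
    · conv_lhs => rw [← hgv]
      exact slashForm_pTilde κ (hO g hg).1 hZ.1 v
    · refine HasSumLocallyUniformlyOn.summableLocallyUniformlyOn
        (hasSumLocallyUniformlyOn_of_of_forall_exists_nhds
          (g := fun Z => ∑' c, ‖polarTerm κ Γ v c Z‖) fun Z hZ => ?_)
      obtain ⟨t, ht, u, hu, hb⟩ := hbound Z hZ
      exact ⟨t, ht, .of_norm_le_summable hu fun c y hy => (norm_norm _).trans_le (hb c y hy)⟩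
    · refine hasSumLocallyUniformlyOn_of_of_forall_exists_nhds fun Z hZ => ?_
      obtain ⟨t, ht, u, hu, hb⟩ := hbound Z hZ
      exact ⟨t, ht, .of_norm_le_summable hu hb⟩
    · rw [hreg] at hZ
      rw [polarMaass_eq hO _ hZ.1]
      exact hfam.tsum_pTilde_isOfType hK hZ
    · rw [hreg] at hZ
      exact slashForm_polarMaass hO hfam hK hg hZ
    · rw [hreg] at hZ
      exact (hfam.summable_mero hZ).congr fun c => (meroTerm_eq hO κ c hZ.1).symm
    · rw [hreg] at hZ
      rw [laplaceTop_congr (polarMaass_eventuallyEq hO κ hZ.1)]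
      exact hfam.laplaceTop_tsum_pTilde hK hZ
  · obtain ⟨f, hf, h⟩ := exists_meroSpace hgen hF
    exact ⟨f, hf, h.eqAwayFromDivisors⟩
  · obtain ⟨F, hF, h⟩ := exists_polarSpace hgen hf
    exact ⟨F, hF, h.eqAwayFromDivisors⟩
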